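/- Setting. For an irrational $x=[0;a_1,a_2,\dots]\in[0,1]$ put $?(x)=2\sum_{n\ge1}(-1)^{n+1}2^{-(a_1+\dots+a_n)}$, extended by continuity to an increasing bijection of $[0,1]$ (Minkowski's question-mark function), and let $\mu$ be the Minkowski measure $d\mu=d?$ on $[0,1]$. Let $\mathbb D=\{t\in\mathbb C:|t-\frac23|<1\}$ and let $H^\infty(\mathbb D)$ be the space of bounded holomorphic functions on $\mathbb D$ with the supremum norm. For $\tau,z\in\mathbb C$ with $|z|<1$ let $\mathbb H_{\tau,z}$ be the bounded operator on $H^\infty(\mathbb D)$ $$\mathbb H_{\tau,z}[f](t)=\sum_{n\ge1}\frac{z^n}{(n+t)^\tau}\,f\Big(\frac1{n+t}\Big),$$ with the principal determination of the power. A simple dominant eigenvalue of a bounded operator is an eigenvalue $\lambda$ of algebraic multiplicity one such that the rest of the spectrum lies in a disc centred at $0$ of radius $<|\lambda|$; it is unique if it exists. Proposition. There is $\delta_0>0$ such that for every $0<\delta\le\delta_0$ the following holds. For $|\tau|\le\delta$ and $|z-\frac12|\le\delta$ the operator $\mathbb H_{\tau,z}$ has a simple dominant eigenvalue $\lambda(\tau,z)$.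 For some $\eta\in(0,\delta]$ there is a function $\rho$, analytic on (a neighbourhood of) the disc $|\tau|\le\eta$, with $|\rho(\tau)-\frac12|\le\delta$ and $\lambda(\tau,\rho(\tau))=1$ for $|\tau|\le\eta$. Every such $\rho$ (for any such $\eta$) satisfies $\rho(0)=\frac12$, that is, $\log(2\rho(0))=0$, and $$(\log\rho)'(0)=\alpha:=-\frac12\int_{(0,1]}\log x\,d\mu(x),\qquad (\log\rho)''(0)<0 .$$ More precisely, $$\begin{aligned}(\log\rho)''(0)&=-\frac12\int_0^1\big(\log x+\alpha\lfloor\tfrac1x\rfloor\big)^2d\mu(x)+\int_0^1\!\int_0^1\big(\log x+\alpha\lfloor\tfrac1x\rfloor\big)\log(1+xy)\,d\mu(x)\,d\mu(y)\\&=-\frac12\int_0^1\Big(\log x+\alpha\lfloor\tfrac1x\rfloor+\int_0^1\log\Big(\frac{1+y\{\frac1x\}}{1+yx}\Big)d\mu(y)\Big)^2d\mu(x),\end{aligned}$$ where all the integrals are absolutely convergent. -/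

import Mathlib

open Set Filter Topology MeasureTheory

noncomputable section

/-! ### The Minkowski question-mark function and the Minkowski measure -/

/-- The fractional part `{1/x}`, which drives the continued fraction expansion (value `0` at `0`). -/
def fractInv (x : ℝ) : ℝ := Int.fract (1 / x)

/-- The partial quotient `a_{n+1}` of `x = [0; a₁, a₂, …] ∈ [0, 1]`; it is `0` once the
expansion of a rational `x` has stopped. -/
def cfDigit (x : ℝ) (n : ℕ) : ℕ := ⌊1 / (fractInv^[n] x)⌋₊

/-- The term `(-1)^n 2^{1 - (a₁ + ⋯ + a_{n+1})}`, which is `0` once the expansion of a rational `x`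
has stopped. -/
def questionTerm (x : ℝ) (n : ℕ) : ℝ :=
  if fractInv^[n] x = 0 then 0
  else 2 * (-1) ^ n / 2 ^ (∑ i ∈ Finset.range (n + 1), cfDigit x i)

/-- The Minkowski question-mark function on `[0, 1]`,
`?([0; a₁, a₂, …]) = 2 ∑_{n ≥ 1} (-1)^{n+1} / 2^{a₁ + ⋯ + a_n}`, where the sum is finite for
rational arguments. -/
def questionMark (x : ℝ) : ℝ := ∑' n, questionTerm x n

lemma fractInv_mem (x : ℝ) : fractInv x ∈ Icc (0 : ℝ) 1 :=
  ⟨Int.fract_nonneg _, (Int.fract_lt_one _).le⟩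

lemma iterate_fractInv_mem {x : ℝ} (hx : x ∈ Icc (0 : ℝ) 1) (n : ℕ) :
    fractInv^[n] x ∈ Icc (0 : ℝ) 1 := by
  cases n with
  | zero => simpa using hx
  | succ n => rw [Function.iterate_succ_apply']; exact fractInv_mem _

lemma fractInv_zero : fractInv 0 = 0 := by simp [fractInv]

lemma iterate_fractInv_zero (n : ℕ) : fractInv^[n] 0 = 0 := by
  induction n with
  | zero => rfl
  | succ n ih => rw [Function.iterate_succ_apply, fractInv_zero, ih]

lemma questionTerm_at_zero (n : ℕ) : questionTerm 0 n = 0 := by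
  simp [questionTerm, iterate_fractInv_zero]

lemma one_le_floor_inv {x : ℝ} (hx : x ∈ Icc (0 : ℝ) 1) (h0 : x ≠ 0) : 1 ≤ ⌊1 / x⌋₊ := by
  have hpos : 0 < x := lt_of_le_of_ne hx.1 (Ne.symm h0)
  apply Nat.le_floor
  rw [Nat.cast_one, le_div_iff₀ hpos]
  linarith [hx.2]

lemma cfDigit_succ (x : ℝ) (n : ℕ) : cfDigit x (n + 1) = cfDigit (fractInv x) n := by
  simp [cfDigit, Function.iterate_succ_apply]

lemma questionTerm_succ {x : ℝ} (n : ℕ) :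
    questionTerm x (n + 1) = -(questionTerm (fractInv x) n / 2 ^ ⌊1 / x⌋₊) := by
  unfold questionTerm
  rw [Function.iterate_succ_apply]
  split_ifs with h
  · simp
  · rw [Finset.sum_range_succ']
    simp only [cfDigit_succ]
    have : cfDigit x 0 = ⌊1 / x⌋₊ := by simp [cfDigit]
    rw [this, pow_succ, pow_add, ← div_div]
    ring

lemma abs_questionTerm_le {x : ℝ} (hx : x ∈ Icc (0 : ℝ) 1) (n : ℕ) :
    |questionTerm x n| ≤ 2 * (1 / 2) ^ n := by
  induction n generalizing x with
  | zero =>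
    unfold questionTerm
    split_ifs with h
    · simp
    · have : (1 : ℝ) ≤ 2 ^ (∑ i ∈ Finset.range (0 + 1), cfDigit x i) :=
        one_le_pow₀ (by norm_num)
      rw [abs_of_nonneg (by positivity), pow_zero, pow_zero, div_le_iff₀ (by positivity)]
      linarith
  | succ n ih =>
    by_cases h0 : x = 0
    · subst h0
      rw [questionTerm_at_zero]
      simp
    · rw [questionTerm_succ, abs_neg, abs_div, abs_of_pos (by positivity : (0 : ℝ) < 2 ^ ⌊1 / x⌋₊)]
      have h1 := ih (fractInv_mem x)
      have h2 : (2 : ℝ) ^ 1 ≤ 2 ^ ⌊1 / x⌋₊ :=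
        pow_le_pow_right₀ (by norm_num) (one_le_floor_inv hx h0)
      rw [div_le_iff₀ (by positivity), pow_succ]
      have h3 : (0 : ℝ) ≤ (1 / 2) ^ n := by positivity
      nlinarith

/-- Partial sums of the series take values in `[0, 1]` and are nondecreasing functions. -/
lemma questionPartial_aux (N : ℕ) :
    (∀ x ∈ Icc (0 : ℝ) 1, ∑ n ∈ Finset.range N, questionTerm x n ∈ Icc (0 : ℝ) 1) ∧
    MonotoneOn (fun x => ∑ n ∈ Finset.range N, questionTerm x n) (Icc (0 : ℝ) 1) := by
  induction N with
  | zero => simp [monotoneOn_const]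
  | succ N ih =>
    obtain ⟨ih1, ih2⟩ := ih
    have hz : ∑ n ∈ Finset.range (N + 1), questionTerm 0 n = 0 :=
      Finset.sum_eq_zero fun n _ => questionTerm_at_zero n
    have hrec : ∀ x : ℝ, x ≠ 0 → ∑ n ∈ Finset.range (N + 1), questionTerm x n =
        (2 - ∑ n ∈ Finset.range N, questionTerm (fractInv x) n) / 2 ^ ⌊1 / x⌋₊ := by
      intro x h0
      rw [Finset.sum_range_succ']
      simp only [questionTerm_succ]
      rw [Finset.sum_neg_distrib, ← Finset.sum_div]
      have : questionTerm x 0 = 2 / 2 ^ ⌊1 / x⌋₊ := by simp [questionTerm, cfDigit, h0]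
      rw [this]
      ring
    have bd : ∀ x ∈ Icc (0 : ℝ) 1,
        ∑ n ∈ Finset.range (N + 1), questionTerm x n ∈ Icc (0 : ℝ) 1 := by
      intro x hx
      by_cases h0 : x = 0
      · subst h0; rw [hz]; simp
      · rw [hrec x h0]
        have h1 := ih1 _ (fractInv_mem x)
        have h2 : (2 : ℝ) ^ 1 ≤ 2 ^ ⌊1 / x⌋₊ :=
          pow_le_pow_right₀ (by norm_num) (one_le_floor_inv hx h0)
        refine ⟨div_nonneg (by linarith [h1.2]) (by positivity), ?_⟩
        rw [div_le_one (by positivity)]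
        linarith [h1.1]
    refine ⟨bd, ?_⟩
    intro x hx y hy hxy
    change ∑ n ∈ Finset.range (N + 1), questionTerm x n ≤
      ∑ n ∈ Finset.range (N + 1), questionTerm y n
    by_cases h0 : x = 0
    · subst h0; rw [hz]; exact (bd y hy).1
    have hxp : 0 < x := lt_of_le_of_ne hx.1 (Ne.symm h0)
    have hyp : 0 < y := hxp.trans_le hxy
    have hinv : 1 / y ≤ 1 / x := one_div_le_one_div_of_le hxp hxy
    rw [hrec x h0, hrec y hyp.ne']
    have hxm := ih1 _ (fractInv_mem x)
    have hym := ih1 _ (fractInv_mem y)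
    rcases (Nat.floor_le_floor hinv).eq_or_lt with he | hl
    · rw [he]
      have hf : fractInv y ≤ fractInv x := by
        have e1 : fractInv x = 1 / x - (⌊1 / x⌋₊ : ℝ) := by
          rw [fractInv, Int.fract, natCast_floor_eq_intCast_floor (by positivity)]
        have e2 : fractInv y = 1 / y - (⌊1 / y⌋₊ : ℝ) := by
          rw [fractInv, Int.fract, natCast_floor_eq_intCast_floor (by positivity)]
        rw [e1, e2, he]
        linarith
      have := ih2 (fractInv_mem y) (fractInv_mem x) hf
      simp only at this
      gcongr
    · have h2 : (2 : ℝ) * 2 ^ ⌊1 / y⌋₊ ≤ 2 ^ ⌊1 / x⌋₊ := by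
        rw [← pow_succ']
        exact pow_le_pow_right₀ (by norm_num) hl
      have hp : (0 : ℝ) < 2 ^ ⌊1 / y⌋₊ := by positivity
      rw [div_le_div_iff₀ (by positivity) hp]
      nlinarith [hxm.1, hym.2]

lemma hasSum_questionMark {x : ℝ} (hx : x ∈ Icc (0 : ℝ) 1) :
    HasSum (questionTerm x) (questionMark x) := by
  apply Summable.hasSum
  refine Summable.of_norm_bounded (g := fun n => 2 * (1 / 2 : ℝ) ^ n)
    (summable_geometric_two.mul_left 2) ?_
  intro n
  exact abs_questionTerm_le hx n

lemma monotoneOn_questionMark : MonotoneOn questionMark (Icc (0 : ℝ) 1) := by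
  intro x hx y hy hxy
  exact le_of_tendsto_of_tendsto' (hasSum_questionMark hx).tendsto_sum_nat
    (hasSum_questionMark hy).tendsto_sum_nat fun N => (questionPartial_aux N).2 hx hy hxy

/-- The function `?` extended to the real line by `0` on the left and by `1` on the right
of `[0, 1]`. -/
def questionMarkExt (x : ℝ) : ℝ := questionMark (projIcc (0 : ℝ) 1 zero_le_one x)

lemma monotone_questionMarkExt : Monotone questionMarkExt := fun x y hxy =>
  monotoneOn_questionMark (projIcc (0 : ℝ) 1 zero_le_one x).2 (projIcc (0 : ℝ) 1 zero_le_one y).2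
    (monotone_projIcc zero_le_one hxy)

/-- The Minkowski measure `dμ = d?`: the Lebesgue-Stieltjes measure of the (continuous,
nondecreasing) function `?`. It is a probability measure carried by `[0, 1]`. -/
def minkowskiMeasure : Measure ℝ := monotone_questionMarkExt.stieltjesFunction.measure

/-! ### The space `H^∞(𝔻)` and the transfer operators -/

/-- The disc `𝔻 = {t : |t - 2/3| < 1}`. -/
def gaussDisc : Set ℂ := Metric.ball (2 / 3 : ℂ) 1

/-- The space `H^∞(𝔻)` of bounded holomorphic functions on `𝔻`, with the supremum norm. -/
def Hinf : Submodule ℂ (BoundedContinuousFunction gaussDisc ℂ) where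
  carrier := {f | ∃ F : ℂ → ℂ, DifferentiableOn ℂ F gaussDisc ∧ ∀ t : gaussDisc, f t = F t}
  add_mem' := by
    rintro f g ⟨F, hF, hf⟩ ⟨G, hG, hg⟩
    exact ⟨F + G, hF.add hG, fun t => by simp [hf t, hg t]⟩
  zero_mem' := ⟨0, differentiableOn_const 0, fun t => by simp⟩
  smul_mem' := by
    rintro c f ⟨F, hF, hf⟩
    exact ⟨c • F, hF.const_smul c, fun t => by simp [hf t]⟩

lemma two_thirds_lt_re {t : ℂ} (ht : t ∈ gaussDisc) (n : ℕ) :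
    2 / 3 < ((n : ℂ) + 1 + t).re := by
  have h1 : ‖t - 2 / 3‖ < 1 := by simpa [gaussDisc, dist_eq_norm] using ht
  have h2 := (abs_le.1 (Complex.abs_re_le_norm (t - 2 / 3))).1
  have h3 : (t - 2 / 3 : ℂ).re = t.re - 2 / 3 := by simp
  rw [h3] at h2
  have h4 : (0 : ℝ) ≤ n := n.cast_nonneg
  simp only [Complex.add_re, Complex.natCast_re, Complex.one_re]
  linarith

/-- The inverse branch `t ↦ 1 / (n + 1 + t)` maps `𝔻` to itself. -/
lemma branch_mem {t : ℂ} (ht : t ∈ gaussDisc) (n : ℕ) :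
    1 / ((n : ℂ) + 1 + t) ∈ gaussDisc := by
  have hre := two_thirds_lt_re ht n
  set w : ℂ := (n : ℂ) + 1 + t with hw
  have hw0 : w ≠ 0 := by
    intro h
    rw [h] at hre
    norm_num at hre
  have key : ‖1 / w - 2 / 3‖ ^ 2 < 1 := by
    have e : 1 / w - 2 / 3 = (3 - 2 * w) / (3 * w) := by field_simp
    have h3w : 0 < ‖3 * w‖ := norm_pos_iff.2 (mul_ne_zero (by norm_num) hw0)
    rw [e, norm_div, div_pow, div_lt_one (pow_pos h3w 2), Complex.sq_norm, Complex.sq_norm,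
      Complex.normSq_apply, Complex.normSq_apply]
    have a1 : (3 - 2 * w).re = 3 - 2 * w.re := by simp
    have a2 : (3 - 2 * w).im = - (2 * w.im) := by simp
    have a3 : (3 * w).re = 3 * w.re := by simp
    have a4 : (3 * w).im = 3 * w.im := by simp
    rw [a1, a2, a3, a4]
    nlinarith [sq_nonneg w.im, sq_nonneg (w.re - 2 / 3)]
  have : ‖1 / w - 2 / 3‖ < 1 := by
    by_contra hcon
    push Not at hcon
    nlinarith
  simpa [gaussDisc, dist_eq_norm] using this

/-- The `n`-th term (with `n + 1` in place of `n`, so that `n` ranges over `ℕ`)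
of the series `∑_{n ≥ 1} z^n (n + t)^{-τ} f(1 / (n + t))`. -/
def transferTerm (τ z : ℂ) (f : Hinf) (n : ℕ) (t : gaussDisc) : ℂ :=
  z ^ (n + 1) / ((n : ℂ) + 1 + t) ^ τ * f.1 ⟨1 / ((n : ℂ) + 1 + t), branch_mem t.2 n⟩

/-- A bound for `|z^{n+1} (n + 1 + t)^{-τ}|` on `𝔻`. -/
def transferBound (τ z : ℂ) (n : ℕ) : ℝ :=
  ‖z‖ ^ (n + 1) * (((n : ℝ) + 3) ^ ⌈|τ.re|⌉₊ * Real.exp (Real.pi * |τ.im|))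

lemma transferBound_nonneg (τ z : ℂ) (n : ℕ) : 0 ≤ transferBound τ z n := by
  unfold transferBound; positivity

lemma summable_transferBound (τ : ℂ) {z : ℂ} (hz : ‖z‖ < 1) : Summable (transferBound τ z) := by
  have h := summable_pow_mul_geometric_of_norm_lt_one (R := ℝ) ⌈|τ.re|⌉₊ (r := ‖z‖) (by simpa using hz)
  by_cases h0 : z = 0
  · subst h0
    exact summable_zero.congr fun n => by simp [transferBound]
  have hzp : 0 < ‖z‖ := norm_pos_iff.2 h0
  have h' := ((summable_nat_add_iff 3).2 h).mul_left (Real.exp (Real.pi * |τ.im|) / ‖z‖ ^ 2)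
  refine h'.congr fun n => ?_
  unfold transferBound
  push_cast
  rw [pow_add ‖z‖ n 3, pow_succ ‖z‖ n]
  field_simp

lemma norm_coeff_le (τ z : ℂ) (n : ℕ) {t : ℂ} (ht : t ∈ gaussDisc) :
    ‖z ^ (n + 1) / ((n : ℂ) + 1 + t) ^ τ‖ ≤ transferBound τ z n := by
  have hre := two_thirds_lt_re ht n
  have htn : ‖t‖ ≤ 2 := by
    have h1 : ‖t - 2 / 3‖ < 1 := by simpa [gaussDisc, dist_eq_norm] using ht
    have h2 : ‖t‖ ≤ ‖t - 2 / 3‖ + ‖(2 / 3 : ℂ)‖ := by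
      simpa using norm_add_le (t - 2 / 3) (2 / 3 : ℂ)
    have h3 : ‖(2 / 3 : ℂ)‖ = 2 / 3 := by simp
    linarith
  have hup : ‖(n : ℂ) + 1 + t‖ ≤ (n : ℝ) + 3 := by
    have h1 := norm_add_le ((n : ℂ) + 1) t
    have h2 : ‖(n : ℂ) + 1‖ = (n : ℝ) + 1 := by
      rw [← Nat.cast_succ, Complex.norm_natCast, Nat.cast_succ]
    linarith
  set w : ℂ := (n : ℂ) + 1 + t with hw
  have hlow : 2 / 3 < ‖w‖ := hre.trans_le (Complex.re_le_norm w)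
  have hwp : 0 < ‖w‖ := by linarith
  have hw0 : w ≠ 0 := norm_pos_iff.1 hwp
  have hn : (0 : ℝ) ≤ n := n.cast_nonneg
  rw [norm_div, norm_pow, transferBound, div_eq_mul_inv]
  refine mul_le_mul_of_nonneg_left ?_ (by positivity)
  rw [← norm_inv, ← Complex.cpow_neg, Complex.norm_cpow_of_ne_zero hw0, div_eq_mul_inv,
    ← Real.exp_neg]
  have hpow : ‖w‖ ^ (-τ).re ≤ ((n : ℝ) + 3) ^ ⌈|τ.re|⌉₊ := by
    have hb : ‖w‖ ^ (-τ).re ≤ ((n : ℝ) + 3) ^ |τ.re| := by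
      rw [Complex.neg_re]
      rcases le_total 0 τ.re with h | h
      · rw [abs_of_nonneg h, Real.rpow_neg hwp.le, ← Real.inv_rpow hwp.le]
        refine Real.rpow_le_rpow (by positivity) ?_ h
        rw [inv_le_comm₀ hwp (by positivity)]
        have : ((n : ℝ) + 3)⁻¹ ≤ 1 / 3 := by
          rw [inv_eq_one_div]
          exact one_div_le_one_div_of_le (by norm_num) (by linarith)
        linarith
      · rw [abs_of_nonpos h]
        exact Real.rpow_le_rpow hwp.le hup (by linarith)
    refine hb.trans ?_
    rw [← Real.rpow_natCast]
    exact Real.rpow_le_rpow_of_exponent_le (by linarith) (Nat.le_ceil _)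
  refine mul_le_mul hpow ?_ (Real.exp_nonneg _) (by positivity)
  apply Real.exp_le_exp.2
  calc -(w.arg * (-τ).im) ≤ |w.arg * τ.im| := by
        rw [Complex.neg_im, mul_neg, neg_neg]; exact le_abs_self _
    _ = |w.arg| * |τ.im| := abs_mul _ _
    _ ≤ Real.pi * |τ.im| := by gcongr; exact Complex.abs_arg_le_pi w

lemma norm_transferTerm_le (τ z : ℂ) (f : Hinf) (n : ℕ) (t : gaussDisc) :
    ‖transferTerm τ z f n t‖ ≤ transferBound τ z n * ‖f‖ := by
  unfold transferTerm
  rw [norm_mul]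
  exact mul_le_mul (norm_coeff_le τ z n t.2) (f.1.norm_coe_le_norm _) (norm_nonneg _)
    (transferBound_nonneg τ z n)

lemma summable_transferTerm (τ : ℂ) {z : ℂ} (hz : ‖z‖ < 1) (f : Hinf) (t : gaussDisc) :
    Summable fun n => transferTerm τ z f n t :=
  Summable.of_norm_bounded ((summable_transferBound τ hz).mul_right ‖f‖)
    fun n => norm_transferTerm_le τ z f n t

lemma norm_tsum_transferTerm_le (τ : ℂ) {z : ℂ} (hz : ‖z‖ < 1) (f : Hinf) (t : gaussDisc) :
    ‖∑' n, transferTerm τ z f n t‖ ≤ (∑' n, transferBound τ z n) * ‖f‖ := by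
  rw [← tsum_mul_right]
  exact tsum_of_norm_bounded ((summable_transferBound τ hz).mul_right ‖f‖).hasSum
    fun n => norm_transferTerm_le τ z f n t

/-- The sum of the series is holomorphic on `𝔻`. -/
lemma exists_differentiableOn_transfer (τ : ℂ) {z : ℂ} (hz : ‖z‖ < 1) (f : Hinf) :
    ∃ F : ℂ → ℂ, DifferentiableOn ℂ F gaussDisc ∧
      ∀ t : gaussDisc, ∑' n, transferTerm τ z f n t = F t := by
  obtain ⟨F, hF, hf⟩ := f.2
  refine ⟨fun t => ∑' n : ℕ, z ^ (n + 1) / ((n : ℂ) + 1 + t) ^ τ * F (1 / ((n : ℂ) + 1 + t)),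
    ?_, ?_⟩
  · refine Complex.differentiableOn_tsum_of_summable_norm
      ((summable_transferBound τ hz).mul_right ‖f‖) ?_ Metric.isOpen_ball ?_
    · intro n t ht
      have hre := two_thirds_lt_re ht n
      have hsl : (n : ℂ) + 1 + t ∈ Complex.slitPlane := Or.inl (by linarith)
      have hw0 : (n : ℂ) + 1 + t ≠ 0 := Complex.slitPlane_ne_zero hsl
      have hd : DifferentiableAt ℂ (fun t : ℂ => (n : ℂ) + 1 + t) t := by fun_prop
      have hFd : DifferentiableAt ℂ F (1 / ((n : ℂ) + 1 + t)) :=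
        hF.differentiableAt (Metric.isOpen_ball.mem_nhds (branch_mem ht n))
      have h1 : DifferentiableAt ℂ (fun t : ℂ => ((n : ℂ) + 1 + t) ^ τ) t := hd.cpow_const hsl
      have h2 : DifferentiableAt ℂ (fun t : ℂ => 1 / ((n : ℂ) + 1 + t)) t :=
        (differentiableAt_const 1).div hd hw0
      have h3 : DifferentiableAt ℂ (fun t : ℂ => F (1 / ((n : ℂ) + 1 + t))) t := hFd.comp t h2
      have h4 : ((n : ℂ) + 1 + t) ^ τ ≠ 0 := by simp [Complex.cpow_eq_zero_iff, hw0]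
      exact (((differentiableAt_const _).div h1 h4).mul h3).differentiableWithinAt
    · intro n t ht
      have := norm_transferTerm_le τ z f n ⟨t, ht⟩
      rwa [transferTerm, hf] at this
  · intro t
    refine tsum_congr fun n => ?_
    rw [transferTerm, hf]

/-- The function `H_{τ,z}[f] : t ↦ ∑_{n ≥ 1} z^n (n + t)^{-τ} f(1 / (n + t))`, for `|z| < 1`, as an
element of `H^∞(𝔻)`. -/
def transferFun (τ z : ℂ) (hz : ‖z‖ < 1) (f : Hinf) : Hinf :=
  ⟨BoundedContinuousFunction.ofNormedAddCommGroup (fun t => ∑' n, transferTerm τ z f n t)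
    (by
      obtain ⟨F, hF, hf⟩ := exists_differentiableOn_transfer τ hz f
      simp only [hf]
      exact hF.continuousOn.domRestrict)
    ((∑' n, transferBound τ z n) * ‖f‖) (norm_tsum_transferTerm_le τ hz f),
    exists_differentiableOn_transfer τ hz f⟩

/-- The transfer operator `H_{τ,z}` as a bounded operator on `H^∞(𝔻)`, for `|z| < 1`. (It is not
considered for `|z| ≥ 1`, where it is given the value `0`.) -/
def transferOp (τ z : ℂ) : Hinf →L[ℂ] Hinf :=
  if hz : ‖z‖ < 1 then
    LinearMap.mkContinuous
      { toFun := transferFun τ z hz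
        map_add' := by
          intro f g
          apply Subtype.ext
          ext t
          change ∑' n, transferTerm τ z (f + g) n t =
            ∑' n, transferTerm τ z f n t + ∑' n, transferTerm τ z g n t
          rw [← (summable_transferTerm τ hz f t).tsum_add (summable_transferTerm τ hz g t)]
          refine tsum_congr fun n => ?_
          simp [transferTerm, mul_add]
        map_smul' := by
          intro c f
          apply Subtype.ext
          ext t
          change ∑' n, transferTerm τ z (c • f) n t = c * ∑' n, transferTerm τ z f n t
          rw [← tsum_mul_left]
          refine tsum_congr fun n => ?_
          simp [transferTerm, mul_left_comm] }
      (∑' n, transferBound τ z n)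
      (by
        intro f
        exact (BoundedContinuousFunction.norm_le
          (mul_nonneg (tsum_nonneg (transferBound_nonneg τ z)) (norm_nonneg f))).2
            (norm_tsum_transferTerm_le τ hz f))
  else 0

lemma transferOp_apply (τ : ℂ) {z : ℂ} (hz : ‖z‖ < 1) (f : Hinf) (t : gaussDisc) :
    (transferOp τ z f).1 t = ∑' n : ℕ, z ^ (n + 1) / ((n : ℂ) + 1 + t) ^ τ *
      f.1 ⟨1 / ((n : ℂ) + 1 + t), branch_mem t.2 n⟩ := by
  rw [transferOp, dif_pos hz]
  rfl

/-! ### The dominant eigenvalue and the implicit function -/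

/-- `l` is a simple, isolated, dominant eigenvalue of the bounded operator `T`: it is an eigenvalue
of algebraic multiplicity one, and the rest of the spectrum lies in a disc about `0` of radius
strictly smaller than `|l|`. -/
structure IsSimpleDominantEigenvalue {E : Type*} [NormedAddCommGroup E] [NormedSpace ℂ E]
    (T : E →L[ℂ] E) (l : ℂ) : Prop where
  hasEigenvalue : Module.End.HasEigenvalue (T : E →ₗ[ℂ] E) l
  simple : Module.finrank ℂ (Module.End.maxGenEigenspace (T : E →ₗ[ℂ] E) l) = 1
  dominant : ∃ r : ℝ, 0 ≤ r ∧ r < ‖l‖ ∧ ∀ m ∈ spectrum ℂ T, m ≠ l → ‖m‖ ≤ r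

/-- A simple dominant eigenvalue is unique. -/
lemma IsSimpleDominantEigenvalue.unique {E : Type*} [NormedAddCommGroup E] [NormedSpace ℂ E]
    {T : E →L[ℂ] E} {l m : ℂ} (hl : IsSimpleDominantEigenvalue T l)
    (hm : IsSimpleDominantEigenvalue T m) : l = m := by
  have key : ∀ {k : ℂ}, Module.End.HasEigenvalue (T : E →ₗ[ℂ] E) k → k ∈ spectrum ℂ T := by
    intro k hk hu
    obtain ⟨v, hv⟩ := hk.exists_hasEigenvector
    obtain ⟨u, hu⟩ := hu
    have h1 : (u : E →L[ℂ] E) v = 0 := by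
      have := hv.apply_eq_smul
      rw [hu]
      simp only [ContinuousLinearMap.coe_coe] at this
      simp [Algebra.algebraMap_eq_smul_one, this]
    have h2 : ((u⁻¹ : (E →L[ℂ] E)ˣ) : E →L[ℂ] E) ((u : E →L[ℂ] E) v) = v := by
      rw [← mul_apply_eq_comp, Units.inv_mul]
      simp
    rw [h1, map_zero] at h2
    exact hv.2 h2.symm
  by_contra hne
  obtain ⟨r, _, hr, h1⟩ := hl.dominant
  obtain ⟨s, _, hs, h2⟩ := hm.dominant
  have a := h1 m (key hm.hasEigenvalue) (Ne.symm hne)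
  have b := h2 l (key hl.hasEigenvalue) hne
  linarith

open Classical in
/-- The dominant eigenvalue `λ(τ, z)` of `H_{τ,z}`, wherever there is one. -/
def dominantEigenvalue (τ z : ℂ) : ℂ :=
  if h : ∃ l, IsSimpleDominantEigenvalue (transferOp τ z) l then h.choose else 0

/-- `ρ` is an analytic solution of `λ(τ, ρ(τ)) = 1` on the disc `|τ| ≤ η`, with
`|ρ(τ) - 1/2| ≤ δ`. -/
structure IsAnalyticSolution (δ η : ℝ) (ρ : ℂ → ℂ) : Prop where
  pos : 0 < η
  le : η ≤ δ
  analytic : AnalyticOnNhd ℂ ρ (Metric.closedBall 0 η)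
  near_half : ∀ τ : ℂ, ‖τ‖ ≤ η → ‖ρ τ - 1 / 2‖ ≤ δ
  eq_one : ∀ τ : ℂ, ‖τ‖ ≤ η → dominantEigenvalue τ (ρ τ) = 1

/-- The constant `α = -½ ∫_{(0,1]} log dμ`. -/
def minkowskiAlpha : ℝ := -(1 / 2) * ∫ x in Ioc (0 : ℝ) 1, Real.log x ∂minkowskiMeasure

/-- The function `x ↦ log x + α ⌊1/x⌋`. -/
def centredLog (x : ℝ) : ℝ := Real.log x + minkowskiAlpha * (⌊1 / x⌋ : ℝ)

/-- The coboundary `x ↦ ∫₀¹ log((1 + y{1/x}) / (1 + yx)) dμ(y)`. -/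
def coboundary (x : ℝ) : ℝ :=
  ∫ y in Icc (0 : ℝ) 1, Real.log ((1 + y * Int.fract (1 / x)) / (1 + y * x)) ∂minkowskiMeasure

end

/-! At `(τ, z) = (0, 1/2)` the operator `H` fixes the constants and preserves integration against
`μ`, because `μ` is self-similar: it is the sum over `n ≥ 1` of `2^{-n}` times its image under `t ↦
1/(n + t)` (`minkowskiMeasure_eq_sum`). The inverse branches contract on average, so `H` multiplies
Lipschitz constants by at most `3/4`, and `N = H - 1 ⊗ μ` (`restOp`) has spectral radius at most
`3/4` (`norm_restOp_pow_le`).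

The nearby operators are `A + 1 ⊗ μ` with `A` close to `N`. For such a rank-one perturbation the
eigenvalue equation is scalar, `w μ((1 - wA)⁻¹ 1) = 1` with `w = 1/λ`, and a contraction argument
gives exactly one root with `|w| ≤ 7/6` (`GoodPerturbation.isSimpleDominantEigenvalue`). Thus `λ(τ,
z) = 1` becomes `resolventFun (τ, z) = 1`. For `τ = 0` the constants are invariant and this function
is `(1 - z)/(2 - 3z)`, with derivative `4` at `1/2`: the implicit function theorem produces `ρ`, and
`ρ(0) = 1/2` is forced.

Put `q = log ρ`, `A(τ) = H_{τ,ρ(τ)}`, and let `u(τ)` be the eigenvector with `u(0) = 1`.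
Differentiating `A u = u` and pairing with `μ` gives `μ(A'1) = 0` and `μ(A''1) + 2 μ(A'u') = 0` at
`0` (`eigenvector_derivs`). On each branch, differentiation in `τ` brings out the factor `L = log x
+ q'(0)⌊1/x⌋`. The first relation is `∫ L dμ = 0`, that is `q'(0) = α`, since `∫ ⌊1/x⌋ dμ = 2`; the
second is `∫ L² dμ + 2q''(0) + 2 ∫ L u' dμ = 0`. Here `u'` solves `u' - Hu' = A'1`, and so does
`ψ(t) = -∫ log(1 + ty) dμ(y)` (`hasSum_potential_sub`); the two differ by a constant, which yields
the first formula for `q''(0)`.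

For the second formula, `H` is dual to composition with the Gauss map `G` and sends `L + ψ` to `ψ`,
whence `∫ (L + ψ - ψ∘G)² dμ = ∫ L² dμ + 2 ∫ Lψ dμ`. If this vanished, `L` would be almost everywhere
a difference of bounded functions, although `nα - log(n + t)` is unbounded in `n` whatever `α` is
(`integral_coboundary_sq_pos`). -/

noncomputable section

/-! ### Perturbation of a simple dominant eigenvalue -/

section Perturbation

variable {E : Type*} [NormedAddCommGroup E] [NormedSpace ℂ E]

/-- Sherman-Morrison formula: the inverse is again the identity plus a rank-one operator. -/
lemma isUnit_one_sub_smulRight (φ : E →L[ℂ] ℂ) {x : E} (hx : φ x ≠ 1) :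
    IsUnit (1 - φ.smulRight x : E →L[ℂ] E) := by
  have h : 1 - φ x ≠ 0 := sub_ne_zero.2 (Ne.symm hx)
  have hc : (1 - φ x)⁻¹ * φ x = (1 - φ x)⁻¹ - 1 := by
    linear_combination -(inv_mul_cancel₀ h)
  refine isUnit_iff_exists.2 ⟨1 + (1 - φ x)⁻¹ • φ.smulRight x, ?_, ?_⟩ <;>
  · ext v
    simp only [mul_apply_eq_comp, sub_apply, add_apply, one_apply_eq_self, smul_apply,
      ContinuousLinearMap.smulRight_apply, map_add, map_sub, map_smul]
    match_scalars
    · ring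
    · linear_combination -(φ v) * hc

lemma inverse_apply_cancel {B : E →L[ℂ] E} (hB : IsUnit B) (v : E) :
    Ring.inverse B (B v) = v := by
  rw [← mul_apply_eq_comp, Ring.inverse_mul_cancel _ hB, one_apply_eq_self]

lemma apply_inverse_cancel {B : E →L[ℂ] E} (hB : IsUnit B) (v : E) :
    B (Ring.inverse B v) = v := by
  rw [← mul_apply_eq_comp, Ring.mul_inverse_cancel _ hB, one_apply_eq_self]

/-- Uniform control of the resolvents `(1 - w A)⁻¹`, `|w| ≤ s`, for `A` near `N`. -/
lemma exists_eventually_resolvent_bound [CompleteSpace E] {N : E →L[ℂ] E} {s : ℝ}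
    (hN : ∀ w : ℂ, ‖w‖ ≤ s → IsUnit (1 - w • N)) :
    ∃ M : ℝ, 0 ≤ M ∧ ∀ᶠ A in 𝓝 N, ∀ w : ℂ, ‖w‖ ≤ s →
      IsUnit (1 - w • A) ∧ ‖Ring.inverse (1 - w • A)‖ ≤ M := by
  have hc : ∀ w : ℂ, ‖w‖ ≤ s → ContinuousAt
      (fun p : (E →L[ℂ] E) × ℂ => Ring.inverse (1 - p.2 • p.1)) (N, w) := by
    intro w hw
    obtain ⟨u, hu⟩ := hN w hw
    have h := NormedRing.inverse_continuousAt u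
    rw [hu] at h
    exact ContinuousAt.comp (f := fun p : (E →L[ℂ] E) × ℂ => 1 - p.2 • p.1) (x := (N, w)) h
      (by fun_prop)
  have hcw : ContinuousOn (fun w : ℂ => Ring.inverse (1 - w • N)) (Metric.closedBall 0 s) := by
    intro w hw
    exact (ContinuousAt.comp (f := fun w : ℂ => (N, w)) (x := w) (hc w (by simpa using hw))
      (by fun_prop)).continuousWithinAt
  obtain ⟨M, hM⟩ := (isCompact_closedBall (0 : ℂ) s).exists_bound_of_continuousOn hcw
  refine ⟨max M 0 + 1, by positivity, ?_⟩
  -- Tube lemma: a condition that holds near each point of `{N} × {|w| ≤ s}` holds for all these `w`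
  -- at once when `A` is close to `N`.
  have := (isCompact_closedBall (0 : ℂ) s).eventually_forall_of_forall_eventually (x₀ := N)
    (P := fun A w => IsUnit (1 - w • A) ∧ ‖Ring.inverse (1 - w • A)‖ ≤ max M 0 + 1) ?_
  · filter_upwards [this] with A hA w hw
    exact hA w (by simpa using hw)
  · intro w hw
    have hw' : ‖w‖ ≤ s := by simpa using hw
    refine Filter.Eventually.and ?_ ?_
    · have hcont : ContinuousAt (fun p : (E →L[ℂ] E) × ℂ => 1 - p.2 • p.1) (N, w) := by fun_prop
      exact hcont.eventually (Units.isOpen.mem_nhds (hN w hw'))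
    · have h1 : ‖Ring.inverse (1 - w • N)‖ < max M 0 + 1 :=
        ((hM w hw).trans (le_max_left _ _)).trans_lt (lt_add_one _)
      filter_upwards [(hc w hw').norm.eventually (gt_mem_nhds h1)] with p hp using hp.le

/-- The data of an operator `A` and a rank-one operator `e ⊗ φ` for which the perturbation theory
of the eigenvalue of `A + e ⊗ φ` works. -/
structure GoodPerturbation (φ : E →L[ℂ] ℂ) (e : E) (A : E →L[ℂ] E) (s M : ℝ) : Prop where
  one_lt : 1 < s
  M_nonneg : 0 ≤ M
  apply_e : φ e = 1
  res : ∀ w : ℂ, ‖w‖ ≤ s → IsUnit (1 - w • A) ∧ ‖Ring.inverse (1 - w • A)‖ ≤ M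
  small₁ : (2 * s * M + s ^ 2 * M ^ 2 * ‖A‖) * (‖φ‖ * ‖A e‖) ≤ 1 / 2
  small₂ : s ^ 2 * M * (‖φ‖ * ‖A e‖) ≤ (s - 1) / 2
  small₃ : s ^ 2 * M ^ 2 * (‖φ‖ * ‖A e‖) ≤ 1 / 2

/-- Every smallness condition carries the factor `‖A e‖`, which vanishes at `A = N`. The three
conditions serve in turn to make `fixMap` a contraction, to keep its values well inside the disc of
radius `s`, and to make the root simple. -/
lemma eventually_goodPerturbation [CompleteSpace E] {φ : E →L[ℂ] ℂ} {e : E} {N : E →L[ℂ] E}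
    {s : ℝ} (hs : 1 < s) (he : φ e = 1) (hNe : N e = 0)
    (hN : ∀ w : ℂ, ‖w‖ ≤ s → IsUnit (1 - w • N)) :
    ∃ M : ℝ, ∀ᶠ A in 𝓝 N, GoodPerturbation φ e A s M := by
  obtain ⟨M, hM0, hM⟩ := exists_eventually_resolvent_bound hN
  refine ⟨M, ?_⟩
  have lim (g : (E →L[ℂ] E) → ℝ) (hg : Continuous g) (hgN : g N = 0) {c : ℝ} (hc : 0 < c) :
      ∀ᶠ A in 𝓝 N, g A ≤ c := by
    have := hg.continuousAt (x := N)
    rw [ContinuousAt, hgN] at this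
    filter_upwards [this.eventually (gt_mem_nhds hc)] with A hA using hA.le
  filter_upwards [hM,
    lim (fun A => (2 * s * M + s ^ 2 * M ^ 2 * ‖A‖) * (‖φ‖ * ‖A e‖)) (by fun_prop) (by simp [hNe])
      (by norm_num : (0 : ℝ) < 1 / 2),
    lim (fun A => s ^ 2 * M * (‖φ‖ * ‖A e‖)) (by fun_prop) (by simp [hNe])
      (by linarith : (0 : ℝ) < (s - 1) / 2),
    lim (fun A => s ^ 2 * M ^ 2 * (‖φ‖ * ‖A e‖)) (by fun_prop) (by simp [hNe])
      (by norm_num : (0 : ℝ) < 1 / 2)] with A h1 h2 h3 h4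
  exact ⟨hs, hM0, he, h1, h2, h3, h4⟩

namespace GoodPerturbation

variable {φ : E →L[ℂ] ℂ} {e : E} {A : E →L[ℂ] E} {s M : ℝ}

/-- The fixed points of this map are the inverses of the large eigenvalues of `A + e ⊗ φ`. -/
def fixMap (φ : E →L[ℂ] ℂ) (e : E) (A : E →L[ℂ] E) (w : ℂ) : ℂ :=
  1 - w ^ 2 * φ (Ring.inverse (1 - w • A) (A e))

lemma norm_apply_le (φ : E →L[ℂ] ℂ) (R : E →L[ℂ] E) (v : E) :
    ‖φ (R v)‖ ≤ ‖R‖ * (‖φ‖ * ‖v‖) := by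
  calc ‖φ (R v)‖ ≤ ‖φ‖ * ‖R v‖ := φ.le_opNorm _
    _ ≤ ‖φ‖ * (‖R‖ * ‖v‖) := by gcongr; exact R.le_opNorm _
    _ = _ := by ring

lemma resolvent_apply_e (h : GoodPerturbation φ e A s M) {w : ℂ} (hw : ‖w‖ ≤ s) :
    Ring.inverse (1 - w • A) e = e + w • Ring.inverse (1 - w • A) (A e) := by
  have h1 := inverse_apply_cancel (h.res w hw).1 e
  simp only [sub_apply, one_apply_eq_self, smul_apply, map_sub, map_smul] at h1
  rw [sub_eq_iff_eq_add] at h1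
  exact h1

/-- An eigenvector for `1/w` satisfies `(1 - wA) v = w φ(v) e`; applying the resolvent and then `φ`
leaves the scalar equation on the right. -/
lemma fixMap_eq_iff (h : GoodPerturbation φ e A s M) {w : ℂ} (hw : ‖w‖ ≤ s) :
    fixMap φ e A w = w ↔ w * φ (Ring.inverse (1 - w • A) e) = 1 := by
  rw [h.resolvent_apply_e hw, fixMap]
  simp only [map_add, map_smul, h.apply_e, smul_eq_mul]
  constructor <;> intro h1 <;> linear_combination -h1

lemma resolvent_sub (h : GoodPerturbation φ e A s M) {w w' : ℂ} (hw : ‖w‖ ≤ s) (hw' : ‖w'‖ ≤ s) :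
    Ring.inverse (1 - w • A) - Ring.inverse (1 - w' • A) =
      (w - w') • (Ring.inverse (1 - w • A) * A * Ring.inverse (1 - w' • A)) := by
  have h1 := Ring.inverse_mul_cancel _ (h.res w hw).1
  have h2 := Ring.mul_inverse_cancel _ (h.res w' hw').1
  set R := Ring.inverse (1 - w • A)
  set R' := Ring.inverse (1 - w' • A)
  calc R - R' = R * ((1 - w' • A) * R') - (R * (1 - w • A)) * R' := by rw [h1, h2]; simp
    _ = _ := by
      simp only [mul_sub, sub_mul, mul_one, one_mul, smul_mul_assoc, mul_smul_comm, mul_assoc,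
        sub_smul]
      abel

lemma norm_fixMap_sub_le (h : GoodPerturbation φ e A s M) {w w' : ℂ} (hw : ‖w‖ ≤ s)
    (hw' : ‖w'‖ ≤ s) : ‖fixMap φ e A w - fixMap φ e A w'‖ ≤ 1 / 2 * ‖w - w'‖ := by
  have hs := h.one_lt
  have hM := h.M_nonneg
  set R := Ring.inverse (1 - w • A) with hR
  set R' := Ring.inverse (1 - w' • A) with hR'
  have hRM : ‖R‖ ≤ M := (h.res w hw).2
  have hRM' : ‖R'‖ ≤ M := (h.res w' hw').2
  have e1 : fixMap φ e A w - fixMap φ e A w' =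
      -((w - w') * ((w + w') * φ (R (A e)) + w' ^ 2 * φ ((R * A * R') (A e)))) := by
    have h3 : φ (R (A e)) - φ (R' (A e)) = (w - w') * φ ((R * A * R') (A e)) := by
      rw [← map_sub, ← sub_apply, hR, hR', h.resolvent_sub hw hw', smul_apply, map_smul, smul_eq_mul]
    rw [fixMap, fixMap, ← hR, ← hR']
    linear_combination -(w' ^ 2) * h3
  have hc : 0 ≤ ‖φ‖ * ‖A e‖ := by positivity
  rw [e1, norm_neg, norm_mul, mul_comm]
  refine mul_le_mul_of_nonneg_right ?_ (norm_nonneg _)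
  have b1 : ‖(w + w') * φ (R (A e))‖ ≤ 2 * s * M * (‖φ‖ * ‖A e‖) := by
    rw [norm_mul, mul_assoc (2 * s)]
    have := norm_add_le w w'
    refine mul_le_mul (by linarith) ((norm_apply_le φ R _).trans ?_) (norm_nonneg _) (by linarith)
    exact mul_le_mul_of_nonneg_right hRM hc
  have b2 : ‖w' ^ 2 * φ ((R * A * R') (A e))‖ ≤ s ^ 2 * M ^ 2 * ‖A‖ * (‖φ‖ * ‖A e‖) := by
    have b3 : ‖R * A * R'‖ ≤ M ^ 2 * ‖A‖ := by
      calc ‖R * A * R'‖ ≤ ‖R‖ * ‖A‖ * ‖R'‖ :=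
            (norm_mul_le _ _).trans (mul_le_mul_of_nonneg_right (norm_mul_le _ _) (norm_nonneg _))
        _ ≤ M * ‖A‖ * M := by gcongr
        _ = _ := by ring
    rw [norm_mul, norm_pow]
    calc ‖w'‖ ^ 2 * ‖φ ((R * A * R') (A e))‖ ≤ s ^ 2 * ((M ^ 2 * ‖A‖) * (‖φ‖ * ‖A e‖)) := by
          gcongr
          exact (norm_apply_le φ _ _).trans (mul_le_mul_of_nonneg_right b3 hc)
      _ = _ := by ring
  have := norm_add_le ((w + w') * φ (R (A e))) (w' ^ 2 * φ ((R * A * R') (A e)))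
  have h1 := h.small₁
  rw [add_mul] at h1
  linarith

/-- The radius `(1 + s)/2` is strictly smaller than `s`. This is the spectral gap: the eigenvalue
has modulus at least `2/(1 + s)`, while the rest of the spectrum stays within `1/s`. -/
lemma norm_fixMap_le (h : GoodPerturbation φ e A s M) {w : ℂ} (hw : ‖w‖ ≤ s) :
    ‖fixMap φ e A w‖ ≤ (1 + s) / 2 := by
  have hs := h.one_lt
  have hc : 0 ≤ ‖φ‖ * ‖A e‖ := by positivity
  have b : ‖w ^ 2 * φ (Ring.inverse (1 - w • A) (A e))‖ ≤ s ^ 2 * M * (‖φ‖ * ‖A e‖) := by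
    rw [norm_mul, norm_pow, mul_assoc]
    gcongr
    exact (norm_apply_le φ _ _).trans (mul_le_mul_of_nonneg_right (h.res w hw).2 hc)
  have h1 := norm_sub_le (1 : ℂ) (w ^ 2 * φ (Ring.inverse (1 - w • A) (A e)))
  rw [norm_one] at h1
  have h2 := h.small₂
  rw [fixMap]
  linarith

lemma exists_fixed (h : GoodPerturbation φ e A s M) :
    ∃ w : ℂ, ‖w‖ ≤ (1 + s) / 2 ∧ fixMap φ e A w = w := by
  have hs := h.one_lt
  have hmaps : MapsTo (fixMap φ e A) (Metric.closedBall 0 s) (Metric.closedBall 0 s) := by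
    intro w hw
    have := h.norm_fixMap_le (w := w) (by simpa using hw)
    simp only [Metric.mem_closedBall, dist_zero_right]
    linarith
  have hcontr : ContractingWith (1 / 2) (hmaps.restrict (fixMap φ e A) _ _) := by
    refine ⟨by rw [← NNReal.coe_lt_coe]; norm_num, LipschitzWith.of_dist_le_mul ?_⟩
    rintro ⟨x, hx⟩ ⟨y, hy⟩
    rw [Subtype.dist_eq, Subtype.dist_eq]
    simp only [MapsTo.val_restrict_apply, dist_eq_norm]
    simpa using h.norm_fixMap_sub_le (w := x) (w' := y) (by simpa using hx) (by simpa using hy)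
  obtain ⟨w, hw, hfix, -⟩ := ContractingWith.exists_fixedPoint'
    Metric.isClosed_closedBall.isComplete hmaps hcontr (x := 0) (by simp; linarith) (edist_ne_top _ _)
  refine ⟨w, ?_, hfix⟩
  have := h.norm_fixMap_le (w := w) (by simpa using hw)
  rwa [show fixMap φ e A w = w from hfix] at this

lemma fixed_unique (h : GoodPerturbation φ e A s M) {w w' : ℂ} (hw : ‖w‖ ≤ s) (hw' : ‖w'‖ ≤ s)
    (hf : fixMap φ e A w = w) (hf' : fixMap φ e A w' = w') : w = w' := by
  have := h.norm_fixMap_sub_le hw hw'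
  rw [hf, hf'] at this
  have h0 : ‖w - w'‖ = 0 := le_antisymm (by linarith) (norm_nonneg _)
  exact sub_eq_zero.1 (norm_eq_zero.1 h0)

lemma fixMap_zero (φ : E →L[ℂ] ℂ) (e : E) (A : E →L[ℂ] E) : fixMap φ e A 0 = 1 := by
  simp [fixMap]

/-- Solving `(λ - A - e ⊗ φ) v = y` by means of the resolvent of `A`. -/
lemma eq_of_sub_apply (h : GoodPerturbation φ e A s M) {w : ℂ} (hw : ‖w‖ ≤ s) (hw0 : w ≠ 0)
    {v y : E} (hv : w⁻¹ • v - (A + φ.smulRight e) v = y) :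
    v = (w * φ v) • Ring.inverse (1 - w • A) e + w • Ring.inverse (1 - w • A) y := by
  have h1 : (1 - w • A) v = (w * φ v) • e + w • y := by
    rw [← hv]
    simp only [sub_apply, one_apply_eq_self, smul_apply, add_apply,
      ContinuousLinearMap.smulRight_apply, smul_sub, smul_add, smul_smul, mul_inv_cancel₀ hw0,
      one_smul]
    abel
  have h2 := inverse_apply_cancel (h.res w hw).1 v
  rw [h1, map_add, map_smul, map_smul] at h2
  exact h2.symm

lemma isSimpleDominantEigenvalue (h : GoodPerturbation φ e A s M) {w : ℂ} (hw : ‖w‖ ≤ s)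
    (hf : fixMap φ e A w = w) :
    IsSimpleDominantEigenvalue (A + φ.smulRight e) w⁻¹ := by
  have hs := h.one_lt
  have hw0 : w ≠ 0 := by
    rintro rfl
    rw [fixMap_zero] at hf
    exact one_ne_zero hf
  have hw2 : ‖w‖ ≤ (1 + s) / 2 := by
    have := h.norm_fixMap_le hw
    rwa [hf] at this
  have hfix := (h.fixMap_eq_iff hw).1 hf
  set R := Ring.inverse (1 - w • A) with hR
  have hc : 0 ≤ ‖φ‖ * ‖A e‖ := by positivity
  set v : E := w • R e with hv
  have hφv : φ v = 1 := by simpa [hv] using hfix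
  have hv0 : v ≠ 0 := by
    rintro h0
    rw [h0, map_zero] at hφv
    exact zero_ne_one hφv
  have hHv : (A + φ.smulRight e) v = w⁻¹ • v := by
    have h1 := apply_inverse_cancel (h.res w hw).1 e
    rw [← hR] at h1
    have h2 : w • A (R e) = R e - e := by
      simp only [sub_apply, one_apply_eq_self, smul_apply] at h1
      rw [sub_eq_iff_eq_add'] at h1
      rw [eq_sub_iff_add_eq]
      exact h1.symm
    simp only [add_apply, ContinuousLinearMap.smulRight_apply, hφv, one_smul]
    rw [hv, map_smul, h2, smul_smul, inv_mul_cancel₀ hw0, one_smul]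
    abel
  refine ⟨?_, ?_, s⁻¹, by positivity, ?_, ?_⟩
  · exact Module.End.hasEigenvalue_of_hasEigenvector (x := v)
      ⟨Module.End.mem_eigenspace_iff.2 hHv, hv0⟩
  -- `φ(R² e)` is the derivative of `w φ(R e)` in `w`; that it is nonzero says that the root is
  -- simple, and it excludes Jordan blocks.
  · have hRR : w * φ (R (R e)) ≠ 0 := by
      have e1 : w * φ (R (R e)) = 1 + w ^ 2 * φ ((R * R) (A e)) := by
        have := congrArg (fun x => w * φ (R x)) (h.resolvent_apply_e hw)
        simp only [← hR, map_add, map_smul, smul_eq_mul] at this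
        rw [this, mul_apply_eq_comp]
        linear_combination hfix
      have b : ‖w ^ 2 * φ ((R * R) (A e))‖ ≤ 1 / 2 := by
        refine le_trans ?_ h.small₃
        rw [norm_mul, norm_pow, mul_assoc]
        gcongr
        refine (norm_apply_le φ _ _).trans (mul_le_mul_of_nonneg_right ?_ hc)
        calc ‖R * R‖ ≤ ‖R‖ * ‖R‖ := norm_mul_le _ _
          _ ≤ M * M := by
            have := (h.res w hw).2
            have := h.M_nonneg
            gcongr
          _ = M ^ 2 := by ring
      intro h0
      rw [e1] at h0
      have : w ^ 2 * φ ((R * R) (A e)) = -1 := by linear_combination h0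
      rw [this] at b
      norm_num at b
    -- Induction on the exponent: `T - 1/w` sends `x` to some `c v`. Solving for `x` with the
    -- resolvent and applying `φ` gives `c φ(R² e) = 0`, so `c = 0` and `x` is a true eigenvector.
    have key : ∀ k : ℕ, ∀ x : E,
        ((((A + φ.smulRight e : E →L[ℂ] E) : E →ₗ[ℂ] E) - w⁻¹ • 1) ^ k) x = 0 → ∃ c : ℂ, x = c • v := by
      intro k
      induction k with
      | zero => intro x hx; exact ⟨0, by simpa using hx⟩
      | succ k ih =>
        intro x hx
        rw [pow_succ, Module.End.mul_apply] at hx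
        obtain ⟨c, hcv⟩ := ih _ hx
        have h1 : w⁻¹ • x - (A + φ.smulRight e) x = -(c • v) := by
          rw [← hcv]
          simp
        have h2 := h.eq_of_sub_apply hw hw0 h1
        rw [← hR] at h2
        have h3 := congrArg φ h2
        simp only [hv, map_add, map_smul, map_neg, smul_eq_mul] at h3
        have h4 : c = 0 := by
          have h5 : w * (c * (w * φ (R (R e)))) = 0 := by linear_combination (φ x) * hfix + h3
          rcases mul_eq_zero.1 h5 with h6 | h6
          · exact absurd h6 hw0
          · rcases mul_eq_zero.1 h6 with h7 | h7
            · exact h7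
            · exact absurd h7 hRR
        rw [h4] at h2
        refine ⟨φ x, ?_⟩
        rw [hv, smul_smul]
        conv_lhs => rw [h2]
        simp [mul_comm]
    rw [finrank_eq_one_iff']
    refine ⟨⟨v, ?_⟩, ?_, ?_⟩
    · rw [Module.End.mem_maxGenEigenspace]
      refine ⟨1, ?_⟩
      have : (A + φ.smulRight e : E →L[ℂ] E) v - w⁻¹ • v = 0 := by rw [hHv, sub_self]
      simpa using this
    · intro h0
      exact hv0 (congrArg Subtype.val h0)
    · rintro ⟨x, hx⟩
      obtain ⟨k, hk⟩ := (Module.End.mem_maxGenEigenspace _ _ _).1 hx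
      obtain ⟨c, hc'⟩ := key k x hk
      exact ⟨c, Subtype.ext hc'.symm⟩
  · rw [norm_inv]
    exact (inv_lt_inv₀ (by linarith) (norm_pos_iff.2 hw0)).2 (by linarith)
  · intro m hm hne
    by_contra hlt
    push Not at hlt
    have hs0 : 0 < s := by linarith
    have hm0 : 0 < ‖m‖ := (inv_pos.2 hs0).trans hlt
    have hmne : m ≠ 0 := norm_pos_iff.1 hm0
    have hm1 : ‖m⁻¹‖ ≤ s := by
      rw [norm_inv]
      exact (inv_lt_of_inv_lt₀ hs0 hlt).le
    have hnf : fixMap φ e A m⁻¹ ≠ m⁻¹ := by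
      intro hfm
      exact hne (inv_injective (by rw [inv_inv]; exact h.fixed_unique hm1 hw hfm hf))
    rw [Ne, h.fixMap_eq_iff hm1] at hnf
    refine hm ?_
    set R' := Ring.inverse (1 - m⁻¹ • A) with hR'
    -- The operator `m - T` factors through the resolvent of `A` and a rank-one correction of the
    -- identity, invertible because `1/m` is not a fixed point.
    have e1 : algebraMap ℂ (E →L[ℂ] E) m - (A + φ.smulRight e) =
        algebraMap ℂ (E →L[ℂ] E) m * ((1 - m⁻¹ • A) * (1 - φ.smulRight (m⁻¹ • R' e))) := by
      ext x
      have h1 := apply_inverse_cancel (h.res _ hm1).1 e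
      rw [← hR'] at h1
      rw [mul_apply_eq_comp, mul_apply_eq_comp, sub_apply (1 : E →L[ℂ] E) (φ.smulRight _) x, map_sub,
        ContinuousLinearMap.smulRight_apply, map_smul, map_smul, h1]
      simp [Algebra.algebraMap_eq_smul_one, smul_sub, smul_smul, hmne]
      rw [mul_comm (φ x), ← mul_assoc, mul_inv_cancel₀ hmne, one_mul]
      abel
    change IsUnit (algebraMap ℂ (E →L[ℂ] E) m - (A + φ.smulRight e))
    rw [e1]
    refine ((IsUnit.mk0 m hmne).map (algebraMap ℂ (E →L[ℂ] E))).mul ((h.res _ hm1).1.mul ?_)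
    refine isUnit_one_sub_smulRight φ ?_
    simpa using hnf

lemma exists_isSimpleDominantEigenvalue (h : GoodPerturbation φ e A s M) :
    ∃ l, IsSimpleDominantEigenvalue (A + φ.smulRight e) l := by
  obtain ⟨w, hw, hf⟩ := h.exists_fixed
  exact ⟨w⁻¹, h.isSimpleDominantEigenvalue (by have := h.one_lt; linarith) hf⟩

lemma isUnit_one_sub (h : GoodPerturbation φ e A s M) : IsUnit (1 - A) := by
  have := (h.res 1 (by simpa using h.one_lt.le)).1
  rwa [one_smul] at this

/-- This trades the condition `λ = 1` for an explicit equation in the operator, so the regularity of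
the eigenvalue itself is never needed. -/
lemma isSimpleDominantEigenvalue_one_iff (h : GoodPerturbation φ e A s M) :
    IsSimpleDominantEigenvalue (A + φ.smulRight e) 1 ↔ φ (Ring.inverse (1 - A) e) = 1 := by
  have h1s : ‖(1 : ℂ)‖ ≤ s := by simpa using h.one_lt.le
  have hiff := h.fixMap_eq_iff h1s
  rw [one_mul, one_smul] at hiff
  constructor
  · intro hd
    obtain ⟨v, hv⟩ := hd.hasEigenvalue.exists_hasEigenvector
    have h1 : (1 : ℂ)⁻¹ • v - (A + φ.smulRight e) v = 0 := by
      have := hv.apply_eq_smul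
      rw [ContinuousLinearMap.coe_coe] at this
      rw [this, inv_one, sub_self]
    have h2 := h.eq_of_sub_apply h1s one_ne_zero h1
    rw [map_zero, smul_zero, add_zero, one_mul, one_smul] at h2
    have h3 : φ v ≠ 0 := by
      intro h0
      rw [h0, zero_smul] at h2
      exact hv.2 h2
    have h4 := congrArg φ h2
    rw [map_smul, smul_eq_mul] at h4
    exact mul_left_cancel₀ h3 (by rw [mul_one]; exact h4.symm)
  · intro h1
    have := h.isSimpleDominantEigenvalue h1s (hiff.2 h1)
    rwa [inv_one] at this

/-- If `1` is the dominant eigenvalue then the resolvent yields the normalized eigenvector. -/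
lemma apply_resolvent_eq (h : GoodPerturbation φ e A s M) (h1 : φ (Ring.inverse (1 - A) e) = 1) :
    (A + φ.smulRight e) (Ring.inverse (1 - A) e) = Ring.inverse (1 - A) e := by
  have h2 := apply_inverse_cancel h.isUnit_one_sub e
  simp only [sub_apply, one_apply_eq_self] at h2
  simp only [add_apply, ContinuousLinearMap.smulRight_apply, h1, one_smul]
  rw [sub_eq_iff_eq_add'] at h2
  exact h2.symm

end GoodPerturbation

end Perturbation

end

noncomputable section

/-! ### The question-mark function and the self-similarity of the Minkowski measure -/

lemma questionMark_zero : questionMark 0 = 0 := by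
  simp [questionMark, questionTerm_at_zero]

lemma questionMark_mem {x : ℝ} (hx : x ∈ Icc (0 : ℝ) 1) : questionMark x ∈ Icc (0 : ℝ) 1 :=
  isClosed_Icc.mem_of_tendsto (hasSum_questionMark hx).tendsto_sum_nat
    (Eventually.of_forall fun N => (questionPartial_aux N).1 x hx)

/-- Splitting off the first term of the series; this functional equation is the source of the
self-similarity of `μ`. -/
lemma questionMark_eq_fractInv {x : ℝ} (hx : x ∈ Icc (0 : ℝ) 1) (h0 : x ≠ 0) :
    questionMark x = (2 - questionMark (fractInv x)) / 2 ^ ⌊1 / x⌋₊ := by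
  have h1 : questionTerm x 0 = 2 / 2 ^ ⌊1 / x⌋₊ := by simp [questionTerm, cfDigit, h0]
  have h2 : HasSum (fun n => questionTerm x (n + 1)) (-(questionMark (fractInv x) / 2 ^ ⌊1 / x⌋₊)) := by
    simp only [questionTerm_succ]
    exact ((hasSum_questionMark (fractInv_mem x)).div_const _).neg
  have h3 := (hasSum_nat_add_iff' 1).2 (hasSum_questionMark hx)
  rw [Finset.sum_range_one, h1] at h3
  have := h3.unique h2
  rw [sub_div]
  linarith

lemma questionMark_one : questionMark 1 = 1 := by
  rw [questionMark_eq_fractInv (by simp) one_ne_zero]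
  simp [fractInv, questionMark_zero]

/-- The inverse branch `t ↦ 1 / (n + 1 + t)` on the reals. -/
def realBranch (n : ℕ) (t : ℝ) : ℝ := 1 / ((n : ℝ) + 1 + t)

lemma realBranch_pos (n : ℕ) {t : ℝ} (ht : 0 ≤ t) : 0 < realBranch n t := by
  unfold realBranch; positivity

lemma realBranch_mem (n : ℕ) {t : ℝ} (ht : t ∈ Icc (0 : ℝ) 1) : realBranch n t ∈ Icc (0 : ℝ) 1 := by
  refine ⟨(realBranch_pos n ht.1).le, ?_⟩
  have h0 := ht.1
  rw [realBranch, div_le_one (by positivity)]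
  have : (0 : ℝ) ≤ n := n.cast_nonneg
  linarith

lemma one_div_realBranch (n : ℕ) (t : ℝ) : 1 / realBranch n t = n + 1 + t := by
  simp [realBranch]

lemma floor_one_div_realBranch (n : ℕ) {t : ℝ} (ht : t ∈ Ico (0 : ℝ) 1) :
    ⌊1 / realBranch n t⌋ = (n : ℤ) + 1 := by
  rw [one_div_realBranch, Int.floor_eq_iff]
  push_cast
  exact ⟨by linarith [ht.1], by linarith [ht.2]⟩

lemma fract_one_div_realBranch (n : ℕ) {t : ℝ} (ht : t ∈ Ico (0 : ℝ) 1) :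
    Int.fract (1 / realBranch n t) = t := by
  rw [Int.fract, floor_one_div_realBranch n ht, one_div_realBranch]
  push_cast
  ring

lemma questionMark_realBranch (n : ℕ) {t : ℝ} (ht : t ∈ Icc (0 : ℝ) 1) :
    questionMark (realBranch n t) = (2 - questionMark t) / 2 ^ (n + 1) := by
  rw [questionMark_eq_fractInv (realBranch_mem n ht) (realBranch_pos n ht.1).ne']
  -- At `t = 1` the first partial quotient jumps to `n + 2` and the expansion stops, but the formula
  -- persists because `?(1) = 1`.
  rcases eq_or_lt_of_le ht.2 with h1 | h1
  · subst h1
    have e : 1 / realBranch n 1 = ((n + 2 : ℕ) : ℝ) := by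
      rw [one_div_realBranch]; push_cast; ring
    rw [fractInv, e, Int.fract_natCast, Nat.floor_natCast, questionMark_zero, questionMark_one,
      pow_succ _ (n + 1), div_eq_div_iff (by positivity) (by positivity)]
    ring
  · have e1 : fractInv (realBranch n t) = t := fract_one_div_realBranch n ⟨ht.1, h1⟩
    have e2 : ⌊1 / realBranch n t⌋₊ = n + 1 := by
      have h := floor_one_div_realBranch n ⟨ht.1, h1⟩
      rw [← Int.floor_toNat, h]
      rfl
    rw [e1, e2]

/-! ### Continuity of `?` and total mass of the Minkowski measure -/

lemma exists_questionMark_near (N : ℕ) : ∀ y ∈ Icc (0 : ℝ) 1,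
    ∃ x ∈ Icc (0 : ℝ) 1, |questionMark x - y| ≤ (1 / 2) ^ N := by
  induction N with
  | zero =>
    intro y hy
    refine ⟨0, by simp, ?_⟩
    rw [questionMark_zero, zero_sub, abs_neg, abs_of_nonneg hy.1, pow_zero]
    exact hy.2
  | succ N ih =>
    intro y hy
    rcases eq_or_lt_of_le hy.1 with h0 | h0
    · subst h0
      refine ⟨0, by simp, ?_⟩
      rw [questionMark_zero, sub_zero, abs_zero]
      positivity
    -- With `2^{-(n+1)} < y ≤ 2^{-n}` the number `2 - 2^{n+1} y` lies in `[0, 1]`; approximating it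
    -- by a value of `?` and applying branch `n` divides the error by `2^{n+1} ≥ 2`.
    · obtain ⟨n, hn1, hn2⟩ := exists_nat_pow_near_of_lt_one h0 hy.2
        (by norm_num : (0 : ℝ) < 1 / 2) (by norm_num)
      have hp : (0 : ℝ) < 2 ^ n := by positivity
      rw [one_div, inv_pow] at hn1 hn2
      have h1 : 1 < y * 2 ^ (n + 1) := by
        rwa [inv_lt_iff_one_lt_mul₀ (by positivity)] at hn1
      have h2 : y * 2 ^ n ≤ 1 := by
        rwa [le_inv_comm₀ h0 hp, ← one_div, le_div_iff₀ h0, mul_comm] at hn2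
      obtain ⟨x, hx, hxy⟩ := ih (2 - y * 2 ^ (n + 1)) ⟨by rw [pow_succ]; linarith, by linarith⟩
      refine ⟨realBranch n x, realBranch_mem n hx, ?_⟩
      rw [questionMark_realBranch n hx]
      have e : (2 - questionMark x) / 2 ^ (n + 1) - y =
          -(questionMark x - (2 - y * 2 ^ (n + 1))) / 2 ^ (n + 1) := by
        field_simp
        ring
      rw [e, abs_div, abs_neg, abs_of_pos (by positivity : (0 : ℝ) < 2 ^ (n + 1)),
        div_le_iff₀ (by positivity)]
      have h3 : (1 : ℝ) ≤ 2 ^ n := one_le_pow₀ (by norm_num)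
      have h4 : (0 : ℝ) < (1 / 2) ^ N := by positivity
      have h5 : (1 / 2 : ℝ) ^ (N + 1) * 2 ^ (n + 1) = (1 / 2) ^ N * 2 ^ n := by ring
      rw [h5]
      nlinarith

lemma continuous_questionMarkExt : Continuous questionMarkExt := by
  let g : Icc (0 : ℝ) 1 → Icc (0 : ℝ) 1 := fun x => ⟨questionMark x, questionMark_mem x.2⟩
  have hg : Monotone g := fun x y hxy => monotoneOn_questionMark x.2 y.2 hxy
  -- A monotone self-map of the interval with dense range has no jumps.
  have hd : DenseRange g := by
    refine Metric.dense_iff.2 fun y r hr => ?_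
    obtain ⟨N, hN⟩ := exists_pow_lt_of_lt_one hr (by norm_num : (1 / 2 : ℝ) < 1)
    obtain ⟨x, hx, hxy⟩ := exists_questionMark_near N y y.2
    refine ⟨g ⟨x, hx⟩, ?_, mem_range_self _⟩
    rw [Metric.mem_ball, Subtype.dist_eq, Real.dist_eq]
    exact hxy.trans_lt hN
  exact continuous_subtype_val.comp ((hg.continuous_of_denseRange hd).comp continuous_projIcc)

lemma questionMarkExt_of_mem {x : ℝ} (hx : x ∈ Icc (0 : ℝ) 1) :
    questionMarkExt x = questionMark x := by
  rw [questionMarkExt, projIcc_of_mem _ hx]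

lemma questionMarkExt_of_nonpos {x : ℝ} (hx : x ≤ 0) : questionMarkExt x = 0 := by
  rw [questionMarkExt, projIcc_of_le_left _ hx]
  exact questionMark_zero

lemma questionMarkExt_of_one_le {x : ℝ} (hx : 1 ≤ x) : questionMarkExt x = 1 := by
  rw [questionMarkExt, projIcc_of_right_le _ hx]
  exact questionMark_one

lemma coe_questionStieltjes :
    ⇑monotone_questionMarkExt.stieltjesFunction = questionMarkExt := by
  ext x
  rw [Monotone.stieltjesFunction_eq]
  exact continuous_questionMarkExt.continuousAt.continuousWithinAt.rightLim_eq

lemma tendsto_questionMarkExt_atBot : Tendsto questionMarkExt atBot (𝓝 0) :=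
  tendsto_const_nhds.congr' ((eventually_le_atBot 0).mono fun _ h => (questionMarkExt_of_nonpos h).symm)

lemma tendsto_questionMarkExt_atTop : Tendsto questionMarkExt atTop (𝓝 1) :=
  tendsto_const_nhds.congr' ((eventually_ge_atTop 1).mono fun _ h => (questionMarkExt_of_one_le h).symm)

instance : IsProbabilityMeasure minkowskiMeasure :=
  StieltjesFunction.isProbabilityMeasure _
    (by rw [coe_questionStieltjes]; exact tendsto_questionMarkExt_atBot)
    (by rw [coe_questionStieltjes]; exact tendsto_questionMarkExt_atTop)

lemma minkowskiMeasure_Iic (a : ℝ) :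
    minkowskiMeasure (Iic a) = ENNReal.ofReal (questionMarkExt a) := by
  rw [minkowskiMeasure, StieltjesFunction.measure_Iic _
    (by rw [coe_questionStieltjes]; exact tendsto_questionMarkExt_atBot), coe_questionStieltjes,
    sub_zero]

lemma minkowskiMeasure_Ici (a : ℝ) :
    minkowskiMeasure (Ici a) = ENNReal.ofReal (1 - questionMarkExt a) := by
  rw [minkowskiMeasure, StieltjesFunction.measure_Ici _
    (by rw [coe_questionStieltjes]; exact tendsto_questionMarkExt_atTop), coe_questionStieltjes,
    continuous_questionMarkExt.continuousAt.continuousWithinAt.leftLim_eq]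

lemma ae_minkowski_mem_Ioo : ∀ᵐ x ∂minkowskiMeasure, x ∈ Ioo (0 : ℝ) 1 := by
  have h0 : ∀ᵐ x ∂minkowskiMeasure, x ∉ Iic (0 : ℝ) := by
    rw [← measure_eq_zero_iff_ae_notMem, minkowskiMeasure_Iic, questionMarkExt_of_nonpos le_rfl,
      ENNReal.ofReal_zero]
  have h1 : ∀ᵐ x ∂minkowskiMeasure, x ∉ Ici (1 : ℝ) := by
    rw [← measure_eq_zero_iff_ae_notMem, minkowskiMeasure_Ici, questionMarkExt_of_one_le le_rfl,
      sub_self, ENNReal.ofReal_zero]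
  filter_upwards [h0, h1] with x hx hy
  exact ⟨not_le.1 hx, not_le.1 hy⟩

lemma minkowskiMeasure_restrict_Icc : minkowskiMeasure.restrict (Icc 0 1) = minkowskiMeasure :=
  Measure.restrict_eq_self_of_ae_mem (ae_minkowski_mem_Ioo.mono fun _ h => Ioo_subset_Icc_self h)

lemma minkowskiMeasure_restrict_Ioc : minkowskiMeasure.restrict (Ioc 0 1) = minkowskiMeasure :=
  Measure.restrict_eq_self_of_ae_mem (ae_minkowski_mem_Ioo.mono fun _ h => Ioo_subset_Ioc_self h)

/-! ### Self-similarity of the Minkowski measure -/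

lemma measurable_realBranch (n : ℕ) : Measurable (realBranch n) := by
  unfold realBranch; fun_prop

lemma hasSum_half_pow : HasSum (fun n : ℕ => (1 / 2 : ℝ) ^ (n + 1)) 1 := by
  have := hasSum_geometric_two.mul_right (1 / 2)
  simpa [pow_succ] using this

lemma exists_eq_realBranch {a : ℝ} (ha : 0 < a) (h1 : a ≤ 1) :
    ∃ (m : ℕ) (s : ℝ), s ∈ Ico (0 : ℝ) 1 ∧ a = realBranch m s := by
  have hf := one_le_floor_inv ⟨ha.le, h1⟩ ha.ne'
  have h2 := Nat.floor_le (one_div_pos.2 ha).le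
  have h3 := Nat.lt_floor_add_one (1 / a)
  refine ⟨⌊1 / a⌋₊ - 1, 1 / a - ⌊1 / a⌋₊, ⟨by linarith, by linarith⟩, ?_⟩
  rw [realBranch, Nat.cast_sub hf]
  simp

/-- The `n`-th term is the mass that the weighted image of `μ` under branch `n` gives to `(-∞, a]`.
For `a = 1/(m + 1 + s)` the terms `n < m` vanish, the term `n = m` is `2^{-(m+1)} (1 - ?(s))`, and
the later ones add up to `2^{-(m+1)}`. -/
lemma hasSum_questionMarkExt {a : ℝ} (ha : 0 < a) :
    HasSum (fun n : ℕ => (1 / 2 : ℝ) ^ (n + 1) * (1 - questionMarkExt (1 / a - (n + 1))))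
      (questionMarkExt a) := by
  rcases lt_or_ge 1 a with h1 | h1
  · rw [questionMarkExt_of_one_le h1.le]
    refine hasSum_half_pow.congr_fun fun n => ?_
    have h2 : 1 / a ≤ 1 := by rw [div_le_one ha]; exact h1.le
    have h3 : (0 : ℝ) ≤ n := n.cast_nonneg
    rw [questionMarkExt_of_nonpos (by linarith), sub_zero, mul_one]
  · obtain ⟨m, s, hs, rfl⟩ := exists_eq_realBranch ha h1
    have hs' : s ∈ Icc (0 : ℝ) 1 := Ico_subset_Icc_self hs
    rw [questionMarkExt_of_mem (realBranch_mem m hs'), questionMark_realBranch m hs',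
      one_div_realBranch, ← hasSum_nat_add_iff' m]
    have hlow : ∑ i ∈ Finset.range m, (1 / 2 : ℝ) ^ (i + 1) *
        (1 - questionMarkExt ((m : ℝ) + 1 + s - (i + 1))) = 0 := by
      refine Finset.sum_eq_zero fun i hi => ?_
      have h2 : (i : ℝ) + 1 ≤ m := by exact_mod_cast Finset.mem_range.1 hi
      rw [questionMarkExt_of_one_le (by linarith [hs.1]), sub_self, mul_zero]
    rw [hlow, sub_zero]
    have h3 : HasSum (fun k : ℕ => (1 / 2 : ℝ) ^ m * (1 / 2) ^ (k + 1) -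
        if k = 0 then (1 / 2 : ℝ) ^ (m + 1) * questionMark s else 0)
        ((1 / 2 : ℝ) ^ m * 1 - (1 / 2) ^ (m + 1) * questionMark s) :=
      (hasSum_half_pow.mul_left _).sub (hasSum_ite_eq 0 _)
    have e : (2 - questionMark s) / 2 ^ (m + 1) =
        (1 / 2 : ℝ) ^ m * 1 - (1 / 2) ^ (m + 1) * questionMark s := by
      rw [one_div, inv_pow, inv_pow, pow_succ]
      field_simp
    rw [e]
    refine h3.congr_fun fun k => ?_
    rcases Nat.eq_zero_or_pos k with rfl | hk
    · have e2 : (m : ℝ) + 1 + s - (((0 + m : ℕ) : ℝ) + 1) = s := by push_cast; ring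
      rw [e2, questionMarkExt_of_mem hs', if_pos rfl, Nat.zero_add]
      ring
    · have hk' : (1 : ℝ) ≤ k := by exact_mod_cast hk
      rw [questionMarkExt_of_nonpos (by push_cast; linarith [hs.2]), if_neg hk.ne']
      ring

/-- The Minkowski measure is invariant under the transfer operator. -/
theorem minkowskiMeasure_eq_sum :
    minkowskiMeasure = Measure.sum fun n : ℕ =>
      ENNReal.ofReal ((1 / 2) ^ (n + 1)) • minkowskiMeasure.map (realBranch n) := by
  refine Measure.ext_of_Iic _ _ fun a => ?_
  rw [Measure.sum_apply _ measurableSet_Iic, minkowskiMeasure_Iic]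
  simp only [Measure.smul_apply, smul_eq_mul,
    Measure.map_apply (measurable_realBranch _) measurableSet_Iic]
  rcases le_or_gt a 0 with ha | ha
  · rw [questionMarkExt_of_nonpos ha, ENNReal.ofReal_zero]
    symm
    rw [ENNReal.tsum_eq_zero]
    intro n
    have : minkowskiMeasure (realBranch n ⁻¹' Iic a) = 0 := by
      rw [measure_eq_zero_iff_ae_notMem]
      filter_upwards [ae_minkowski_mem_Ioo] with t ht hta
      exact absurd (ha.trans_lt' (lt_of_lt_of_le (realBranch_pos n ht.1.le) hta)) (lt_irrefl _)
    rw [this, mul_zero]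
  · have hn (n : ℕ) : minkowskiMeasure (realBranch n ⁻¹' Iic a) =
        ENNReal.ofReal (1 - questionMarkExt (1 / a - (n + 1))) := by
      rw [← minkowskiMeasure_Ici]
      refine measure_congr ?_
      filter_upwards [ae_minkowski_mem_Ioo] with t ht
      have h0 : (0 : ℝ) < n + 1 + t := by
        have := ht.1
        positivity
      refine propext ?_
      change realBranch n t ≤ a ↔ 1 / a - (n + 1) ≤ t
      rw [realBranch, div_le_comm₀ h0 ha, sub_le_iff_le_add']
    have hnn (x : ℝ) : 0 ≤ 1 - questionMarkExt x :=
      sub_nonneg.2 (questionMark_mem (projIcc (0 : ℝ) 1 zero_le_one x).2).2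
    simp only [hn, ← ENNReal.ofReal_mul (by positivity : (0 : ℝ) ≤ (1 / 2) ^ _)]
    rw [← ENNReal.ofReal_tsum_of_nonneg (fun n => mul_nonneg (by positivity) (hnn _))
      (hasSum_questionMarkExt ha).summable, (hasSum_questionMarkExt ha).tsum_eq]

/-- Every image measure has positive weight in the decomposition of `μ`, so null sets pull back to
null sets under each branch. -/
lemma ae_comp_realBranch {p : ℝ → Prop} (h : ∀ᵐ x ∂minkowskiMeasure, p x) (n : ℕ) :
    ∀ᵐ t ∂minkowskiMeasure, p (realBranch n t) := by
  rw [minkowskiMeasure_eq_sum, Measure.ae_sum_iff] at h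
  have h1 := h n
  rw [Measure.ae_ennreal_smul_measure_iff (by positivity)] at h1
  exact ae_of_ae_map (measurable_realBranch n).aemeasurable h1

section

variable {F : Type*} [NormedAddCommGroup F]

lemma integrable_comp_realBranch {g : ℝ → F} (hg : Integrable g minkowskiMeasure) (n : ℕ) :
    Integrable (fun t => g (realBranch n t)) minkowskiMeasure := by
  rw [minkowskiMeasure_eq_sum, integrable_sum_measure_iff] at hg
  have h1 := hg.1 n
  rw [integrable_smul_measure (by positivity) ENNReal.ofReal_ne_top] at h1
  exact h1.comp_measurable (measurable_realBranch n)

/-- Integration against the Minkowski measure, branch by branch. -/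
lemma hasSum_integral_minkowski [NormedSpace ℝ F] {g : ℝ → F} (hg : Integrable g minkowskiMeasure) :
    HasSum (fun n : ℕ => (1 / 2 : ℝ) ^ (n + 1) • ∫ t, g (realBranch n t) ∂minkowskiMeasure)
      (∫ x, g x ∂minkowskiMeasure) := by
  have hg' := hg
  rw [minkowskiMeasure_eq_sum] at hg'
  have h1 := hasSum_integral_measure hg'
  rw [← minkowskiMeasure_eq_sum] at h1
  refine h1.congr_fun fun n => ?_
  have h2 := (integrable_sum_measure_iff.1 hg').1 n
  rw [integrable_smul_measure (by positivity) ENNReal.ofReal_ne_top] at h2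
  rw [integral_smul_measure, ENNReal.toReal_ofReal (by positivity),
    integral_map (measurable_realBranch n).aemeasurable h2.aestronglyMeasurable]

/-- On branch `n` one has `1/x ≤ n + 2`, against a weight `2^{-(n+1)}`. Since `|log x|` and `⌊1/x⌋`
are at most `1/x`, this one majorant also handles their squares and products. -/
lemma integrable_one_div_sq : Integrable (fun x : ℝ => (1 / x) ^ 2) minkowskiMeasure := by
  have hm : Measurable (fun x : ℝ => (1 / x) ^ 2) := by fun_prop
  have hb (n : ℕ) : ∀ᵐ t ∂minkowskiMeasure, ‖(1 / realBranch n t) ^ 2‖ ≤ ((n : ℝ) + 2) ^ 2 := by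
    filter_upwards [ae_minkowski_mem_Ioo] with t ht
    have := ht.1
    rw [one_div_realBranch, Real.norm_of_nonneg (by positivity)]
    exact pow_le_pow_left₀ (by positivity) (by linarith [ht.2]) 2
  have hi (n : ℕ) : Integrable (fun t => (1 / realBranch n t) ^ 2) minkowskiMeasure :=
    Integrable.of_bound (hm.comp (measurable_realBranch n)).aestronglyMeasurable _ (hb n)
  rw [minkowskiMeasure_eq_sum]
  refine integrable_sum_measure (fun n => ?_) ?_
  · rw [integrable_smul_measure (by positivity) ENNReal.ofReal_ne_top,
      integrable_map_measure hm.aestronglyMeasurable (measurable_realBranch n).aemeasurable]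
    exact hi n
  · have hs : Summable fun n : ℕ => (1 / 2 : ℝ) ^ (n + 1) * ((n : ℝ) + 2) ^ 2 := by
      have := (summable_nat_add_iff 2).2
        (summable_pow_mul_geometric_of_norm_lt_one (R := ℝ) 2 (r := 1 / 2) (by norm_num))
      refine (this.mul_left 2).congr fun n => ?_
      push_cast
      ring
    refine Summable.of_nonneg_of_le (fun n => integral_nonneg fun _ => norm_nonneg _) (fun n => ?_) hs
    rw [integral_smul_measure, ENNReal.toReal_ofReal (by positivity),
      integral_map (measurable_realBranch n).aemeasurable hm.norm.aestronglyMeasurable, smul_eq_mul]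
    refine mul_le_mul_of_nonneg_left ?_ (by positivity)
    have := integral_mono_ae (hi n).norm (integrable_const _) (hb n)
    simpa using this

lemma integrable_minkowski_of_le {g : ℝ → F} (hg : AEStronglyMeasurable g minkowskiMeasure) {C : ℝ}
    (hC : ∀ x ∈ Ioo (0 : ℝ) 1, ‖g x‖ ≤ C * (1 / x) ^ 2) : Integrable g minkowskiMeasure := by
  refine (integrable_one_div_sq.const_mul C).mono' hg ?_
  filter_upwards [ae_minkowski_mem_Ioo] with x hx using hC x hx

end

end

noncomputable section

/-! ### Operators on `H^∞(𝔻)` -/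

instance : NormedRing (Hinf →L[ℂ] Hinf) := ContinuousLinearMap.toNormedRing

instance : NormedAlgebra ℂ (Hinf →L[ℂ] Hinf) := ContinuousLinearMap.toNormedAlgebra

namespace Hinf

lemma ext_apply {f g : Hinf} (h : ∀ t, f.1 t = g.1 t) : f = g :=
  Subtype.ext (BoundedContinuousFunction.ext h)

lemma norm_coe_apply_le (f : Hinf) (t : gaussDisc) : ‖f.1 t‖ ≤ ‖f‖ := f.1.norm_coe_le_norm t

lemma norm_le_of_forall {f : Hinf} {C : ℝ} (hC : 0 ≤ C) (h : ∀ t, ‖f.1 t‖ ≤ C) : ‖f‖ ≤ C :=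
  (BoundedContinuousFunction.norm_le hC).2 h

/-- Evaluation at a point of the disc. -/
def eval (t : gaussDisc) : Hinf →L[ℂ] ℂ :=
  (BoundedContinuousFunction.evalCLM ℂ t).comp Hinf.subtypeL

@[simp] lemma eval_apply (t : gaussDisc) (f : Hinf) : eval t f = f.1 t := rfl

@[simp] lemma sub_apply (f g : Hinf) (t : gaussDisc) : (f - g).1 t = f.1 t - g.1 t := rfl
@[simp] lemma smul_apply (c : ℂ) (f : Hinf) (t : gaussDisc) : (c • f).1 t = c * f.1 t := rfl

/-- A bounded holomorphic function on the disc as an element of `H^∞(𝔻)`. -/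
def ofFun (F : ℂ → ℂ) (hF : DifferentiableOn ℂ F gaussDisc) (C : ℝ)
    (hC : ∀ t ∈ gaussDisc, ‖F t‖ ≤ C) : Hinf :=
  ⟨BoundedContinuousFunction.ofNormedAddCommGroup (fun t : gaussDisc => F t)
    hF.continuousOn.domRestrict C fun t => hC t t.2, F, hF, fun _ => rfl⟩

/-- Uniform limits of holomorphic functions are holomorphic. The resulting completeness is what
operator series and resolvents require. -/
lemma isClosed : IsClosed (Hinf : Set (BoundedContinuousFunction gaussDisc ℂ)) := by
  classical
  rw [← isSeqClosed_iff_isClosed]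
  intro f g hf hg
  choose F hF hfF using hf
  have hu : TendstoUniformly (fun n => ⇑(f n)) (⇑g) atTop :=
    BoundedContinuousFunction.tendsto_iff_tendstoUniformly.1 hg
  let G : ℂ → ℂ := fun t => if h : t ∈ gaussDisc then g ⟨t, h⟩ else 0
  have hG : TendstoUniformlyOn F G atTop gaussDisc := by
    rw [Metric.tendstoUniformlyOn_iff]
    intro ε hε
    filter_upwards [Metric.tendstoUniformly_iff.1 hu ε hε] with n hn t ht
    have := hn ⟨t, ht⟩
    rw [hfF] at this
    simpa [G, ht] using this
  exact ⟨G, hG.tendstoLocallyUniformlyOn.differentiableOn (Eventually.of_forall hF)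
    Metric.isOpen_ball, fun t => by simp [G]⟩

instance : CompleteSpace Hinf := isClosed.completeSpace_coe

/-- The constant function `1`. -/
def one : Hinf := ofFun (fun _ => 1) (differentiableOn_const 1) 1 (by simp)

@[simp] lemma one_apply (t : gaussDisc) : one.1 t = 1 := rfl

end Hinf

/-- The product of two bounded holomorphic functions. -/
def Hinf.mul (g f : Hinf) : Hinf :=
  ⟨g.1 * f.1, by
    obtain ⟨G, hG, hg⟩ := g.2
    obtain ⟨F, hF, hf⟩ := f.2
    refine ⟨G * F, hG.mul hF, fun t => ?_⟩
    rw [BoundedContinuousFunction.mul_apply, hg, hf, Pi.mul_apply]⟩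

/-- Multiplication by a bounded holomorphic function. -/
def mulOp (g : Hinf) : Hinf →L[ℂ] Hinf :=
  LinearMap.mkContinuous
    { toFun := Hinf.mul g
      map_add' := fun f₁ f₂ => Hinf.ext_apply fun t => mul_add (g.1 t) (f₁.1 t) (f₂.1 t)
      map_smul' := fun c f => Hinf.ext_apply fun t => mul_left_comm (g.1 t) c (f.1 t) }
    ‖g‖ fun f => Hinf.norm_le_of_forall (mul_nonneg (norm_nonneg _) (norm_nonneg _)) fun t => by
      change ‖g.1 t * f.1 t‖ ≤ _
      rw [norm_mul]
      exact mul_le_mul (Hinf.norm_coe_apply_le g t) (Hinf.norm_coe_apply_le f t) (norm_nonneg _)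
        (norm_nonneg _)

lemma norm_mulOp_le (g : Hinf) : ‖mulOp g‖ ≤ ‖g‖ :=
  LinearMap.mkContinuous_norm_le _ (norm_nonneg _) _

/-- The inverse branch `t ↦ 1 / (n + 1 + t)` as a self-map of the disc. -/
def branch (n : ℕ) (t : gaussDisc) : gaussDisc := ⟨1 / ((n : ℂ) + 1 + t), branch_mem t.2 n⟩

lemma add_mem_slitPlane (n : ℕ) {t : ℂ} (ht : t ∈ gaussDisc) :
    (n : ℂ) + 1 + t ∈ Complex.slitPlane :=
  Or.inl (by linarith [two_thirds_lt_re ht n])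

lemma add_ne_zero_of_mem (n : ℕ) {t : ℂ} (ht : t ∈ gaussDisc) : (n : ℂ) + 1 + t ≠ 0 :=
  Complex.slitPlane_ne_zero (add_mem_slitPlane n ht)

lemma continuous_branch (n : ℕ) : Continuous (branch n) :=
  Continuous.subtype_mk (continuous_const.div (by fun_prop) fun t => add_ne_zero_of_mem n t.2) _

/-- The composition of a bounded holomorphic function with an inverse branch. -/
def Hinf.compBranch (n : ℕ) (f : Hinf) : Hinf :=
  ⟨f.1.compContinuous ⟨branch n, continuous_branch n⟩, by
    obtain ⟨F, hF, hf⟩ := f.2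
    refine ⟨fun t => F (1 / ((n : ℂ) + 1 + t)), ?_, fun t => hf (branch n t)⟩
    refine hF.comp (fun t ht => ?_) (fun t ht => branch_mem ht n)
    exact ((differentiableAt_const 1).div (by fun_prop)
      (add_ne_zero_of_mem n ht)).differentiableWithinAt⟩

/-- Composition with an inverse branch. -/
def compOp (n : ℕ) : Hinf →L[ℂ] Hinf :=
  LinearMap.mkContinuous
    { toFun := Hinf.compBranch n
      map_add' := fun _ _ => rfl
      map_smul' := fun _ _ => rfl }
    1 fun f => Hinf.norm_le_of_forall (mul_nonneg zero_le_one (norm_nonneg _)) fun t => by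
      rw [one_mul]
      exact Hinf.norm_coe_apply_le f (branch n t)

@[simp] lemma compOp_apply (n : ℕ) (f : Hinf) (t : gaussDisc) :
    (compOp n f).1 t = f.1 (branch n t) := rfl

/-! ### The transfer operators as series convergent in operator norm -/

lemma norm_add_le_of_mem (n : ℕ) {t : ℂ} (ht : t ∈ gaussDisc) : ‖(n : ℂ) + 1 + t‖ ≤ n + 3 := by
  have h1 : ‖t - 2 / 3‖ < 1 := by simpa [gaussDisc, dist_eq_norm] using ht
  have h2 : ‖t‖ ≤ ‖t - 2 / 3‖ + ‖(2 / 3 : ℂ)‖ := by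
    simpa using norm_add_le (t - 2 / 3) (2 / 3 : ℂ)
  have h3 : ‖(2 / 3 : ℂ)‖ = 2 / 3 := by simp
  have h4 := norm_add_le ((n : ℂ) + 1) t
  have h5 : ‖(n : ℂ) + 1‖ = (n : ℝ) + 1 := by
    rw [← Nat.cast_succ, Complex.norm_natCast, Nat.cast_succ]
  linarith

lemma norm_log_le_of_re {w : ℂ} (hw : 2 / 3 < w.re) {C : ℝ} (h1 : 1 ≤ C) (hC : ‖w‖ ≤ C) :
    ‖Complex.log w‖ ≤ C + 4 := by
  have h0 : 2 / 3 < ‖w‖ := hw.trans_le (Complex.re_le_norm w)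
  have h2 : |Real.log ‖w‖| ≤ C := by
    rw [abs_le]
    constructor
    · have := Real.one_sub_inv_le_log_of_pos (show 0 < ‖w‖ by linarith)
      have h3 : ‖w‖⁻¹ ≤ (2 / 3)⁻¹ := inv_anti₀ (by norm_num) h0.le
      norm_num at h3
      linarith
    · exact (Real.log_le_self (norm_nonneg w)).trans hC
  have h3 := Complex.norm_le_abs_re_add_abs_im (Complex.log w)
  rw [Complex.log_re, Complex.log_im] at h3
  have := Complex.abs_arg_le_pi w
  linarith [Real.pi_le_four]

/-- The function `t ↦ log (n + 1 + t)`. -/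
def logH (n : ℕ) : Hinf :=
  Hinf.ofFun (fun t => Complex.log ((n : ℂ) + 1 + t))
    (fun t ht => (DifferentiableAt.clog (by fun_prop) (add_mem_slitPlane n ht)).differentiableWithinAt)
    (n + 7) (fun t ht => by
      refine (norm_log_le_of_re (two_thirds_lt_re ht n) ?_ (norm_add_le_of_mem n ht)).trans (by linarith)
      have : (0 : ℝ) ≤ n := n.cast_nonneg
      linarith)

@[simp] lemma logH_apply (n : ℕ) (t : gaussDisc) :
    (logH n).1 t = Complex.log ((n : ℂ) + 1 + t) := rfl

/-- Multiplication by `t ↦ -log (n + 1 + t)`. -/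
def genOp (n : ℕ) : Hinf →L[ℂ] Hinf := -mulOp (logH n)

@[simp] lemma genOp_apply (n : ℕ) (f : Hinf) (t : gaussDisc) :
    (genOp n f).1 t = -(Complex.log ((n : ℂ) + 1 + t) * f.1 t) := rfl

lemma norm_genOp_le (n : ℕ) : ‖genOp n‖ ≤ n + 7 := by
  rw [genOp, norm_neg]
  refine (norm_mulOp_le _).trans (Hinf.norm_le_of_forall (by positivity) fun t => ?_)
  rw [logH_apply]
  have : (0 : ℝ) ≤ n := n.cast_nonneg
  exact (norm_log_le_of_re (two_thirds_lt_re t.2 n) (by linarith)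
    (norm_add_le_of_mem n t.2)).trans (by linarith)

lemma genOp_pow_apply (n k : ℕ) (f : Hinf) (t : gaussDisc) :
    ((genOp n ^ k) f).1 t = (-Complex.log ((n : ℂ) + 1 + t)) ^ k * f.1 t := by
  induction k with
  | zero => simp
  | succ k ih =>
    rw [pow_succ', mul_apply_eq_comp, genOp_apply, ih, pow_succ]
    ring

lemma exp_genOp_apply (n : ℕ) (τ : ℂ) (f : Hinf) (t : gaussDisc) :
    (NormedSpace.exp (τ • genOp n) f).1 t =
      Complex.exp (-(τ * Complex.log ((n : ℂ) + 1 + t))) * f.1 t := by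
  have h1 := NormedSpace.exp_series_hasSum_exp' (𝕂 := ℂ) (τ • genOp n)
  have h2 := h1.mapL ((Hinf.eval t).comp (ContinuousLinearMap.apply ℂ Hinf f))
  have h3 := (NormedSpace.exp_series_hasSum_exp' (𝕂 := ℂ)
    (-(τ * Complex.log ((n : ℂ) + 1 + t)))).mul_right (f.1 t)
  rw [← Complex.exp_eq_exp_ℂ] at h3
  refine h2.unique (h3.congr_fun fun k => ?_)
  simp only [smul_pow, ContinuousLinearMap.comp_apply, map_smul, ContinuousLinearMap.apply_apply,
    Hinf.eval_apply, smul_eq_mul, genOp_pow_apply]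
  ring

/-- The operator `f ↦ (n + 1 + t)^{-τ} f(1 / (n + 1 + t))`. -/
def termOp (n : ℕ) (τ : ℂ) : Hinf →L[ℂ] Hinf := NormedSpace.exp (τ • genOp n) * compOp n

lemma termOp_apply (n : ℕ) (τ : ℂ) (f : Hinf) (t : gaussDisc) :
    (termOp n τ f).1 t = 1 / ((n : ℂ) + 1 + t) ^ τ * f.1 (branch n t) := by
  rw [termOp, mul_apply_eq_comp, exp_genOp_apply, compOp_apply,
    Complex.cpow_def_of_ne_zero (add_ne_zero_of_mem n t.2), Complex.exp_neg, one_div, mul_comm τ]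

lemma norm_termOp_le (n : ℕ) (τ : ℂ) : ‖termOp n τ‖ ≤ Real.exp (‖τ‖ * (n + 7)) := by
  refine ContinuousLinearMap.opNorm_le_bound _ (Real.exp_nonneg _) fun f => ?_
  refine Hinf.norm_le_of_forall (by positivity) fun t => ?_
  rw [termOp, mul_apply_eq_comp, exp_genOp_apply, norm_mul, Complex.norm_exp, compOp_apply]
  refine mul_le_mul (Real.exp_le_exp.2 ?_) (Hinf.norm_coe_apply_le f _) (norm_nonneg _) (Real.exp_nonneg _)
  refine (Complex.re_le_norm _).trans ?_
  rw [norm_neg, norm_mul]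
  have : (0 : ℝ) ≤ n := n.cast_nonneg
  refine mul_le_mul_of_nonneg_left ?_ (norm_nonneg _)
  exact (norm_log_le_of_re (two_thirds_lt_re t.2 n) (by linarith)
    (norm_add_le_of_mem n t.2)).trans (by linarith)

/-- Writing `(n + 1 + t)^{-τ}` as the exponential of a bounded operator gives differentiability in
operator norm at once. Apart from norm bounds, `T' = G T` is all that the series lemmas below use.
-/
lemma hasDerivAt_termOp (n : ℕ) (τ : ℂ) :
    HasDerivAt (termOp n) (genOp n * termOp n τ) τ := by
  have := (hasDerivAt_exp_smul_const' (𝕂 := ℂ) (genOp n) τ).mul_const (compOp n)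
  rw [mul_assoc] at this
  exact this

lemma exp_tenth_mul_le : Real.exp (1 / 10) * (3 / 5) ≤ 3 / 4 := by
  have h := Real.exp_bound_div_one_sub_of_interval (x := 1 / 10) (by norm_num) (by norm_num)
  norm_num at h ⊢
  linarith

/-- A summable majorant of the terms of the transfer operators and of their derivatives. -/
def termBound (n : ℕ) : ℝ := ((n : ℝ) + 7) * (Real.exp (7 / 10) * (3 / 4) ^ n)

lemma summable_mul_termBound : Summable fun n : ℕ => ((n : ℝ) + 7) * termBound n := by
  have h2 := summable_pow_mul_geometric_of_norm_lt_one (R := ℝ) 2 (r := 3 / 4) (by norm_num)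
  have h1 := summable_pow_mul_geometric_of_norm_lt_one (R := ℝ) 1 (r := 3 / 4) (by norm_num)
  have h0 := summable_pow_mul_geometric_of_norm_lt_one (R := ℝ) 0 (r := 3 / 4) (by norm_num)
  refine (((h2.add (h1.mul_left 14)).add (h0.mul_left 49)).mul_left (Real.exp (7 / 10))).congr
    fun n => ?_
  unfold termBound
  ring

lemma termBound_nonneg (n : ℕ) : 0 ≤ termBound n := by unfold termBound; positivity

lemma summable_termBound : Summable termBound := by
  refine Summable.of_nonneg_of_le termBound_nonneg (fun n => ?_) summable_mul_termBound
  have : (0 : ℝ) ≤ n := n.cast_nonneg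
  exact le_mul_of_one_le_left (termBound_nonneg n) (by linarith)

/-- The growth `e^{n/10}` of the terms is absorbed by `(3/5)^n`, since `(3/5) e^{1/10} ≤ 3/4`. The
factor `n + 7` leaves room for one derivative in `z`, costing `n + 1`, or in `τ`, costing `‖genOp
n‖`. -/
lemma pow_mul_norm_termOp_le (n : ℕ) {τ : ℂ} (hτ : ‖τ‖ ≤ 1 / 10) {r : ℝ} (h0 : 0 ≤ r)
    (hr : r ≤ 3 / 5) : ((n : ℝ) + 7) * (r ^ n * ‖termOp n τ‖) ≤ termBound n := by
  unfold termBound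
  refine mul_le_mul_of_nonneg_left ?_ (by positivity)
  calc r ^ n * ‖termOp n τ‖ ≤ (3 / 5) ^ n * Real.exp (1 / 10 * (n + 7)) := by
        gcongr
        exact (norm_termOp_le n τ).trans (Real.exp_le_exp.2 (by gcongr))
    _ = Real.exp (7 / 10) * (Real.exp (1 / 10) * (3 / 5)) ^ n := by
        rw [mul_pow, ← Real.exp_nat_mul, show (1 / 10 : ℝ) * (n + 7) = 7 / 10 + n * (1 / 10) by ring,
          Real.exp_add]
        ring
    _ ≤ _ := by
        gcongr
        exact exp_tenth_mul_le

lemma norm_smul_termOp_le (n : ℕ) {τ z : ℂ} (hτ : ‖τ‖ ≤ 1 / 10) (hz : ‖z‖ ≤ 3 / 5) :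
    ‖z ^ (n + 1) • termOp n τ‖ ≤ termBound n := by
  refine le_trans ?_ (pow_mul_norm_termOp_le n hτ (norm_nonneg z) hz)
  rw [norm_smul, norm_pow, pow_succ, mul_assoc, mul_left_comm]
  have : (0 : ℝ) ≤ n := n.cast_nonneg
  exact mul_le_mul_of_nonneg_right (by linarith) (by positivity)

lemma hasSum_transferOp {τ z : ℂ} (hτ : ‖τ‖ ≤ 1 / 10) (hz : ‖z‖ ≤ 3 / 5) :
    HasSum (fun n => z ^ (n + 1) • termOp n τ) (transferOp τ z) := by
  have hs : Summable fun n => z ^ (n + 1) • termOp n τ :=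
    Summable.of_norm_bounded summable_termBound fun n => norm_smul_termOp_le n hτ hz
  have h := hs.hasSum
  have e : ∑' n, z ^ (n + 1) • termOp n τ = transferOp τ z := by
    refine ContinuousLinearMap.ext fun f => Hinf.ext_apply fun t => ?_
    have h1 := h.mapL ((Hinf.eval t).comp (ContinuousLinearMap.apply ℂ Hinf f))
    rw [transferOp_apply τ (by linarith)]
    refine h1.tsum_eq.symm.trans (tsum_congr fun n => ?_)
    change z ^ (n + 1) * (termOp n τ f).1 t = _
    rw [termOp_apply]
    simp only [branch]
    ring
  rwa [e] at h

/-! ### The invariant functional -/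

/-- The inclusion of `[0, 1]` in the disc, extended to the line by projection. -/
def realPt (x : ℝ) : gaussDisc :=
  ⟨((projIcc (0 : ℝ) 1 zero_le_one x : ℝ) : ℂ), by
    have h := (projIcc (0 : ℝ) 1 zero_le_one x).2
    rw [gaussDisc, Metric.mem_ball, dist_eq_norm,
      show (((projIcc (0 : ℝ) 1 zero_le_one x : ℝ) : ℂ) - 2 / 3) =
        (((projIcc (0 : ℝ) 1 zero_le_one x : ℝ) - 2 / 3 : ℝ) : ℂ) by push_cast; rfl,
      Complex.norm_real, Real.norm_eq_abs, abs_lt]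
    constructor <;> linarith [h.1, h.2]⟩

lemma continuous_realPt : Continuous realPt :=
  Continuous.subtype_mk (Complex.continuous_ofReal.comp
    (continuous_subtype_val.comp continuous_projIcc)) _

lemma coe_realPt {x : ℝ} (hx : x ∈ Icc (0 : ℝ) 1) : (realPt x : ℂ) = x := by
  change ((projIcc (0 : ℝ) 1 zero_le_one x : ℝ) : ℂ) = x
  rw [projIcc_of_mem _ hx]

lemma branch_realPt (n : ℕ) {t : ℝ} (ht : t ∈ Icc (0 : ℝ) 1) :
    branch n (realPt t) = realPt (realBranch n t) := by
  apply Subtype.ext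
  rw [coe_realPt (realBranch_mem n ht), branch]
  simp only [coe_realPt ht, realBranch]
  push_cast
  rfl

lemma integrable_realPt (f : Hinf) : Integrable (fun x => f.1 (realPt x)) minkowskiMeasure :=
  Integrable.of_bound (f.1.continuous.comp continuous_realPt).aestronglyMeasurable ‖f‖
    (ae_of_all _ fun _ => Hinf.norm_coe_apply_le f _)

/-- Integration against the Minkowski measure, as a functional on `H^∞(𝔻)`. -/
def minkowskiFunctional : Hinf →L[ℂ] ℂ :=
  LinearMap.mkContinuous
    { toFun := fun f => ∫ x, f.1 (realPt x) ∂minkowskiMeasure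
      map_add' := fun f g => integral_add (integrable_realPt f) (integrable_realPt g)
      map_smul' := fun c f => integral_const_mul c _ }
    1 fun f => by
      have h := norm_integral_le_of_norm_le_const (μ := minkowskiMeasure)
        (ae_of_all _ fun x => Hinf.norm_coe_apply_le f (realPt x))
      rw [probReal_univ, mul_one] at h
      rw [one_mul]
      exact h

lemma minkowskiFunctional_apply (f : Hinf) :
    minkowskiFunctional f = ∫ x, f.1 (realPt x) ∂minkowskiMeasure := rfl

lemma minkowskiFunctional_one : minkowskiFunctional Hinf.one = 1 := by
  rw [minkowskiFunctional_apply]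
  simp only [Hinf.one_apply, integral_const, probReal_univ, one_smul]

end

noncomputable section

/-! ### The spectral gap of the unperturbed operator -/

/-- The transfer operator `f ↦ ∑ 2^{-n} f(1 / (n + t))`. -/
def baseOp : Hinf →L[ℂ] Hinf := transferOp 0 (1 / 2)

lemma termOp_zero (n : ℕ) : termOp n 0 = compOp n := by
  rw [termOp, zero_smul, NormedSpace.exp_zero, one_mul]

lemma hasSum_baseOp : HasSum (fun n => (1 / 2 : ℂ) ^ (n + 1) • compOp n) baseOp := by
  have := hasSum_transferOp (τ := 0) (z := 1 / 2) (by norm_num) (by norm_num)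
  simp only [termOp_zero] at this
  exact this

lemma hasSum_apply {T : ℕ → Hinf →L[ℂ] Hinf} {S : Hinf →L[ℂ] Hinf} (h : HasSum T S) (f : Hinf)
    (t : gaussDisc) : HasSum (fun n => (T n f).1 t) ((S f).1 t) :=
  h.mapL ((Hinf.eval t).comp (ContinuousLinearMap.apply ℂ Hinf f))

lemma hasSum_functional {T : ℕ → Hinf →L[ℂ] Hinf} {S : Hinf →L[ℂ] Hinf} (h : HasSum T S)
    (f : Hinf) : HasSum (fun n => minkowskiFunctional (T n f)) (minkowskiFunctional (S f)) :=
  h.mapL (minkowskiFunctional.comp (ContinuousLinearMap.apply ℂ Hinf f))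

lemma hasSum_baseOp_apply (f : Hinf) (t : gaussDisc) :
    HasSum (fun n => (1 / 2 : ℂ) ^ (n + 1) * f.1 (branch n t)) ((baseOp f).1 t) :=
  hasSum_apply hasSum_baseOp f t

lemma minkowskiFunctional_compOp (n : ℕ) (f : Hinf) : minkowskiFunctional (compOp n f) =
    ∫ t, f.1 (realPt (realBranch n t)) ∂minkowskiMeasure := by
  rw [minkowskiFunctional_apply]
  refine integral_congr_ae ?_
  filter_upwards [ae_minkowski_mem_Ioo] with t ht
  rw [compOp_apply, branch_realPt n (Ioo_subset_Icc_self ht)]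

lemma ofReal_half_pow (n : ℕ) : (((1 / 2 : ℝ) ^ n : ℝ) : ℂ) = (1 / 2 : ℂ) ^ n := by
  push_cast
  rfl

/-- Self-similarity of `μ` read as duality: `μ` is a left eigenvector for the eigenvalue `1`. -/
lemma minkowskiFunctional_baseOp (f : Hinf) :
    minkowskiFunctional (baseOp f) = minkowskiFunctional f := by
  have h1 := hasSum_functional hasSum_baseOp f
  have h2 := hasSum_integral_minkowski (integrable_realPt f)
  refine h1.unique (h2.congr_fun fun n => ?_)
  rw [← minkowskiFunctional_compOp, Complex.real_smul, ofReal_half_pow]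
  exact minkowskiFunctional.map_smul _ _

lemma hasSum_half_pow_complex : HasSum (fun n : ℕ => (1 / 2 : ℂ) ^ (n + 1)) 1 := by
  have := Complex.hasSum_ofReal.2 hasSum_half_pow
  simpa only [ofReal_half_pow, Complex.ofReal_one] using this

lemma baseOp_one : baseOp Hinf.one = Hinf.one := by
  refine Hinf.ext_apply fun t => (hasSum_baseOp_apply Hinf.one t).unique ?_
  simpa only [Hinf.one_apply, mul_one] using hasSum_half_pow_complex

/-- The part of the disc that contains the images of the inverse branches. -/
def branchSet : Set ℂ := {t | 0 ≤ t.re ∧ ‖t - 2 / 3‖ ≤ 5 / 6}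

/-! ### Contraction of Lipschitz constants by the unperturbed operator -/

lemma convex_branchSet : Convex ℝ branchSet := by
  have h : branchSet = {t : ℂ | 0 ≤ Complex.reLm t} ∩ Metric.closedBall (2 / 3) (5 / 6) := by
    ext t
    simp [branchSet, dist_eq_norm]
  rw [h]
  exact (convex_halfSpace_ge Complex.reLm.isLinear 0).inter (convex_closedBall _ _)

/-- Inversion carries `Re w > 2/3` into the disc with diameter `[0, 3/2]`, and `5/6 = 3/2 - 2/3`.
The images therefore stay at distance `1/6` from the boundary of the domain. -/
lemma branch_mem_branchSet (n : ℕ) (t : gaussDisc) : (branch n t : ℂ) ∈ branchSet := by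
  have hre := two_thirds_lt_re t.2 n
  have hw0 := add_ne_zero_of_mem n t.2
  change 1 / ((n : ℂ) + 1 + t) ∈ branchSet
  set w : ℂ := (n : ℂ) + 1 + t with hw
  constructor
  · rw [one_div, Complex.inv_re]
    exact div_nonneg (by linarith) (Complex.normSq_nonneg _)
  · have e : 1 / w - 2 / 3 = (3 - 2 * w) / (3 * w) := by field_simp
    have h3w : 0 < ‖3 * w‖ := norm_pos_iff.2 (mul_ne_zero (by norm_num) hw0)
    rw [e, norm_div, div_le_iff₀ h3w]
    refine abs_le_of_sq_le_sq' ?_ (by positivity) |>.2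
    rw [mul_pow, Complex.sq_norm, Complex.sq_norm, Complex.normSq_apply, Complex.normSq_apply]
    have a1 : (3 - 2 * w).re = 3 - 2 * w.re := by simp
    have a2 : (3 - 2 * w).im = - (2 * w.im) := by simp
    have a3 : (3 * w).re = 3 * w.re := by simp
    have a4 : (3 * w).im = 3 * w.im := by simp
    rw [a1, a2, a3, a4]
    nlinarith [sq_nonneg w.im, sq_nonneg (w.re - 2 / 3)]

lemma realPt_mem_branchSet (x : ℝ) : (realPt x : ℂ) ∈ branchSet := by
  have h := (projIcc (0 : ℝ) 1 zero_le_one x).2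
  refine ⟨h.1, ?_⟩
  change ‖((projIcc (0 : ℝ) 1 zero_le_one x : ℝ) : ℂ) - 2 / 3‖ ≤ 5 / 6
  rw [show (((projIcc (0 : ℝ) 1 zero_le_one x : ℝ) : ℂ) - 2 / 3) =
        (((projIcc (0 : ℝ) 1 zero_le_one x : ℝ) - 2 / 3 : ℝ) : ℂ) by push_cast; rfl,
      Complex.norm_real, Real.norm_eq_abs, abs_le]
  constructor <;> linarith [h.1, h.2]

/-- The natural constant is `(n + 1)^{-2}`, because `Re ≥ 0` on `branchSet`. The majorant used here
is `1` for `n = 0`, at least `1/4` afterwards, and its mean for the weights `2^{-(n+1)}` is exactly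
`3/4`. -/
lemma norm_branch_sub_le (n : ℕ) {s t : gaussDisc} (hs : (s : ℂ) ∈ branchSet)
    (ht : (t : ℂ) ∈ branchSet) :
    ‖(branch n t : ℂ) - branch n s‖ ≤ (1 / 4 + 3 / 4 * (1 / 2) ^ n) * ‖(t : ℂ) - s‖ := by
  have hn : (0 : ℝ) ≤ n := n.cast_nonneg
  have low {t : gaussDisc} (ht : (t : ℂ) ∈ branchSet) : (n : ℝ) + 1 ≤ ‖(n : ℂ) + 1 + t‖ := by
    refine le_trans ?_ (Complex.re_le_norm _)
    simpa using ht.1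
  have e : (branch n t : ℂ) - branch n s =
      -((t : ℂ) - s) / (((n : ℂ) + 1 + t) * ((n : ℂ) + 1 + s)) := by
    change 1 / ((n : ℂ) + 1 + t) - 1 / ((n : ℂ) + 1 + s) = _
    have h1 := add_ne_zero_of_mem n t.2
    have h2 := add_ne_zero_of_mem n s.2
    field_simp
    ring
  rw [e, norm_div, norm_neg, norm_mul, mul_comm (1 / 4 + _), div_eq_mul_inv]
  refine mul_le_mul_of_nonneg_left ?_ (norm_nonneg _)
  have h1 : ((n : ℝ) + 1) * (n + 1) ≤ ‖(n : ℂ) + 1 + t‖ * ‖(n : ℂ) + 1 + s‖ :=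
    mul_le_mul (low ht) (low hs) (by linarith) (norm_nonneg _)
  refine (inv_anti₀ (by positivity) h1).trans ?_
  rcases Nat.eq_zero_or_pos n with rfl | hp
  · norm_num
  · have hp' : (1 : ℝ) ≤ n := by exact_mod_cast hp
    have h4 : (((n : ℝ) + 1) * (n + 1))⁻¹ ≤ 4⁻¹ := inv_anti₀ (by norm_num) (by nlinarith)
    have : (0 : ℝ) ≤ 3 / 4 * (1 / 2) ^ n := by positivity
    linarith

/-- `c` is a Lipschitz constant of `f` on the images of the inverse branches. -/
def IsBranchLipschitz (f : Hinf) (c : ℝ) : Prop :=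
  ∀ s t : gaussDisc, (s : ℂ) ∈ branchSet → (t : ℂ) ∈ branchSet →
    ‖f.1 t - f.1 s‖ ≤ c * ‖(t : ℂ) - s‖

/-- Cauchy's estimate on circles of radius `1/12`, which stay in the domain since `5/6 + 1/12 < 1`;
convexity of `branchSet` then allows the mean value inequality. -/
lemma isBranchLipschitz (f : Hinf) : IsBranchLipschitz f (12 * ‖f‖) := by
  obtain ⟨F, hF, hf⟩ := id f.2
  intro s t hs ht
  rw [hf, hf]
  refine convex_branchSet.norm_image_sub_le_of_norm_deriv_le (fun x hx => ?_) (fun x hx => ?_) hs ht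
  · refine hF.differentiableAt (Metric.isOpen_ball.mem_nhds ?_)
    rw [Metric.mem_ball, dist_eq_norm]
    linarith [hx.2]
  · have hsub : Metric.closedBall x (1 / 12) ⊆ gaussDisc := by
      intro y hy
      rw [Metric.mem_closedBall, dist_eq_norm] at hy
      rw [gaussDisc, Metric.mem_ball, dist_eq_norm]
      have := norm_add_le (y - x) (x - 2 / 3)
      rw [sub_add_sub_cancel] at this
      linarith [hx.2]
    have hd : DiffContOnCl ℂ F (Metric.ball x (1 / 12)) := by
      refine DifferentiableOn.diffContOnCl (hF.mono ?_)
      rw [closure_ball _ (by norm_num)]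
      exact hsub
    have h1 := Complex.norm_deriv_le_of_forall_mem_sphere_norm_le (C := ‖f‖)
      (by norm_num : (0 : ℝ) < 1 / 12) hd fun y hy => by
        have hy' := hsub (Metric.sphere_subset_closedBall hy)
        have := Hinf.norm_coe_apply_le f ⟨y, hy'⟩
        rwa [hf] at this
    refine h1.trans (le_of_eq ?_)
    ring

lemma IsBranchLipschitz.baseOp {f : Hinf} {c : ℝ} (hc : 0 ≤ c) (h : IsBranchLipschitz f c) :
    IsBranchLipschitz (baseOp f) (3 / 4 * c) := by
  intro s t hs ht
  have h1 := (hasSum_baseOp_apply f t).sub (hasSum_baseOp_apply f s)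
  have h2 : HasSum (fun n : ℕ => (1 / 2 : ℝ) ^ (n + 1) * (c * ((1 / 4 + 3 / 4 * (1 / 2) ^ n) *
      ‖(t : ℂ) - s‖))) (3 / 4 * c * ‖(t : ℂ) - s‖) := by
    have h3 := (hasSum_half_pow.mul_left (1 / 4)).add
      ((hasSum_geometric_of_lt_one (r := 1 / 4) (by norm_num) (by norm_num)).mul_left (3 / 8))
    have h4 := h3.mul_right (c * ‖(t : ℂ) - s‖)
    norm_num at h4
    rw [← mul_assoc] at h4
    refine h4.congr_fun fun n => ?_
    have e : (1 / 4 : ℝ) ^ n = (1 / 2) ^ n * (1 / 2) ^ n := by rw [← mul_pow]; norm_num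
    norm_num at e
    rw [e]
    ring
  rw [← h1.tsum_eq]
  refine tsum_of_norm_bounded h2 fun n => ?_
  rw [← mul_sub, norm_mul, norm_pow]
  norm_num only [norm_div, norm_one, Complex.norm_ofNat]
  refine mul_le_mul_of_nonneg_left ?_ (by positivity)
  exact (h _ _ (branch_mem_branchSet n s) (branch_mem_branchSet n t)).trans
    (mul_le_mul_of_nonneg_left (norm_branch_sub_le n hs ht) hc)

/-- The unperturbed operator without its leading spectral part. -/
def restOp : Hinf →L[ℂ] Hinf := baseOp - minkowskiFunctional.smulRight Hinf.one

lemma restOp_apply (f : Hinf) : restOp f = baseOp f - minkowskiFunctional f • Hinf.one := rfl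

lemma minkowskiFunctional_restOp (f : Hinf) : minkowskiFunctional (restOp f) = 0 := by
  rw [restOp_apply, map_sub, map_smul, minkowskiFunctional_baseOp, minkowskiFunctional_one,
    smul_eq_mul, mul_one, sub_self]

lemma restOp_one : restOp Hinf.one = 0 := by
  rw [restOp_apply, baseOp_one, minkowskiFunctional_one, one_smul, sub_self]

lemma IsBranchLipschitz.restOp {f : Hinf} {c : ℝ} (hc : 0 ≤ c) (h : IsBranchLipschitz f c) :
    IsBranchLipschitz (restOp f) (3 / 4 * c) := by
  intro s t hs ht
  have e : (_root_.restOp f).1 t - (_root_.restOp f).1 s =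
      (_root_.baseOp f).1 t - (_root_.baseOp f).1 s := by
    rw [restOp_apply]
    simp only [Hinf.sub_apply, Hinf.smul_apply, Hinf.one_apply]
    ring
  rw [e]
  exact h.baseOp hc s t hs ht

lemma isBranchLipschitz_restOp_pow (k : ℕ) (f : Hinf) :
    IsBranchLipschitz ((restOp ^ k) f) ((3 / 4) ^ k * (12 * ‖f‖)) := by
  induction k with
  | zero =>
    rw [pow_zero, pow_zero, one_mul, one_apply_eq_self]
    exact isBranchLipschitz f
  | succ k ih =>
    rw [pow_succ', pow_succ', mul_apply_eq_comp, mul_assoc]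
    exact ih.restOp (by positivity)

/-- A function of mean zero is bounded by its oscillation: `f(t)` is the `μ`-average of `f(t) -
f(x)`, and `branchSet` has diameter at most `2`. -/
lemma norm_apply_le_of_isBranchLipschitz {f : Hinf} {c : ℝ} (hc : 0 ≤ c)
    (h : IsBranchLipschitz f c) (h0 : minkowskiFunctional f = 0) {t : gaussDisc}
    (ht : (t : ℂ) ∈ branchSet) : ‖f.1 t‖ ≤ 2 * c := by
  have e : f.1 t = ∫ x, (f.1 t - f.1 (realPt x)) ∂minkowskiMeasure := by
    rw [integral_sub (integrable_const _) (integrable_realPt f), ← minkowskiFunctional_apply, h0]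
    simp
  have h1 := norm_integral_le_of_norm_le_const (μ := minkowskiMeasure) (C := 2 * c)
    (f := fun x => f.1 t - f.1 (realPt x)) (ae_of_all _ fun x => by
      refine (h _ _ (realPt_mem_branchSet x) ht).trans ?_
      rw [mul_comm 2 c]
      refine mul_le_mul_of_nonneg_left ?_ hc
      have h2 := norm_sub_le ((t : ℂ) - 2 / 3) ((realPt x : ℂ) - 2 / 3)
      rw [sub_sub_sub_cancel_right] at h2
      linarith [ht.2, (realPt_mem_branchSet x).2])
  rw [← e, probReal_univ, mul_one] at h1
  exact h1

lemma norm_baseOp_apply_le {f : Hinf} {C : ℝ}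
    (h : ∀ t : gaussDisc, (t : ℂ) ∈ branchSet → ‖f.1 t‖ ≤ C) (t : gaussDisc) :
    ‖(baseOp f).1 t‖ ≤ C := by
  rw [← (hasSum_baseOp_apply f t).tsum_eq]
  have h2 := hasSum_half_pow.mul_right C
  rw [one_mul] at h2
  refine tsum_of_norm_bounded h2 fun n => ?_
  rw [norm_mul, norm_pow]
  norm_num only [norm_div, norm_one, Complex.norm_ofNat]
  exact mul_le_mul_of_nonneg_left (h _ (branch_mem_branchSet n t)) (by positivity)

/-- The first `k + 1` factors shrink the Lipschitz constant `12 ‖f‖` and produce mean zero, which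
bounds the function on `branchSet`. The last factor extends the bound to the whole disc, as `baseOp`
only evaluates its argument at images of branches. -/
lemma norm_restOp_pow_le (k : ℕ) : ‖restOp ^ (k + 2)‖ ≤ 24 * (3 / 4) ^ (k + 1) := by
  refine ContinuousLinearMap.opNorm_le_bound _ (by positivity) fun f => ?_
  refine Hinf.norm_le_of_forall (by positivity) fun t => ?_
  have h0 : minkowskiFunctional ((restOp ^ (k + 1)) f) = 0 := by
    rw [pow_succ', mul_apply_eq_comp]
    exact minkowskiFunctional_restOp _
  rw [pow_succ', mul_apply_eq_comp, restOp_apply, h0, zero_smul, sub_zero]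
  refine norm_baseOp_apply_le (fun s hs => ?_) t
  refine (norm_apply_le_of_isBranchLipschitz (by positivity)
    (isBranchLipschitz_restOp_pow (k + 1) f) h0 hs).trans (le_of_eq ?_)
  ring

lemma isUnit_one_sub_of_isUnit_one_sub_pow {R : Type*} [Ring R] {a : R} {k : ℕ}
    (h : IsUnit (1 - a ^ k)) : IsUnit (1 - a) := by
  obtain ⟨u, hu⟩ := h
  have h1 : (1 - a) * ∑ i ∈ Finset.range k, a ^ i = 1 - a ^ k := mul_neg_geom_sum a k
  have h2 : (∑ i ∈ Finset.range k, a ^ i) * (1 - a) = 1 - a ^ k := geom_sum_mul_neg a k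
  have hl : IsUnit ((1 - a) * ∑ i ∈ Finset.range k, a ^ i) := by rw [h1, ← hu]; exact u.isUnit
  have hc : Commute (1 - a) (∑ i ∈ Finset.range k, a ^ i) := h1.trans h2.symm
  exact (hc.isUnit_mul_iff.1 hl).1

/-- The radius `7/6` exceeds `1` while `(7/6)(3/4) = 7/8 < 1`, so a high power of `w • restOp` has
norm less than `1`. -/
lemma isUnit_one_sub_smul_restOp {w : ℂ} (hw : ‖w‖ ≤ 7 / 6) : IsUnit (1 - w • restOp) := by
  obtain ⟨k, hk⟩ := exists_pow_lt_of_lt_one (by norm_num : (0 : ℝ) < 1 / 30)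
    (by norm_num : (7 / 8 : ℝ) < 1)
  have h1 : ‖(w • restOp) ^ (k + 2)‖ < 1 := by
    rw [smul_pow, norm_smul, norm_pow]
    have h2 := norm_restOp_pow_le k
    have h3 : ‖w‖ ^ (k + 2) ≤ (7 / 6) ^ (k + 2) := pow_le_pow_left₀ (norm_nonneg w) hw _
    calc ‖w‖ ^ (k + 2) * ‖restOp ^ (k + 2)‖ ≤ (7 / 6) ^ (k + 2) * (24 * (3 / 4) ^ (k + 1)) := by
          gcongr
      _ = (49 / 2) * (((7 / 6) * (3 / 4)) ^ k) := by rw [mul_pow]; ring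
      _ < 1 := by
        norm_num only
        norm_num only at hk
        linarith
  exact isUnit_one_sub_of_isUnit_one_sub_pow (isUnit_one_sub_of_norm_lt_one h1)

/-- The fixed functions of the unperturbed operator are the constants. -/
lemma eq_smul_one_of_baseOp_eq {f : Hinf} (h : baseOp f = f) :
    f = minkowskiFunctional f • Hinf.one := by
  set g := f - minkowskiFunctional f • Hinf.one with hg
  have h1 : restOp g = g := by
    rw [hg, map_sub, map_smul, restOp_one, smul_zero, sub_zero, restOp_apply, h]
  have hu := isUnit_one_sub_smul_restOp (w := 1) (by norm_num)
  rw [one_smul] at hu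
  have h2 := inverse_apply_cancel hu g
  rw [_root_.sub_apply, one_apply_eq_self, h1, sub_self, map_zero] at h2
  exact sub_eq_zero.1 h2.symm

end

noncomputable section

/-! ### Analytic dependence of the operators on the parameters -/

section Series

variable {𝔸 : Type*} [NormedRing 𝔸] [NormedAlgebra ℂ 𝔸] [CompleteSpace 𝔸]

lemma norm_le_of_norm_sub_half_le {z : ℂ} (hz : ‖z - 1 / 2‖ ≤ 1 / 10) : ‖z‖ ≤ 3 / 5 := by
  have h := norm_add_le (z - 1 / 2) (1 / 2)
  rw [sub_add_cancel] at h
  have h2 : ‖(1 / 2 : ℂ)‖ = 1 / 2 := by norm_num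
  linarith

/-- Joint class `C¹` over `ℂ` suffices: it feeds the implicit function theorem, and a complex
function of one variable differentiable near a point is analytic there. -/
lemma contDiffAt_tsum_pow_smul {T : ℕ → ℂ → 𝔸} {G : ℕ → 𝔸} {b : ℕ → ℝ}
    (hT : ∀ n τ, HasDerivAt (T n) (G n * T n τ) τ) (hG : ∀ n : ℕ, ‖G n‖ ≤ n + 7)
    (hb : Summable b)
    (hbd : ∀ (n : ℕ) (τ : ℂ) (r : ℝ), ‖τ‖ ≤ 1 / 10 → 0 ≤ r → r ≤ 3 / 5 →
      ((n : ℝ) + 7) * (r ^ n * ‖T n τ‖) ≤ b n) :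
    ContDiffAt ℂ 1 (fun p : ℂ × ℂ => ∑' n : ℕ, p.2 ^ (n + 1) • T n p.1) (0, 1 / 2) := by
  set U : Set (ℂ × ℂ) := Metric.ball (0, 1 / 2) (1 / 10) with hU
  have hmem {p : ℂ × ℂ} (hp : p ∈ U) : ‖p.1‖ ≤ 1 / 10 ∧ ‖p.2‖ ≤ 3 / 5 := by
    rw [hU, Metric.mem_ball, Prod.dist_eq, max_lt_iff, dist_zero_right, dist_eq_norm] at hp
    exact ⟨hp.1.le, norm_le_of_norm_sub_half_le hp.2.le⟩
  let f' : ℕ → ℂ × ℂ → (ℂ × ℂ →L[ℂ] 𝔸) := fun n p =>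
    (ContinuousLinearMap.snd ℂ ℂ ℂ).smulRight ((((n : ℂ) + 1) * p.2 ^ n) • T n p.1) +
      (ContinuousLinearMap.fst ℂ ℂ ℂ).smulRight (p.2 ^ (n + 1) • (G n * T n p.1))
  have hf (n : ℕ) (p : ℂ × ℂ) : HasFDerivAt (fun p : ℂ × ℂ => p.2 ^ (n + 1) • T n p.1) (f' n p) p := by
    have h1 : HasFDerivAt (fun p : ℂ × ℂ => T n p.1)
        ((ContinuousLinearMap.fst ℂ ℂ ℂ).smulRight (G n * T n p.1)) p := by
      have := (hT n p.1).hasFDerivAt.comp p (hasFDerivAt_fst (𝕜 := ℂ) (p := p))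
      refine this.congr_fderiv ?_
      ext <;> simp
    have h2 : HasFDerivAt (fun p : ℂ × ℂ => p.2 ^ (n + 1))
        ((ContinuousLinearMap.snd ℂ ℂ ℂ).smulRight (((n : ℂ) + 1) * p.2 ^ n)) p := by
      have := (hasDerivAt_pow (n + 1) p.2).hasFDerivAt.comp p (hasFDerivAt_snd (𝕜 := ℂ) (p := p))
      refine this.congr_fderiv ?_
      ext <;> simp
    refine (h2.smul h1).congr_fderiv ?_
    ext <;> simp [f']
  have hcT (n : ℕ) : Continuous (T n) :=
    continuous_iff_continuousAt.2 fun τ => (hT n τ).continuousAt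
  have hf' (n : ℕ) (p : ℂ × ℂ) (hp : p ∈ U) : ‖f' n p‖ ≤ 2 * b n := by
    obtain ⟨h1, h2⟩ := hmem hp
    have hn : (0 : ℝ) ≤ n := n.cast_nonneg
    have h3 := hbd n p.1 ‖p.2‖ h1 (norm_nonneg _) h2
    have h4 : ‖((n : ℂ) + 1)‖ = (n : ℝ) + 1 := by
      rw [← Nat.cast_succ, Complex.norm_natCast, Nat.cast_succ]
    refine (norm_add_le _ _).trans ?_
    rw [ContinuousLinearMap.norm_smulRight_apply, ContinuousLinearMap.norm_smulRight_apply,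
      norm_smul, norm_smul, norm_mul, norm_pow, norm_pow, h4, two_mul]
    refine add_le_add ?_ ?_
    · refine le_trans ?_ h3
      refine (mul_le_of_le_one_left (by positivity) (ContinuousLinearMap.norm_snd_le ℂ ℂ ℂ)).trans ?_
      rw [mul_assoc]
      exact mul_le_mul_of_nonneg_right (by linarith) (by positivity)
    · refine le_trans ?_ h3
      refine (mul_le_of_le_one_left (by positivity) (ContinuousLinearMap.norm_fst_le ℂ ℂ ℂ)).trans ?_
      calc ‖p.2‖ ^ (n + 1) * ‖G n * T n p.1‖ ≤ (‖p.2‖ ^ n * 1) * ((n + 7) * ‖T n p.1‖) := by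
            rw [pow_succ]
            have := hG n
            gcongr
            · linarith
            · exact (norm_mul_le _ _).trans (by gcongr)
        _ = _ := by ring
  have hs0 : Summable fun n : ℕ => (((0 : ℂ), (1 / 2 : ℂ)) : ℂ × ℂ).2 ^ (n + 1) •
      T n (((0 : ℂ), (1 / 2 : ℂ)) : ℂ × ℂ).1 := by
    refine Summable.of_norm_bounded hb fun n => ?_
    have h3 := hbd n 0 (1 / 2) (by norm_num) (by norm_num) (by norm_num)
    refine le_trans ?_ h3
    have hn : (0 : ℝ) ≤ n := n.cast_nonneg
    rw [norm_smul, norm_pow, pow_succ, mul_assoc, mul_left_comm]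
    norm_num only [norm_div, norm_one, Complex.norm_ofNat]
    exact mul_le_mul_of_nonneg_right (by linarith) (by positivity)
  have hmem0 : (((0 : ℂ), (1 / 2 : ℂ)) : ℂ × ℂ) ∈ U := Metric.mem_ball_self (by norm_num)
  rw [contDiffAt_one_iff]
  refine ⟨fun p => ∑' n, f' n p, U, Metric.isOpen_ball.mem_nhds hmem0, ?_, fun p hp => ?_⟩
  · refine continuousOn_tsum (fun n => Continuous.continuousOn ?_) (hb.mul_left 2) hf'
    refine Continuous.add ?_ ?_
    · exact (ContinuousLinearMap.smulRightL ℂ (ℂ × ℂ) 𝔸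
        (ContinuousLinearMap.snd ℂ ℂ ℂ)).continuous.comp
        (by have := hcT n; fun_prop : Continuous fun p : ℂ × ℂ => (((n : ℂ) + 1) * p.2 ^ n) • T n p.1)
    · exact (ContinuousLinearMap.smulRightL ℂ (ℂ × ℂ) 𝔸
        (ContinuousLinearMap.fst ℂ ℂ ℂ)).continuous.comp
        (by have := hcT n; fun_prop : Continuous fun p : ℂ × ℂ => p.2 ^ (n + 1) • (G n * T n p.1))
  · exact hasFDerivAt_tsum_of_isPreconnected (hb.mul_left 2) Metric.isOpen_ball
      (convex_ball _ _).isPreconnected (fun n p _ => hf n p) hf' hmem0 hs0 hp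

/-- Two termwise derivatives of the series `∑ e^{(n + 1) q(τ)} T_n(τ)` with `T_n' = G_n T_n`. -/
lemma tsum_exp_smul_derivs {T : ℕ → ℂ → 𝔸} {G : ℕ → 𝔸} {b : ℕ → ℝ}
    (hT : ∀ n τ, HasDerivAt (T n) (G n * T n τ) τ) (hb : Summable b)
    (hbd : ∀ (n : ℕ) (τ : ℂ) (r : ℝ), ‖τ‖ ≤ 1 / 10 → 0 ≤ r → r ≤ 3 / 5 →
      ((n : ℝ) + 7) * (r ^ n * ‖T n τ‖) ≤ b n)
    {q : ℂ → ℂ} (hq : AnalyticAt ℂ q 0) (hq0 : Complex.exp (q 0) = 1 / 2) :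
    let g : ℕ → ℂ → 𝔸 := fun n τ => Complex.exp (((n : ℂ) + 1) * q τ) • T n τ
    let d : ℕ → 𝔸 := fun n => (((n : ℂ) + 1) * deriv q 0) • g n 0 + G n * g n 0
    (∀ᶠ τ in 𝓝 0, DifferentiableAt ℂ (fun τ => ∑' n, g n τ) τ) ∧
    HasSum d (deriv (fun τ => ∑' n, g n τ) 0) ∧
    HasSum (fun n : ℕ => (((n : ℂ) + 1) * deriv (deriv q) 0) • g n 0 +
      ((((n : ℂ) + 1) * deriv q 0) • d n + G n * d n))
      (deriv (deriv (fun τ => ∑' n, g n τ)) 0) := by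
  intro g d
  have hev : ∀ᶠ τ in 𝓝 (0 : ℂ), AnalyticAt ℂ q τ ∧ ‖Complex.exp (q τ)‖ < 3 / 5 ∧ ‖τ‖ < 1 / 10 := by
    refine hq.eventually_analyticAt.and (Filter.Eventually.and ?_ ?_)
    · have h1 : ContinuousAt (fun τ => ‖Complex.exp (q τ)‖) 0 := hq.continuousAt.cexp.norm
      refine h1.eventually (gt_mem_nhds ?_)
      change ‖Complex.exp (q 0)‖ < 3 / 5
      rw [hq0]
      norm_num
    · exact (continuous_norm.continuousAt (x := (0 : ℂ))).eventually (gt_mem_nhds (by norm_num))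
  obtain ⟨ε, hε, hεU⟩ := Metric.eventually_nhds_iff_ball.1 hev
  have hg (n : ℕ) (τ : ℂ) (hτ : τ ∈ Metric.ball (0 : ℂ) ε) :
      HasDerivAt (g n) ((((n : ℂ) + 1) * deriv q τ) • g n τ + G n * g n τ) τ := by
    have h1 : HasDerivAt q (deriv q τ) τ := (hεU τ hτ).1.differentiableAt.hasDerivAt
    have h2 := ((h1.const_mul ((n : ℂ) + 1)).cexp).smul (hT n τ)
    refine h2.congr_deriv ?_
    simp only [g, mul_smul_comm, smul_smul]
    rw [add_comm, mul_comm (Complex.exp _)]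
  have hgd (n : ℕ) : DifferentiableOn ℂ (g n) (Metric.ball 0 ε) := fun τ hτ =>
    (hg n τ hτ).differentiableAt.differentiableWithinAt
  have hgb (n : ℕ) (τ : ℂ) (hτ : τ ∈ Metric.ball (0 : ℂ) ε) : ‖g n τ‖ ≤ b n := by
    obtain ⟨-, h1, h2⟩ := hεU τ hτ
    refine le_trans ?_ (hbd n τ ‖Complex.exp (q τ)‖ h2.le (norm_nonneg _) h1.le)
    have e : Complex.exp (((n : ℂ) + 1) * q τ) = Complex.exp (q τ) ^ (n + 1) := by
      rw [← Complex.exp_nat_mul]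
      push_cast
      rfl
    have hn : (0 : ℝ) ≤ n := n.cast_nonneg
    rw [norm_smul, e, norm_pow, pow_succ, mul_assoc, mul_left_comm]
    exact mul_le_mul_of_nonneg_right (by linarith) (by positivity)
  have hsum (τ : ℂ) (hτ : τ ∈ Metric.ball (0 : ℂ) ε) :
      HasSum (fun n => deriv (g n) τ) (deriv (fun τ => ∑' n, g n τ) τ) :=
    Complex.hasSum_deriv_of_summable_norm hb hgd Metric.isOpen_ball hgb hτ
  have h0 : (0 : ℂ) ∈ Metric.ball (0 : ℂ) ε := Metric.mem_ball_self hε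
  refine ⟨?_, ?_, ?_⟩
  · filter_upwards [Metric.ball_mem_nhds (0 : ℂ) hε] with τ hτ
    exact (Complex.differentiableOn_tsum_of_summable_norm hb hgd Metric.isOpen_ball
      hgb).differentiableAt (Metric.isOpen_ball.mem_nhds hτ)
  · exact (hsum 0 h0).congr_fun fun n => (hg n 0 h0).deriv.symm
  · have hε2 : 0 < ε / 2 := by positivity
    have hsub : Metric.ball (0 : ℂ) (ε / 2) ⊆ Metric.ball 0 ε :=
      Metric.ball_subset_ball (by linarith)
    -- Cauchy's estimate on circles of radius `ε/4` inside the larger ball makes the series of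
    -- derivatives normally convergent, so it can be differentiated again.
    have hb' (n : ℕ) (τ : ℂ) (hτ : τ ∈ Metric.ball (0 : ℂ) (ε / 2)) :
        ‖deriv (g n) τ‖ ≤ b n / (ε / 4) := by
      have hs : Metric.closedBall τ (ε / 4) ⊆ Metric.ball 0 ε := by
        intro y hy
        have := dist_triangle y τ 0
        rw [Metric.mem_closedBall] at hy
        rw [Metric.mem_ball] at hτ ⊢
        linarith
      refine Complex.norm_deriv_le_of_forall_mem_sphere_norm_le (by positivity) ?_
        fun y hy => hgb n y (hs (Metric.sphere_subset_closedBall hy))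
      refine DifferentiableOn.diffContOnCl ((hgd n).mono ?_)
      rwa [closure_ball _ (by positivity)]
    have h2 := Complex.hasSum_deriv_of_summable_norm (hb.div_const (ε / 4))
      (fun n => ((hgd n).deriv Metric.isOpen_ball).mono hsub) Metric.isOpen_ball hb'
      (Metric.mem_ball_self hε2)
    have e2 : (fun w => ∑' n, deriv (g n) w) =ᶠ[𝓝 0] deriv (fun τ => ∑' n, g n τ) := by
      filter_upwards [Metric.ball_mem_nhds (0 : ℂ) hε] with τ hτ
      exact (hsum τ hτ).tsum_eq
    rw [e2.deriv_eq] at h2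
    refine h2.congr_fun fun n => ?_
    have e3 : deriv (g n) =ᶠ[𝓝 0] fun τ => (((n : ℂ) + 1) * deriv q τ) • g n τ + G n * g n τ := by
      filter_upwards [Metric.ball_mem_nhds (0 : ℂ) hε] with τ hτ
      exact (hg n τ hτ).deriv
    rw [e3.deriv_eq]
    have h4 : HasDerivAt (deriv q) (deriv (deriv q) 0) 0 :=
      hq.deriv.differentiableAt.hasDerivAt
    have h5 := ((h4.const_mul ((n : ℂ) + 1)).smul (hg n 0 h0)).add ((hg n 0 h0).const_mul (G n))
    refine Eq.trans ?_ h5.deriv.symm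
    simp only [d]
    abel

end Series

section SecondOrder

variable {E : Type*} [NormedAddCommGroup E] [NormedSpace ℂ E] [CompleteSpace E]

/-- The first two derivatives of the eigenvalue equation `A(τ) u(τ) = u(τ)`, seen through a left
eigenvector of `A(0)`. -/
lemma eigenvector_derivs {A : ℂ → E →L[ℂ] E} {u : ℂ → E} {φ : E →L[ℂ] ℂ}
    (hφ : ∀ v, φ (A 0 v) = φ v)
    (hA : ∀ᶠ τ in 𝓝 0, DifferentiableAt ℂ A τ) (hu : ∀ᶠ τ in 𝓝 0, DifferentiableAt ℂ u τ)
    (hAu : ∀ᶠ τ in 𝓝 0, A τ (u τ) = u τ) :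
    φ (deriv A 0 (u 0)) = 0 ∧ deriv A 0 (u 0) + A 0 (deriv u 0) = deriv u 0 ∧
      φ (deriv (deriv A) 0 (u 0)) + 2 * φ (deriv A 0 (deriv u 0)) = 0 := by
  have hA2 : HasDerivAt (deriv A) (deriv (deriv A) 0) 0 :=
    (Complex.analyticAt_iff_eventually_differentiableAt.2 hA).deriv.differentiableAt.hasDerivAt
  have hu2 : HasDerivAt (deriv u) (deriv (deriv u) 0) 0 :=
    (Complex.analyticAt_iff_eventually_differentiableAt.2 hu).deriv.differentiableAt.hasDerivAt
  have hA1 := hA.self_of_nhds.hasDerivAt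
  have hu1 := hu.self_of_nhds.hasDerivAt
  have h1 : deriv A 0 (u 0) + A 0 (deriv u 0) = deriv u 0 :=
    ((hA1.clm_apply hu1).congr_of_eventuallyEq (hAu.mono fun _ h => h.symm)).unique hu1
  refine ⟨?_, h1, ?_⟩
  · have := congrArg φ h1
    rw [map_add, hφ] at this
    linear_combination this
  -- Subtracting `A 0`, which `φ` does not see, removes `u''` from the second derivative at `0`.
  · have hD : (fun τ => φ ((A τ - A 0) (u τ))) =ᶠ[𝓝 0] fun _ => 0 := by
      filter_upwards [hAu] with τ hτ
      rw [sub_apply, hτ, map_sub, hφ, sub_self]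
    have hD' : (fun τ => φ (deriv A τ (u τ) + (A τ - A 0) (deriv u τ))) =ᶠ[𝓝 0] fun _ => 0 := by
      filter_upwards [hD.eventuallyEq_nhds, hA, hu] with τ hτ hAτ huτ
      have h2 := (hAτ.hasDerivAt.sub_const (A 0)).clm_apply huτ.hasDerivAt
      have h3 := (φ.hasFDerivAt.comp_hasDerivAt τ h2).congr_of_eventuallyEq hτ.symm
      exact h3.unique (hasDerivAt_const τ 0)
    have h4 := φ.hasFDerivAt.comp_hasDerivAt (0 : ℂ)
      ((hA2.clm_apply hu1).add ((hA1.sub_const (A 0)).clm_apply hu2))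
    have h5 := (h4.congr_of_eventuallyEq hD'.symm).unique (hasDerivAt_const 0 0)
    simp only [sub_self, zero_apply, add_zero, map_add] at h5
    linear_combination h5

end SecondOrder

end

noncomputable section

/-! ### The dominant eigenvalue near `(0, 1/2)` -/

lemma mul_pow_mul_norm_termOp_le (n : ℕ) (τ : ℂ) (r : ℝ) (hτ : ‖τ‖ ≤ 1 / 10) (h0 : 0 ≤ r)
    (hr : r ≤ 3 / 5) : ((n : ℝ) + 7) * (r ^ n * ‖termOp n τ‖) ≤ termBound n :=
  pow_mul_norm_termOp_le n hτ h0 hr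

lemma contDiffAt_transferOp :
    ContDiffAt ℂ 1 (fun p : ℂ × ℂ => transferOp p.1 p.2) (0, 1 / 2) := by
  have h := contDiffAt_tsum_pow_smul (T := termOp) (G := genOp) hasDerivAt_termOp norm_genOp_le
    summable_termBound mul_pow_mul_norm_termOp_le
  refine h.congr_of_eventuallyEq ?_
  filter_upwards [Metric.ball_mem_nhds (((0 : ℂ), (1 / 2 : ℂ)) : ℂ × ℂ)
    (by norm_num : (0 : ℝ) < 1 / 10)] with p hp
  rw [Metric.mem_ball, Prod.dist_eq, max_lt_iff, dist_zero_right, dist_eq_norm] at hp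
  exact (hasSum_transferOp hp.1.le (norm_le_of_norm_sub_half_le hp.2.le)).tsum_eq.symm

/-- The transfer operator without the leading spectral part of the unperturbed operator. -/
def restOpAt (τ z : ℂ) : Hinf →L[ℂ] Hinf :=
  transferOp τ z - minkowskiFunctional.smulRight Hinf.one

lemma restOpAt_add (τ z : ℂ) :
    restOpAt τ z + minkowskiFunctional.smulRight Hinf.one = transferOp τ z := sub_add_cancel _ _

lemma contDiffAt_restOpAt :
    ContDiffAt ℂ 1 (fun p : ℂ × ℂ => restOpAt p.1 p.2) (0, 1 / 2) :=
  contDiffAt_transferOp.sub contDiffAt_const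

lemma restOpAt_zero_half : restOpAt 0 (1 / 2) = restOp := rfl

lemma exists_goodPerturbation : ∃ (M δ : ℝ), 0 < δ ∧ δ ≤ 1 / 10 ∧ ∀ τ z : ℂ, ‖τ‖ ≤ δ →
    ‖z - 1 / 2‖ ≤ δ → GoodPerturbation minkowskiFunctional Hinf.one (restOpAt τ z) (7 / 6) M := by
  obtain ⟨M, hM⟩ := eventually_goodPerturbation (φ := minkowskiFunctional) (e := Hinf.one)
    (by norm_num : (1 : ℝ) < 7 / 6) minkowskiFunctional_one restOp_one
    (fun w hw => isUnit_one_sub_smul_restOp hw)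
  rw [← restOpAt_zero_half] at hM
  have h1 := contDiffAt_restOpAt.continuousAt.eventually hM
  obtain ⟨ε, hε, h2⟩ := Metric.eventually_nhds_iff_ball.1 h1
  refine ⟨M, min (ε / 2) (1 / 10), by positivity, min_le_right _ _, fun τ z hτ hz => ?_⟩
  refine h2 (τ, z) ?_
  rw [Metric.mem_ball, Prod.dist_eq, max_lt_iff, dist_zero_right, dist_eq_norm]
  have := min_le_left (ε / 2) (1 / 10)
  exact ⟨by linarith, by linarith⟩

/-- The function whose value is `1` exactly when the dominant eigenvalue is `1`. -/
def resolventFun (p : ℂ × ℂ) : ℂ :=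
  minkowskiFunctional (Ring.inverse (1 - restOpAt p.1 p.2) Hinf.one)

lemma contDiffAt_resolventFun : ContDiffAt ℂ 1 resolventFun (0, 1 / 2) := by
  obtain ⟨u, hu⟩ := isUnit_one_sub_smul_restOp (w := 1) (by norm_num)
  rw [one_smul] at hu
  have h1 := contDiffAt_ringInverse (n := 1) ℂ u
  rw [hu, ← restOpAt_zero_half] at h1
  have h2 : ContDiffAt ℂ 1 (fun p : ℂ × ℂ => 1 - restOpAt p.1 p.2) (0, 1 / 2) :=
    contDiffAt_const.sub contDiffAt_restOpAt
  have h3 := ContDiffAt.comp (0, 1 / 2) (f := fun p : ℂ × ℂ => 1 - restOpAt p.1 p.2) h1 h2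
  exact (minkowskiFunctional.comp
    (ContinuousLinearMap.apply ℂ Hinf Hinf.one)).contDiff.contDiffAt.comp (0, 1 / 2) h3

lemma dominantEigenvalue_spec {τ z : ℂ} (h : ∃ l, IsSimpleDominantEigenvalue (transferOp τ z) l) :
    IsSimpleDominantEigenvalue (transferOp τ z) (dominantEigenvalue τ z) := by
  rw [dominantEigenvalue, dif_pos h]
  exact h.choose_spec

section

variable {τ z : ℂ} {s M : ℝ}

lemma GoodPerturbation.dominantEigenvalue_spec
    (h : GoodPerturbation minkowskiFunctional Hinf.one (restOpAt τ z) s M) :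
    IsSimpleDominantEigenvalue (transferOp τ z) (dominantEigenvalue τ z) := by
  have h1 := h.exists_isSimpleDominantEigenvalue
  rw [restOpAt_add] at h1
  exact _root_.dominantEigenvalue_spec h1

lemma GoodPerturbation.dominantEigenvalue_eq_one_iff
    (h : GoodPerturbation minkowskiFunctional Hinf.one (restOpAt τ z) s M) :
    dominantEigenvalue τ z = 1 ↔ resolventFun (τ, z) = 1 := by
  have h1 := h.isSimpleDominantEigenvalue_one_iff
  rw [restOpAt_add] at h1
  refine Iff.trans ⟨fun h2 => ?_, fun h2 => h.dominantEigenvalue_spec.unique h2⟩ h1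
  rw [← h2]
  exact h.dominantEigenvalue_spec

end

/-! ### The case `τ = 0` and the implicit function theorem -/

lemma transferOp_zero_one {z : ℂ} (hz : ‖z‖ ≤ 3 / 5) :
    transferOp 0 z Hinf.one = (z / (1 - z)) • Hinf.one := by
  refine Hinf.ext_apply fun t => ?_
  have h1 := hasSum_apply (hasSum_transferOp (τ := 0) (by norm_num) hz) Hinf.one t
  refine h1.unique ?_
  have h2 := (hasSum_geometric_of_norm_lt_one (show ‖z‖ < 1 by linarith)).mul_left z
  rw [← div_eq_mul_inv] at h2
  rw [Hinf.smul_apply, Hinf.one_apply, mul_one]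
  refine h2.congr_fun fun n => ?_
  rw [termOp_zero]
  change z ^ (n + 1) * 1 = z * z ^ n
  ring

/-- For `τ = 0` the constant function is an eigenvector of `restOpAt`, with eigenvalue `z/(1 - z) -
1`, so its resolvent is explicit there. The product form avoids dividing by `2 - 3z`. -/
lemma mul_resolventFun_zero {z : ℂ} {s M : ℝ} (hz : ‖z‖ ≤ 3 / 5)
    (h : GoodPerturbation minkowskiFunctional Hinf.one (restOpAt 0 z) s M) :
    (2 - 3 * z) * resolventFun (0, z) = 1 - z := by
  have hz1 : 1 - z ≠ 0 := by
    intro h0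
    have : z = 1 := by linear_combination -h0
    rw [this, norm_one] at hz
    norm_num at hz
  have e : (1 - restOpAt 0 z) Hinf.one = ((2 - 3 * z) / (1 - z)) • Hinf.one := by
    rw [sub_apply, one_apply_eq_self, restOpAt, sub_apply, transferOp_zero_one hz,
      ContinuousLinearMap.smulRight_apply, minkowskiFunctional_one]
    match_scalars
    field_simp
    ring
  have h2 := congrArg minkowskiFunctional (inverse_apply_cancel h.isUnit_one_sub Hinf.one)
  rw [e, map_smul, map_smul, minkowskiFunctional_one, smul_eq_mul] at h2
  change (2 - 3 * z) / (1 - z) * resolventFun (0, z) = 1 at h2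
  field_simp at h2
  exact h2

lemma resolventFun_zero_half : resolventFun (0, 1 / 2) = 1 := by
  obtain ⟨M, δ, hδ, -, h⟩ := exists_goodPerturbation
  have := mul_resolventFun_zero (by norm_num) (h 0 (1 / 2) (by simpa using hδ.le) (by simpa using hδ.le))
  linear_combination 2 * this

lemma hasDerivAt_resolventFun_zero : HasDerivAt (fun z => resolventFun (0, z)) 4 (1 / 2) := by
  obtain ⟨M, δ, hδ, hδ', h⟩ := exists_goodPerturbation
  have h1 : HasDerivAt (fun z : ℂ => (1 - z) / (2 - 3 * z)) 4 (1 / 2) := by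
    have := ((hasDerivAt_id (1 / 2 : ℂ)).const_sub 1).div
      (((hasDerivAt_id (1 / 2 : ℂ)).const_mul 3).const_sub 2) (by norm_num)
    refine this.congr_deriv ?_
    norm_num
  refine h1.congr_of_eventuallyEq ?_
  have hne : ∀ᶠ z : ℂ in 𝓝 (1 / 2), 2 - 3 * z ≠ 0 :=
    (by fun_prop : ContinuousAt (fun z : ℂ => 2 - 3 * z) (1 / 2)).eventually_ne (by norm_num)
  filter_upwards [Metric.ball_mem_nhds (1 / 2 : ℂ) hδ, hne] with z hz hz2
  rw [Metric.mem_ball, dist_eq_norm] at hz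
  rw [eq_div_iff hz2, mul_comm]
  exact mul_resolventFun_zero (norm_le_of_norm_sub_half_le (hz.le.trans hδ'))
    (h 0 z (by simpa using hδ.le) hz.le)

lemma exists_isAnalyticSolution {M δ₀ : ℝ} (h : ∀ τ z : ℂ, ‖τ‖ ≤ δ₀ → ‖z - 1 / 2‖ ≤ δ₀ →
      GoodPerturbation minkowskiFunctional Hinf.one (restOpAt τ z) (7 / 6) M)
    {δ : ℝ} (hδ : 0 < δ) (hδ₀ : δ ≤ δ₀) : ∃ (η : ℝ) (ρ : ℂ → ℂ), IsAnalyticSolution δ η ρ := by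
  -- The partial derivative in `z` is multiplication by `4`, known from the explicit formula at `τ =
  -- 0`.
  have hinv : (fderiv ℂ resolventFun (0, 1 / 2) ∘L .inr ℂ ℂ ℂ).IsInvertible := by
    have h1 : HasDerivAt (fun z => resolventFun (0, z)) (fderiv ℂ resolventFun (0, 1 / 2) (0, 1)) (1 / 2) := by
      have h2 : HasDerivAt (fun z : ℂ => ((0 : ℂ), z)) (0, 1) (1 / 2) :=
        (hasDerivAt_const _ _).prodMk (hasDerivAt_id _)
      exact (contDiffAt_resolventFun.differentiableAt one_ne_zero).hasFDerivAt.comp_hasDerivAt (1 / 2) h2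
    have h3 := h1.unique hasDerivAt_resolventFun_zero
    refine ⟨ContinuousLinearEquiv.unitsEquivAut ℂ (Units.mk0 4 (by norm_num)), ?_⟩
    ext
    simpa using h3.symm
  set ρ := contDiffAt_resolventFun.implicitFunction one_ne_zero hinv with hρ
  have hρ0 : ρ 0 = 1 / 2 := contDiffAt_resolventFun.implicitFunction_apply_self one_ne_zero hinv
  have hρe : ∀ᶠ τ in 𝓝 (0 : ℂ), resolventFun (τ, ρ τ) = resolventFun (0, 1 / 2) :=
    contDiffAt_resolventFun.eventually_apply_implicitFunction one_ne_zero hinv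
  have hρc : ContDiffAt ℂ 1 ρ 0 := contDiffAt_resolventFun.contDiffAt_implicitFunction one_ne_zero hinv
  have hρa : AnalyticAt ℂ ρ 0 := by
    rw [Complex.analyticAt_iff_eventually_differentiableAt]
    filter_upwards [hρc.eventually (by simp)] with τ hτ using hτ.differentiableAt one_ne_zero
  have hρn : ∀ᶠ τ in 𝓝 (0 : ℂ), ‖ρ τ - 1 / 2‖ < δ := by
    have h1 : ContinuousAt (fun τ => ‖ρ τ - 1 / 2‖) 0 := (hρa.continuousAt.sub_const _).norm
    refine h1.eventually (gt_mem_nhds ?_)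
    simpa [hρ0] using hδ
  obtain ⟨ε, hε, hall⟩ := Metric.eventually_nhds_iff_ball.1
    (hρe.and (hρa.eventually_analyticAt.and hρn))
  have hmem {τ : ℂ} (hτ : ‖τ‖ ≤ min (ε / 2) δ) : τ ∈ Metric.ball (0 : ℂ) ε := by
    rw [Metric.mem_ball, dist_zero_right]
    linarith [min_le_left (ε / 2) δ]
  refine ⟨min (ε / 2) δ, ρ, by positivity, min_le_right _ _, fun τ hτ => ?_, fun τ hτ => ?_,
    fun τ hτ => ?_⟩
  · exact (hall τ (hmem (by simpa using hτ))).2.1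
  · exact (hall τ (hmem hτ)).2.2.le
  · rw [(h τ (ρ τ) ((hτ.trans (min_le_right _ _)).trans hδ₀)
      ((hall τ (hmem hτ)).2.2.le.trans hδ₀)).dominantEigenvalue_eq_one_iff,
      (hall τ (hmem hτ)).1, resolventFun_zero_half]

lemma IsAnalyticSolution.apply_zero {M δ₀ δ η : ℝ} {ρ : ℂ → ℂ}
    (h : ∀ τ z : ℂ, ‖τ‖ ≤ δ₀ → ‖z - 1 / 2‖ ≤ δ₀ →
      GoodPerturbation minkowskiFunctional Hinf.one (restOpAt τ z) (7 / 6) M)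
    (hδ₀ : δ₀ ≤ 1 / 10) (hδ : δ ≤ δ₀) (hρ : IsAnalyticSolution δ η ρ) : ρ 0 = 1 / 2 := by
  have h0 : ‖(0 : ℂ)‖ ≤ η := by simpa using hρ.pos.le
  have hn := (hρ.near_half 0 h0).trans hδ
  have hg := h 0 (ρ 0) ((h0.trans hρ.le).trans hδ) hn
  have h1 := hg.dominantEigenvalue_eq_one_iff.1 (hρ.eq_one 0 h0)
  have h2 := mul_resolventFun_zero (norm_le_of_norm_sub_half_le (hn.trans hδ₀)) hg
  rw [h1] at h2
  linear_combination -(1 / 2) * h2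

end

noncomputable section

/-! ### Derivatives of the transfer operators along a curve -/

lemma measurable_floor_one_div : Measurable fun x : ℝ => (⌊1 / x⌋ : ℝ) :=
  (measurable_from_top (f := fun k : ℤ => (k : ℝ))).comp (Int.measurable_floor.comp (by fun_prop))

lemma abs_log_le_one_div {x : ℝ} (hx : x ∈ Ioo (0 : ℝ) 1) : |Real.log x| ≤ 1 / x := by
  rw [abs_of_nonpos (Real.log_nonpos hx.1.le hx.2.le), ← Real.log_inv, one_div]
  exact Real.log_le_self (inv_nonneg.2 hx.1.le)

lemma abs_floor_le_one_div {x : ℝ} (hx : x ∈ Ioo (0 : ℝ) 1) : |(⌊1 / x⌋ : ℝ)| ≤ 1 / x := by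
  have h : (0 : ℤ) ≤ ⌊1 / x⌋ := Int.floor_nonneg.2 (one_div_pos.2 hx.1).le
  rw [abs_of_nonneg (by exact_mod_cast h)]
  exact Int.floor_le _

lemma one_le_one_div_of_mem {x : ℝ} (hx : x ∈ Ioo (0 : ℝ) 1) : 1 ≤ 1 / x := by
  rw [le_div_iff₀ hx.1, one_mul]
  exact hx.2.le

lemma integrable_log : Integrable Real.log minkowskiMeasure := by
  refine integrable_minkowski_of_le (C := 1) Real.measurable_log.aestronglyMeasurable fun x hx => ?_
  have h1 := one_le_one_div_of_mem hx
  rw [Real.norm_eq_abs, one_mul, sq]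
  exact (abs_log_le_one_div hx).trans (le_mul_of_one_le_left (by linarith) h1)

lemma integrable_floor : Integrable (fun x : ℝ => (⌊1 / x⌋ : ℝ)) minkowskiMeasure := by
  refine integrable_minkowski_of_le (C := 1) measurable_floor_one_div.aestronglyMeasurable
    fun x hx => ?_
  have h1 := one_le_one_div_of_mem hx
  rw [Real.norm_eq_abs, one_mul, sq]
  exact (abs_floor_le_one_div hx).trans (le_mul_of_one_le_left (by linarith) h1)

lemma integrable_ofReal_log : Integrable (fun x : ℝ => (Real.log x : ℂ)) minkowskiMeasure :=
  integrable_log.ofReal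

lemma integrable_ofReal_floor :
    Integrable (fun x : ℝ => ((⌊1 / x⌋ : ℝ) : ℂ)) minkowskiMeasure :=
  integrable_floor.ofReal

/-- The first partial quotient equals `n + 1` with probability `2^{-(n+1)}`. The value `2` accounts
for the factor `1/2` in `α` and for the coefficient of `q''` below. -/
lemma integral_floor : ∫ x, (⌊1 / x⌋ : ℝ) ∂minkowskiMeasure = 2 := by
  have h1 := hasSum_integral_minkowski integrable_floor
  have h2 : HasSum (fun n : ℕ => (n : ℝ) * (1 / 2) ^ n) 2 := by
    have := hasSum_coe_mul_geometric_of_norm_lt_one (𝕜 := ℝ) (r := 1 / 2) (by norm_num)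
    norm_num at this ⊢
    exact this
  rw [← hasSum_nat_add_iff' 1, Finset.sum_range_one, Nat.cast_zero, zero_mul, sub_zero] at h2
  refine h1.unique (h2.congr_fun fun n => ?_)
  have h3 : ∫ t, (⌊1 / realBranch n t⌋ : ℝ) ∂minkowskiMeasure = n + 1 := by
    have : ∫ t, (⌊1 / realBranch n t⌋ : ℝ) ∂minkowskiMeasure = ∫ _, ((n : ℝ) + 1) ∂minkowskiMeasure := by
      refine integral_congr_ae ?_
      filter_upwards [ae_minkowski_mem_Ioo] with t ht
      rw [floor_one_div_realBranch n (Ioo_subset_Ico_self ht)]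
      push_cast
      rfl
    rw [this, integral_const, probReal_univ, one_smul]
  rw [h3, smul_eq_mul]
  push_cast
  ring

lemma minkowskiAlpha_eq : minkowskiAlpha = -(1 / 2) * ∫ x, Real.log x ∂minkowskiMeasure := by
  rw [minkowskiAlpha, minkowskiMeasure_restrict_Ioc]

/-- The function `x ↦ log x + a ⌊1/x⌋`. -/
def digitLog (a : ℂ) (x : ℝ) : ℂ := (Real.log x : ℂ) + a * ((⌊1 / x⌋ : ℝ) : ℂ)

lemma digitLog_minkowskiAlpha (x : ℝ) : digitLog minkowskiAlpha x = (centredLog x : ℂ) := by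
  rw [digitLog, centredLog]
  push_cast
  rfl

lemma measurable_digitLog (a : ℂ) : Measurable (digitLog a) :=
  (Complex.measurable_ofReal.comp Real.measurable_log).add
    ((Complex.measurable_ofReal.comp measurable_floor_one_div).const_mul a)

lemma norm_digitLog_le (a : ℂ) {x : ℝ} (hx : x ∈ Ioo (0 : ℝ) 1) :
    ‖digitLog a x‖ ≤ (1 + ‖a‖) * (1 / x) := by
  refine (norm_add_le _ _).trans ?_
  rw [norm_mul, Complex.norm_real, Complex.norm_real, Real.norm_eq_abs, Real.norm_eq_abs, add_mul,
    one_mul]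
  exact add_le_add (abs_log_le_one_div hx)
    (mul_le_mul_of_nonneg_left (abs_floor_le_one_div hx) (norm_nonneg _))

lemma integrable_digitLog_mul (a : ℂ) {h : ℝ → ℂ} (hh : AEStronglyMeasurable h minkowskiMeasure)
    {C : ℝ} (hC : ∀ x ∈ Ioo (0 : ℝ) 1, ‖h x‖ ≤ C) :
    Integrable (fun x => digitLog a x * h x) minkowskiMeasure := by
  refine integrable_minkowski_of_le (C := (1 + ‖a‖) * C)
    ((measurable_digitLog a).aestronglyMeasurable.mul hh) fun x hx => ?_
  have h1 := one_le_one_div_of_mem hx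
  have hC0 : 0 ≤ C := (norm_nonneg _).trans (hC x hx)
  rw [norm_mul]
  calc ‖digitLog a x‖ * ‖h x‖ ≤ ((1 + ‖a‖) * (1 / x)) * C :=
        mul_le_mul (norm_digitLog_le a hx) (hC x hx) (norm_nonneg _) (by positivity)
    _ = (1 + ‖a‖) * C * (1 / x) := by ring
    _ ≤ (1 + ‖a‖) * C * (1 / x) ^ 2 := by
      refine mul_le_mul_of_nonneg_left ?_ (by positivity)
      rw [sq]
      exact le_mul_of_one_le_left (by linarith) h1

lemma integrable_digitLog_sq (a : ℂ) :
    Integrable (fun x => digitLog a x ^ 2) minkowskiMeasure := by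
  refine integrable_minkowski_of_le (C := (1 + ‖a‖) ^ 2)
    ((measurable_digitLog a).pow_const 2).aestronglyMeasurable fun x hx => ?_
  rw [norm_pow, ← mul_pow]
  exact pow_le_pow_left₀ (norm_nonneg _) (norm_digitLog_le a hx) 2

lemma digitLog_realBranch (a : ℂ) (n : ℕ) {t : ℝ} (ht : t ∈ Ioo (0 : ℝ) 1) :
    digitLog a (realBranch n t) =
      ((n : ℂ) + 1) * a - Complex.log ((n : ℂ) + 1 + realPt t) := by
  have h0 := ht.1
  rw [digitLog, floor_one_div_realBranch n (Ioo_subset_Ico_self ht), realBranch, one_div,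
    Real.log_inv, coe_realPt (Ioo_subset_Icc_self ht),
    show (n : ℂ) + 1 + (t : ℂ) = (((n : ℝ) + 1 + t : ℝ) : ℂ) by push_cast; rfl,
    ← Complex.ofReal_log (by positivity)]
  push_cast
  ring

/-- A series of operators is computed by integration if its terms are. -/
lemma minkowskiFunctional_eq_integral {T : ℕ → Hinf →L[ℂ] Hinf} {S : Hinf →L[ℂ] Hinf}
    (h : HasSum T S) (f : Hinf) {g : ℝ → ℂ} (hg : Integrable g minkowskiMeasure)
    (hT : ∀ n, ∀ t ∈ Ioo (0 : ℝ) 1,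
      (T n f).1 (realPt t) = (1 / 2 : ℂ) ^ (n + 1) * g (realBranch n t)) :
    minkowskiFunctional (S f) = ∫ x, g x ∂minkowskiMeasure := by
  refine (hasSum_functional h f).unique ((hasSum_integral_minkowski hg).congr_fun fun n => ?_)
  rw [minkowskiFunctional_apply, Complex.real_smul, ofReal_half_pow, ← integral_const_mul]
  refine integral_congr_ae ?_
  filter_upwards [ae_minkowski_mem_Ioo] with t ht using hT n t ht

/-- Differentiating `e^{(n+1)q(τ)} (n + 1 + t)^{-τ}` brings out the factor `(n + 1) q' - log(n + 1 +
t)`, which is `digitLog q'` at the point `1/(n + 1 + t)`. Self-similarity of `μ` then turns the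
series into integrals; the second derivative has an extra term `(n + 1) q''`, of integral `2 q''`.
-/
lemma transferOp_curve_derivs {q : ℂ → ℂ} (hq : AnalyticAt ℂ q 0)
    (hq0 : Complex.exp (q 0) = 1 / 2) {A : ℂ → Hinf →L[ℂ] Hinf}
    (hA : A =ᶠ[𝓝 0] fun τ => transferOp τ (Complex.exp (q τ))) :
    (∀ᶠ τ in 𝓝 0, DifferentiableAt ℂ A τ) ∧
    (∀ f, minkowskiFunctional (deriv A 0 f) =
      ∫ x, digitLog (deriv q 0) x * f.1 (realPt x) ∂minkowskiMeasure) ∧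
    (∀ t : gaussDisc, HasSum (fun n : ℕ => (1 / 2 : ℂ) ^ (n + 1) *
      (((n : ℂ) + 1) * deriv q 0 - Complex.log ((n : ℂ) + 1 + t))) ((deriv A 0 Hinf.one).1 t)) ∧
    minkowskiFunctional (deriv (deriv A) 0 Hinf.one) =
      (∫ x, digitLog (deriv q 0) x ^ 2 ∂minkowskiMeasure) + 2 * deriv (deriv q) 0 := by
  obtain ⟨h1, h2, h3⟩ := tsum_exp_smul_derivs (T := termOp) (G := genOp) hasDerivAt_termOp
    summable_termBound mul_pow_mul_norm_termOp_le hq hq0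
  have hexp (n : ℕ) (τ : ℂ) : Complex.exp (((n : ℂ) + 1) * q τ) = Complex.exp (q τ) ^ (n + 1) := by
    rw [← Complex.exp_nat_mul]
    push_cast
    rfl
  have hAs : A =ᶠ[𝓝 0] fun τ => ∑' n : ℕ, Complex.exp (((n : ℂ) + 1) * q τ) • termOp n τ := by
    have hev : ∀ᶠ τ in 𝓝 (0 : ℂ), ‖Complex.exp (q τ)‖ < 3 / 5 := by
      have h4 : ContinuousAt (fun τ => ‖Complex.exp (q τ)‖) 0 := hq.continuousAt.cexp.norm
      refine h4.eventually (gt_mem_nhds ?_)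
      change ‖Complex.exp (q 0)‖ < 3 / 5
      rw [hq0]
      norm_num
    filter_upwards [hA, hev, Metric.ball_mem_nhds (0 : ℂ) (by norm_num : (0 : ℝ) < 1 / 10)]
      with τ hτ hτ2 hτ3
    rw [hτ, ← (hasSum_transferOp (by simpa using (Metric.mem_ball.1 hτ3).le) hτ2.le).tsum_eq]
    simp only [hexp]
  have hg0 (n : ℕ) : Complex.exp (((n : ℂ) + 1) * q 0) • termOp n 0 =
      (1 / 2 : ℂ) ^ (n + 1) • compOp n := by rw [hexp, hq0, termOp_zero]
  simp only [hg0] at h2 h3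
  rw [← hAs.deriv_eq] at h2
  rw [← hAs.deriv.deriv_eq] at h3
  set a := deriv q 0
  set κ := deriv (deriv q) 0
  set d : ℕ → Hinf →L[ℂ] Hinf := fun n =>
    (((n : ℂ) + 1) * a) • (1 / 2 : ℂ) ^ (n + 1) • compOp n +
      genOp n * (1 / 2 : ℂ) ^ (n + 1) • compOp n with hd
  have hd1 (n : ℕ) (f : Hinf) (t : gaussDisc) : (d n f).1 t = (1 / 2 : ℂ) ^ (n + 1) *
      ((((n : ℂ) + 1) * a - Complex.log ((n : ℂ) + 1 + t)) * f.1 (branch n t)) := by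
    change ((n : ℂ) + 1) * a * ((1 / 2 : ℂ) ^ (n + 1) * f.1 (branch n t)) +
      -(Complex.log ((n : ℂ) + 1 + t) * ((1 / 2 : ℂ) ^ (n + 1) * f.1 (branch n t))) = _
    ring
  refine ⟨?_, fun f => ?_, fun t => ?_, ?_⟩
  · filter_upwards [h1, hAs.eventuallyEq_nhds] with τ hτ hτ2
    exact hτ.congr_of_eventuallyEq hτ2
  · refine minkowskiFunctional_eq_integral h2 f (integrable_digitLog_mul a
      (integrable_realPt f).aestronglyMeasurable (C := ‖f‖) fun x _ => Hinf.norm_coe_apply_le f _)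
      fun n t ht => ?_
    rw [hd1, digitLog_realBranch a n ht, branch_realPt n (Ioo_subset_Icc_self ht)]
  · refine (hasSum_apply h2 Hinf.one t).congr_fun fun n => ?_
    rw [hd1, Hinf.one_apply, mul_one]
  · have hi : Integrable (fun x : ℝ => κ * ((⌊1 / x⌋ : ℝ) : ℂ)) minkowskiMeasure :=
      integrable_ofReal_floor.const_mul κ
    rw [minkowskiFunctional_eq_integral h3 Hinf.one
      (g := fun x => digitLog a x ^ 2 + κ * ((⌊1 / x⌋ : ℝ) : ℂ))
      ((integrable_digitLog_sq a).add hi) fun n t ht => ?_]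
    · rw [integral_add (integrable_digitLog_sq a) hi, integral_const_mul, integral_complex_ofReal,
        integral_floor]
      push_cast
      ring
    · change ((n : ℂ) + 1) * κ * ((1 / 2 : ℂ) ^ (n + 1) * 1) +
        (((n : ℂ) + 1) * a * (d n Hinf.one).1 (realPt t) +
          -(Complex.log ((n : ℂ) + 1 + realPt t) * (d n Hinf.one).1 (realPt t))) = _
      rw [hd1, Hinf.one_apply, digitLog_realBranch a n ht,
        floor_one_div_realBranch n (Ioo_subset_Ico_self ht)]
      push_cast
      ring

/-! ### The solution of the cohomological equation -/

lemma two_thirds_lt_re_one_add_mul {t : ℂ} (ht : t ∈ gaussDisc) {y : ℝ} (hy : y ∈ Icc (0 : ℝ) 1) :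
    2 / 3 < (1 + t * y).re := by
  have h1 := two_thirds_lt_re ht 0
  simp only [Nat.cast_zero, zero_add, Complex.add_re, Complex.one_re] at h1
  simp only [Complex.add_re, Complex.one_re, Complex.mul_re, Complex.ofReal_re, Complex.ofReal_im,
    mul_zero, sub_zero]
  have h2 : t.re * y > -(1 / 3) ∨ y = 0 := by
    rcases eq_or_lt_of_le hy.1 with h | h
    · exact Or.inr h.symm
    · left
      nlinarith [hy.2]
  rcases h2 with h2 | h2
  · linarith
  · rw [h2]; norm_num

lemma norm_log_one_add_mul_le {t : ℂ} (ht : t ∈ gaussDisc) {y : ℝ} (hy : y ∈ Icc (0 : ℝ) 1) :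
    ‖Complex.log (1 + t * y)‖ ≤ 7 := by
  refine (norm_log_le_of_re (C := 3) (two_thirds_lt_re_one_add_mul ht hy) (by norm_num) ?_).trans
    (by norm_num)
  have h1 := norm_add_le (1 : ℂ) (t * y)
  have h2 := norm_add_le (t - 2 / 3) (2 / 3)
  have h3 : ‖(2 / 3 : ℂ)‖ = 2 / 3 := by simp
  have h4 : ‖t - 2 / 3‖ < 1 := by simpa [gaussDisc, dist_eq_norm] using ht
  rw [sub_add_cancel] at h2
  rw [norm_one, norm_mul, Complex.norm_real, Real.norm_of_nonneg hy.1] at h1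
  have h5 : ‖t‖ * y ≤ ‖t‖ := mul_le_of_le_one_right (norm_nonneg _) hy.2
  linarith

lemma measurable_log_one_add_mul (t : ℂ) : Measurable fun y : ℝ => Complex.log (1 + t * y) :=
  Complex.measurable_log.comp (by fun_prop)

lemma integrable_log_one_add_mul {t : ℂ} (ht : t ∈ gaussDisc) :
    Integrable (fun y : ℝ => Complex.log (1 + t * y)) minkowskiMeasure :=
  Integrable.of_bound (measurable_log_one_add_mul t).aestronglyMeasurable 7
    (ae_minkowski_mem_Ioo.mono fun _ hy => norm_log_one_add_mul_le ht (Ioo_subset_Icc_self hy))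

lemma differentiableOn_integral_log :
    DifferentiableOn ℂ (fun t : ℂ => -∫ y : ℝ, Complex.log (1 + t * y) ∂minkowskiMeasure)
      gaussDisc := by
  intro t ht
  refine DifferentiableAt.differentiableWithinAt (DifferentiableAt.neg ?_)
  have h := hasDerivAt_integral_of_dominated_loc_of_deriv_le (μ := minkowskiMeasure) (𝕜 := ℂ)
    (F := fun t (y : ℝ) => Complex.log (1 + t * y)) (F' := fun t (y : ℝ) => (y : ℂ) / (1 + t * y))
    (bound := fun _ => 3 / 2) (Metric.isOpen_ball.mem_nhds ht)
    (Eventually.of_forall fun s => (measurable_log_one_add_mul s).aestronglyMeasurable)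
    (integrable_log_one_add_mul ht)
    (Measurable.aestronglyMeasurable (by fun_prop)) ?_ (integrable_const _) ?_
  · exact h.2.differentiableAt
  · filter_upwards [ae_minkowski_mem_Ioo] with y hy s hs
    have h1 := two_thirds_lt_re_one_add_mul hs (Ioo_subset_Icc_self hy)
    have h2 := h1.trans_le (Complex.re_le_norm _)
    rw [norm_div, Complex.norm_real, Real.norm_of_nonneg hy.1.le, div_le_iff₀ (by linarith)]
    linarith [hy.2]
  · filter_upwards [ae_minkowski_mem_Ioo] with y hy s hs
    have h1 := two_thirds_lt_re_one_add_mul hs (Ioo_subset_Icc_self hy)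
    have h2 : HasDerivAt (fun s : ℂ => 1 + s * y) (y : ℂ) s := by
      simpa using ((hasDerivAt_id s).mul_const (y : ℂ)).const_add 1
    exact h2.clog (Or.inl (by linarith))

/-- The function `t ↦ -∫ log (1 + t y) dμ(y)`. -/
def potential : Hinf :=
  Hinf.ofFun (fun t => -∫ y : ℝ, Complex.log (1 + t * y) ∂minkowskiMeasure)
    differentiableOn_integral_log 7 fun t ht => by
      have h := norm_integral_le_of_norm_le_const (μ := minkowskiMeasure) (C := 7)
        (f := fun y : ℝ => Complex.log (1 + t * y))
        (ae_minkowski_mem_Ioo.mono fun _ hy => norm_log_one_add_mul_le ht (Ioo_subset_Icc_self hy))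
      rw [probReal_univ, mul_one] at h
      rw [norm_neg]
      exact h

lemma potential_apply (t : gaussDisc) :
    potential.1 t = -∫ y : ℝ, Complex.log (1 + t * y) ∂minkowskiMeasure := rfl

/-- Both factors of `w (1 + y/w)` lie in the right half plane, so their arguments add without
leaving the principal range. -/
lemma log_one_add_div {w : ℂ} (hw : 0 < w.re) {y : ℝ} (hy : 0 ≤ y) :
    Complex.log (1 + 1 / w * y) = Complex.log (w + y) - Complex.log w := by
  have hw0 : w ≠ 0 := by rintro rfl; simp at hw
  have h1 : 0 < (1 + 1 / w * y).re := by
    rw [one_div, Complex.add_re, Complex.one_re, Complex.re_mul_ofReal, Complex.inv_re]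
    have : 0 ≤ w.re / Complex.normSq w * y :=
      mul_nonneg (div_nonneg hw.le (Complex.normSq_nonneg _)) hy
    linarith
  have h10 : 1 + 1 / w * y ≠ 0 := by intro h; rw [h] at h1; simp at h1
  have h2 := abs_lt.1 (Complex.abs_arg_lt_pi_div_two_iff.2 (Or.inl hw))
  have h3 := abs_lt.1 (Complex.abs_arg_lt_pi_div_two_iff.2 (Or.inl h1))
  have h4 := Complex.log_mul hw0 h10 ⟨by linarith [h2.1, h3.1], by linarith [h2.2, h3.2]⟩
  have e : w * (1 + 1 / w * y) = w + y := by field_simp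
  rw [e] at h4
  rw [h4]
  ring

/-- The kernel `log(n + 1 + t + y)` is symmetric in `t` and `y`. It appears when the operator acts
in `t` and again when `μ` is unfolded along branches in `y`; in the difference it cancels, leaving
`log(n + 1 + t)` and the constant `∫ log dμ`. -/
lemma hasSum_potential_sub (t : gaussDisc) :
    HasSum (fun n : ℕ => (1 / 2 : ℂ) ^ (n + 1) *
      (((n : ℂ) + 1) * minkowskiAlpha - Complex.log ((n : ℂ) + 1 + t)))
      ((potential - baseOp potential).1 t) := by
  have hint (n : ℕ) : Integrable (fun y : ℝ => Complex.log ((n : ℂ) + 1 + t + y)) minkowskiMeasure := by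
    have h1 := (integrable_log_one_add_mul (branch n t).2).add
      (integrable_const (Complex.log ((n : ℂ) + 1 + t)))
    refine h1.congr ?_
    filter_upwards [ae_minkowski_mem_Ioo] with y hy
    have := log_one_add_div (w := (n : ℂ) + 1 + t) (by linarith [two_thirds_lt_re t.2 n]) hy.1.le
    change Complex.log (1 + 1 / ((n : ℂ) + 1 + t) * y) + Complex.log ((n : ℂ) + 1 + t) = _
    rw [this]
    ring
  have hlogb (n : ℕ) : Integrable (fun y : ℝ => (Real.log (realBranch n y) : ℂ)) minkowskiMeasure :=
    integrable_comp_realBranch integrable_ofReal_log n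
  have e1 (n : ℕ) : potential.1 (branch n t) =
      Complex.log ((n : ℂ) + 1 + t) - ∫ y : ℝ, Complex.log ((n : ℂ) + 1 + t + y) ∂minkowskiMeasure := by
    have h1 : ∫ y : ℝ, Complex.log (1 + (branch n t : ℂ) * y) ∂minkowskiMeasure =
        ∫ y : ℝ, (Complex.log ((n : ℂ) + 1 + t + y) - Complex.log ((n : ℂ) + 1 + t))
          ∂minkowskiMeasure := by
      refine integral_congr_ae ?_
      filter_upwards [ae_minkowski_mem_Ioo] with y hy
      exact log_one_add_div (by linarith [two_thirds_lt_re t.2 n]) hy.1.le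
    rw [potential_apply, h1, integral_sub (hint n) (integrable_const _), integral_const,
      probReal_univ, one_smul]
    ring
  have e2 (n : ℕ) : ∫ y : ℝ, Complex.log (1 + (t : ℂ) * (realBranch n y : ℝ)) ∂minkowskiMeasure =
      (∫ y : ℝ, Complex.log ((n : ℂ) + 1 + t + y) ∂minkowskiMeasure) +
        ∫ y : ℝ, (Real.log (realBranch n y) : ℂ) ∂minkowskiMeasure := by
    rw [← integral_add (hint n) (hlogb n)]
    refine integral_congr_ae ?_
    filter_upwards [ae_minkowski_mem_Ioo] with y hy
    have h0 := hy.1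
    have hr : (0 : ℝ) < (n : ℝ) + 1 + y := by positivity
    have hne : 1 + (t : ℂ) * (realBranch n y : ℝ) ≠ 0 := by
      intro h
      have := two_thirds_lt_re_one_add_mul t.2 (realBranch_mem n (Ioo_subset_Icc_self hy))
      rw [h] at this
      norm_num at this
    have h1 := Complex.log_ofReal_mul hr hne
    have e : (((n : ℝ) + 1 + y : ℝ) : ℂ) * (1 + (t : ℂ) * (realBranch n y : ℝ)) =
        (n : ℂ) + 1 + t + y := by
      have hr' : ((n : ℂ) + 1 + y) ≠ 0 := by exact_mod_cast hr.ne'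
      rw [realBranch]
      push_cast
      field_simp
      ring
    rw [e] at h1
    change _ = Complex.log ((n : ℂ) + 1 + t + y) + (Real.log (realBranch n y) : ℂ)
    rw [h1, realBranch, one_div, Real.log_inv]
    push_cast
    ring
  have s1 := hasSum_baseOp_apply potential t
  have s2 := (hasSum_integral_minkowski (integrable_log_one_add_mul t.2)).neg
  have s3 := hasSum_integral_minkowski integrable_ofReal_log
  have s4 := hasSum_integral_minkowski integrable_ofReal_floor
  rw [← potential_apply] at s2
  -- By the choice of `α`, the constant left over is spread as `(n + 1) α` over the branches.
  have ea : (∫ x, (Real.log x : ℂ) ∂minkowskiMeasure) +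
      minkowskiAlpha * ∫ x, ((⌊1 / x⌋ : ℝ) : ℂ) ∂minkowskiMeasure = 0 := by
    rw [integral_complex_ofReal, integral_complex_ofReal, integral_floor, minkowskiAlpha_eq]
    push_cast
    ring
  have s5 := ((s2.sub s1).add s3).add (s4.mul_left (minkowskiAlpha : ℂ))
  rw [add_assoc, ea, add_zero] at s5
  refine s5.congr_fun fun n => ?_
  have e3 : ∫ y : ℝ, ((⌊1 / realBranch n y⌋ : ℝ) : ℂ) ∂minkowskiMeasure = (n : ℂ) + 1 := by
    have : ∫ y : ℝ, ((⌊1 / realBranch n y⌋ : ℝ) : ℂ) ∂minkowskiMeasure =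
        ∫ _, ((n : ℂ) + 1) ∂minkowskiMeasure := by
      refine integral_congr_ae ?_
      filter_upwards [ae_minkowski_mem_Ioo] with y hy
      rw [floor_one_div_realBranch n (Ioo_subset_Ico_self hy)]
      push_cast
      rfl
    rw [this, integral_const, probReal_univ, one_smul]
  simp only [Complex.real_smul, ofReal_half_pow]
  rw [e1, e2, e3]
  ring

end

noncomputable section

/-! ### Derivatives of a solution of `λ(τ, ρ(τ)) = 1` -/

lemma integral_digitLog (a : ℂ) : ∫ x, digitLog a x ∂minkowskiMeasure = 2 * (a - minkowskiAlpha) := by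
  have h : ∫ x, digitLog a x ∂minkowskiMeasure = (∫ x, (Real.log x : ℂ) ∂minkowskiMeasure) +
      ∫ x, a * ((⌊1 / x⌋ : ℝ) : ℂ) ∂minkowskiMeasure :=
    integral_add integrable_ofReal_log (integrable_ofReal_floor.const_mul a)
  rw [h, integral_const_mul, integral_complex_ofReal, integral_complex_ofReal, integral_floor,
    minkowskiAlpha_eq]
  push_cast
  ring

lemma deriv_log_solution {q : ℂ → ℂ} (hq : AnalyticAt ℂ q 0) (hq0 : Complex.exp (q 0) = 1 / 2)
    {s M : ℝ}
    (hgood : ∀ᶠ τ in 𝓝 0, GoodPerturbation minkowskiFunctional Hinf.one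
      (restOpAt τ (Complex.exp (q τ))) s M)
    (hone : ∀ᶠ τ in 𝓝 0, resolventFun (τ, Complex.exp (q τ)) = 1) :
    deriv q 0 = minkowskiAlpha ∧
    deriv (deriv q) 0 = -(1 / 2) * (∫ x, digitLog minkowskiAlpha x ^ 2 ∂minkowskiMeasure) -
      ∫ x, digitLog minkowskiAlpha x * potential.1 (realPt x) ∂minkowskiMeasure := by
  set A : ℂ → Hinf →L[ℂ] Hinf := fun τ => transferOp τ (Complex.exp (q τ)) with hA
  set u : ℂ → Hinf := fun τ => Ring.inverse (1 - restOpAt τ (Complex.exp (q τ))) Hinf.one with hu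
  obtain ⟨hAd, hA1, hA1s, hA2⟩ := transferOp_curve_derivs hq hq0 (A := A) EventuallyEq.rfl
  have hA0 : A 0 = baseOp := by rw [hA, baseOp, ← hq0]
  have hu0 : u 0 = Hinf.one := by
    have h0 := inverse_apply_cancel hgood.self_of_nhds.isUnit_one_sub Hinf.one
    rw [sub_apply, one_apply_eq_self] at h0
    rw [hq0, restOpAt_zero_half, restOp_one, sub_zero] at h0
    rw [hu]
    simp only [hq0, restOpAt_zero_half]
    exact h0
  have hud : ∀ᶠ τ in 𝓝 0, DifferentiableAt ℂ u τ := by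
    filter_upwards [hAd, hgood] with τ hτ hg
    have h1 : DifferentiableAt ℂ (fun τ => 1 - restOpAt τ (Complex.exp (q τ))) τ :=
      (differentiableAt_const 1).sub (hτ.sub (differentiableAt_const _))
    have h2 := DifferentiableAt.comp τ
      (f := fun τ => 1 - restOpAt τ (Complex.exp (q τ)))
      (differentiableAt_inverse (𝕜 := ℂ) hg.isUnit_one_sub) h1
    exact h2.clm_apply (differentiableAt_const Hinf.one)
  have hAu : ∀ᶠ τ in 𝓝 0, A τ (u τ) = u τ := by
    filter_upwards [hgood, hone] with τ hg h1
    have := hg.apply_resolvent_eq h1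
    rwa [restOpAt_add] at this
  obtain ⟨e1, e2, e3⟩ := eigenvector_derivs (φ := minkowskiFunctional)
    (fun v => by rw [hA0]; exact minkowskiFunctional_baseOp v) hAd hud hAu
  rw [hu0] at e1 e2 e3
  have ha : deriv q 0 = minkowskiAlpha := by
    have h1 := hA1 Hinf.one
    simp only [Hinf.one_apply, mul_one] at h1
    rw [e1, integral_digitLog] at h1
    linear_combination -(1 / 2) * h1
  refine ⟨ha, ?_⟩
  rw [ha] at hA1 hA1s hA2
  have hp : potential - baseOp potential = deriv A 0 Hinf.one :=
    Hinf.ext_apply fun t => (hasSum_potential_sub t).unique (hA1s t)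
  have hfix : baseOp (deriv u 0 - potential) = deriv u 0 - potential := by
    rw [hA0] at e2
    rw [map_sub]
    have h1 : baseOp (deriv u 0) = deriv u 0 - deriv A 0 Hinf.one := by
      rw [eq_sub_iff_add_eq']
      exact e2
    rw [h1, ← hp]
    abel
  -- `u'(0)` and `potential` solve the same equation, hence differ by a constant; it contributes
  -- nothing below because `μ(A'(0) 1) = 0`.
  have h3 := eq_smul_one_of_baseOp_eq hfix
  rw [sub_eq_iff_eq_add'] at h3
  rw [h3, map_add, map_smul, map_add, map_smul, e1, smul_zero, add_zero, hA2, hA1] at e3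
  linear_combination (1 / 2) * e3

/-! ### Real integrals against the Minkowski measure -/

/-- The function `x ↦ -∫ log (1 + x y) dμ(y)` on `[0, 1]`. -/
def realPotential (x : ℝ) : ℝ := (potential.1 (realPt x)).re

lemma continuous_realPotential : Continuous realPotential :=
  Complex.continuous_re.comp (potential.1.continuous.comp continuous_realPt)

lemma log_one_add_mul_mem {x y : ℝ} (hx : x ∈ Icc (0 : ℝ) 1) (hy : y ∈ Icc (0 : ℝ) 1) :
    Real.log (1 + x * y) ∈ Icc (0 : ℝ) 1 := by
  have h1 : 0 ≤ x * y := mul_nonneg hx.1 hy.1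
  have h2 : x * y ≤ 1 := mul_le_one₀ hx.2 hy.1 hy.2
  refine ⟨Real.log_nonneg (by linarith), ?_⟩
  have := Real.log_le_sub_one_of_pos (show 0 < 1 + x * y by linarith)
  linarith

lemma integrable_log_one_add {x : ℝ} (hx : x ∈ Icc (0 : ℝ) 1) :
    Integrable (fun y => Real.log (1 + x * y)) minkowskiMeasure := by
  refine Integrable.of_bound (Measurable.aestronglyMeasurable (by fun_prop)) 1 ?_
  filter_upwards [ae_minkowski_mem_Ioo] with y hy
  have := log_one_add_mul_mem hx (Ioo_subset_Icc_self hy)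
  rw [Real.norm_of_nonneg this.1]
  exact this.2

lemma potential_realPt {x : ℝ} (hx : x ∈ Icc (0 : ℝ) 1) :
    potential.1 (realPt x) = ((-∫ y, Real.log (1 + x * y) ∂minkowskiMeasure : ℝ) : ℂ) := by
  rw [potential_apply, coe_realPt hx]
  push_cast
  rw [← integral_complex_ofReal]
  congr 1
  refine integral_congr_ae ?_
  filter_upwards [ae_minkowski_mem_Ioo] with y hy
  have : 0 ≤ x * y := mul_nonneg hx.1 hy.1.le
  rw [Complex.ofReal_log (by linarith)]
  push_cast
  rfl

lemma realPotential_eq {x : ℝ} (hx : x ∈ Icc (0 : ℝ) 1) :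
    realPotential x = -∫ y, Real.log (1 + x * y) ∂minkowskiMeasure := by
  rw [realPotential, potential_realPt hx, Complex.ofReal_re]

lemma ofReal_realPotential {x : ℝ} (hx : x ∈ Icc (0 : ℝ) 1) :
    (realPotential x : ℂ) = potential.1 (realPt x) := by
  rw [realPotential_eq hx, potential_realPt hx]

lemma abs_realPotential_le {x : ℝ} (hx : x ∈ Icc (0 : ℝ) 1) : |realPotential x| ≤ 1 := by
  rw [realPotential_eq hx, abs_neg]
  have h := norm_integral_le_of_norm_le_const (μ := minkowskiMeasure) (C := 1)
    (f := fun y => Real.log (1 + x * y)) (by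
      filter_upwards [ae_minkowski_mem_Ioo] with y hy
      have := log_one_add_mul_mem hx (Ioo_subset_Icc_self hy)
      rw [Real.norm_of_nonneg this.1]
      exact this.2)
  rwa [probReal_univ, mul_one] at h

lemma measurable_centredLog : Measurable centredLog :=
  Real.measurable_log.add (measurable_floor_one_div.const_mul _)

lemma measurable_fract_one_div : Measurable fun x : ℝ => Int.fract (1 / x) :=
  measurable_fract.comp (by fun_prop)

lemma fract_mem (x : ℝ) : Int.fract x ∈ Icc (0 : ℝ) 1 :=
  ⟨Int.fract_nonneg _, (Int.fract_lt_one _).le⟩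

lemma abs_centredLog_le {x : ℝ} (hx : x ∈ Ioo (0 : ℝ) 1) :
    |centredLog x| ≤ (1 + |minkowskiAlpha|) * (1 / x) := by
  have h := norm_digitLog_le minkowskiAlpha hx
  rwa [digitLog_minkowskiAlpha, Complex.norm_real, Complex.norm_real, Real.norm_eq_abs,
    Real.norm_eq_abs] at h

/-- Products of two functions of size `O(1/x)` are integrable. -/
lemma integrable_mul_of_le {f g : ℝ → ℝ} (hf : Measurable f) (hg : Measurable g) {C : ℝ}
    (hfC : ∀ x ∈ Ioo (0 : ℝ) 1, |f x| ≤ C * (1 / x))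
    (hgC : ∀ x ∈ Ioo (0 : ℝ) 1, |g x| ≤ C * (1 / x)) :
    Integrable (fun x => f x * g x) minkowskiMeasure := by
  refine integrable_minkowski_of_le (C := C * C) (hf.mul hg).aestronglyMeasurable fun x hx => ?_
  rw [Real.norm_eq_abs, abs_mul]
  calc |f x| * |g x| ≤ (C * (1 / x)) * (C * (1 / x)) :=
        mul_le_mul (hfC x hx) (hgC x hx) (abs_nonneg _) ((abs_nonneg _).trans (hfC x hx))
    _ = C * C * (1 / x) ^ 2 := by ring

/-- A common bound for the functions below is this constant times `1 / x`. -/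
def sizeConst : ℝ := 1 + |minkowskiAlpha| + 2

lemma abs_centredLog_le_sizeConst {x : ℝ} (hx : x ∈ Ioo (0 : ℝ) 1) :
    |centredLog x| ≤ sizeConst * (1 / x) := by
  refine (abs_centredLog_le hx).trans (mul_le_mul_of_nonneg_right ?_ (one_div_pos.2 hx.1).le)
  rw [sizeConst]; linarith

lemma abs_realPotential_le_sizeConst {x y : ℝ} (hx : x ∈ Ioo (0 : ℝ) 1) (hy : y ∈ Icc (0 : ℝ) 1) :
    |realPotential y| ≤ sizeConst * (1 / x) := by
  refine (abs_realPotential_le hy).trans ?_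
  have h1 := one_le_one_div_of_mem hx
  have h2 : 1 ≤ sizeConst := by rw [sizeConst]; linarith [abs_nonneg minkowskiAlpha]
  nlinarith

lemma abs_centredLog_add_le {x : ℝ} (hx : x ∈ Ioo (0 : ℝ) 1) :
    |centredLog x + realPotential x| ≤ sizeConst * (1 / x) := by
  have h1 := one_le_one_div_of_mem hx
  have h2 := abs_realPotential_le (Ioo_subset_Icc_self hx)
  have h3 := abs_centredLog_le hx
  have h4 := abs_add_le (centredLog x) (realPotential x)
  rw [sizeConst]
  linarith

lemma coboundary_eq {x : ℝ} (hx : x ∈ Icc (0 : ℝ) 1) :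
    (IntegrableOn (fun y => Real.log ((1 + y * Int.fract (1 / x)) / (1 + y * x)))
        (Icc (0 : ℝ) 1) minkowskiMeasure) ∧
      coboundary x = realPotential x - realPotential (Int.fract (1 / x)) := by
  have h1 := (integrable_log_one_add (fract_mem (1 / x))).sub (integrable_log_one_add hx)
  have e : (fun y => Real.log (1 + Int.fract (1 / x) * y) - Real.log (1 + x * y))
      =ᵐ[minkowskiMeasure] fun y => Real.log ((1 + y * Int.fract (1 / x)) / (1 + y * x)) := by
    filter_upwards [ae_minkowski_mem_Ioo] with y hy
    have h2 : 0 ≤ y * Int.fract (1 / x) := mul_nonneg hy.1.le (fract_mem _).1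
    have h3 : 0 ≤ y * x := mul_nonneg hy.1.le hx.1
    rw [Real.log_div (by linarith) (by linarith), mul_comm y, mul_comm y]
  constructor
  · rw [IntegrableOn, minkowskiMeasure_restrict_Icc]
    exact h1.congr e
  · rw [coboundary, minkowskiMeasure_restrict_Icc, ← integral_congr_ae e,
      integral_sub (integrable_log_one_add (fract_mem (1 / x))) (integrable_log_one_add hx),
      realPotential_eq hx, realPotential_eq (fract_mem _)]
    ring

lemma centredLog_realBranch (n : ℕ) {t : ℝ} (ht : t ∈ Ioo (0 : ℝ) 1) :
    centredLog (realBranch n t) = (n + 1) * minkowskiAlpha - Real.log (n + 1 + t) := by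
  rw [centredLog, floor_one_div_realBranch n (Ioo_subset_Ico_self ht), realBranch, one_div,
    Real.log_inv]
  push_cast
  ring

/-- The cohomological equation rearranged: the transfer operator sends `L + ψ` to `ψ`, so `L + ψ -
ψ∘G` has conditional mean zero along the branches. -/
lemma hasSum_centredLog_add {t : ℝ} (ht : t ∈ Ioo (0 : ℝ) 1) :
    HasSum (fun n : ℕ => (1 / 2 : ℝ) ^ (n + 1) *
      (centredLog (realBranch n t) + realPotential (realBranch n t))) (realPotential t) := by
  have ht' := Ioo_subset_Icc_self ht
  have h1 := (hasSum_potential_sub (realPt t)).add (hasSum_baseOp_apply potential (realPt t))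
  rw [Hinf.sub_apply, sub_add_cancel, ← ofReal_realPotential ht'] at h1
  refine Complex.hasSum_ofReal.1 (h1.congr_fun fun n => ?_)
  rw [← digitLog_realBranch _ n ht, digitLog_minkowskiAlpha, branch_realPt n ht',
    ← ofReal_realPotential (realBranch_mem n ht')]
  push_cast
  ring

lemma measurable_realPotential_fract : Measurable fun x => realPotential (Int.fract (1 / x)) :=
  continuous_realPotential.measurable.comp measurable_fract_one_div

lemma realBranch_mem_Ioo (n : ℕ) {t : ℝ} (ht : t ∈ Ioo (0 : ℝ) 1) :
    realBranch n t ∈ Ioo (0 : ℝ) 1 := by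
  refine ⟨realBranch_pos n ht.1.le, ?_⟩
  have h0 := ht.1
  have : (0 : ℝ) ≤ n := n.cast_nonneg
  rw [realBranch, div_lt_one (by positivity)]
  linarith

/-- The transfer operator is dual to the composition with the Gauss map. -/
lemma integral_centredLog_add_mul_realPotential_fract :
    ∫ x, (centredLog x + realPotential x) * realPotential (Int.fract (1 / x)) ∂minkowskiMeasure =
      ∫ x, realPotential x * realPotential x ∂minkowskiMeasure := by
  have hm : Measurable fun x => centredLog x + realPotential x :=
    measurable_centredLog.add continuous_realPotential.measurable
  have h1 := hasSum_integral_minkowski (integrable_mul_of_le hm measurable_realPotential_fract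
    (fun x hx => abs_centredLog_add_le hx)
    (fun x hx => abs_realPotential_le_sizeConst hx (fract_mem _)))
  have hs : Summable fun n : ℕ => (1 / 2 : ℝ) ^ (n + 1) * (sizeConst * (n + 2)) := by
    have g1 := summable_pow_mul_geometric_of_norm_lt_one (R := ℝ) 1 (r := 1 / 2) (by norm_num)
    have g0 := summable_pow_mul_geometric_of_norm_lt_one (R := ℝ) 0 (r := 1 / 2) (by norm_num)
    refine (((g1.add (g0.mul_left 2)).mul_left (sizeConst / 2))).congr fun n => ?_
    ring
  refine h1.unique ?_
  have h2 := hasSum_integral_of_dominated_convergence (μ := minkowskiMeasure)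
    (F := fun (n : ℕ) t => (1 / 2 : ℝ) ^ (n + 1) *
      ((centredLog (realBranch n t) + realPotential (realBranch n t)) * realPotential t))
    (f := fun t => realPotential t * realPotential t)
    (fun n _ => (1 / 2 : ℝ) ^ (n + 1) * (sizeConst * (n + 2))) (fun n => ?_) (fun n => ?_)
    (ae_of_all _ fun _ => hs) (integrable_const _) ?_
  · refine h2.congr_fun fun n => ?_
    rw [smul_eq_mul, ← integral_const_mul]
    refine integral_congr_ae ?_
    filter_upwards [ae_minkowski_mem_Ioo] with t ht
    rw [fract_one_div_realBranch n (Ioo_subset_Ico_self ht)]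
  · exact (((hm.comp (measurable_realBranch n)).mul
      continuous_realPotential.measurable).const_mul _).aestronglyMeasurable
  · filter_upwards [ae_minkowski_mem_Ioo] with t ht
    rw [norm_mul, Real.norm_of_nonneg (by positivity), Real.norm_eq_abs, abs_mul]
    refine mul_le_mul_of_nonneg_left ?_ (by positivity)
    have b1 := abs_centredLog_add_le (realBranch_mem_Ioo n ht)
    have b2 := abs_realPotential_le (Ioo_subset_Icc_self ht)
    have b3 : sizeConst * (1 / realBranch n t) ≤ sizeConst * (n + 2) := by
      rw [one_div_realBranch]
      refine mul_le_mul_of_nonneg_left (by linarith [ht.2]) ?_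
      rw [sizeConst]; positivity
    calc _ ≤ |centredLog (realBranch n t) + realPotential (realBranch n t)| * 1 :=
          mul_le_mul_of_nonneg_left b2 (abs_nonneg _)
      _ ≤ _ := by rw [mul_one]; exact b1.trans b3
  · filter_upwards [ae_minkowski_mem_Ioo] with t ht
    refine ((hasSum_centredLog_add ht).mul_right (realPotential t)).congr_fun fun n => ?_
    ring

lemma integral_realPotential_fract_sq :
    ∫ x, realPotential (Int.fract (1 / x)) * realPotential (Int.fract (1 / x)) ∂minkowskiMeasure =
      ∫ x, realPotential x * realPotential x ∂minkowskiMeasure := by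
  have h1 := hasSum_integral_minkowski (integrable_mul_of_le measurable_realPotential_fract
    measurable_realPotential_fract
    (fun x hx => abs_realPotential_le_sizeConst hx (fract_mem _))
    (fun x hx => abs_realPotential_le_sizeConst hx (fract_mem _)))
  refine h1.unique ?_
  have h2 := hasSum_half_pow.mul_right (∫ x, realPotential x * realPotential x ∂minkowskiMeasure)
  rw [one_mul] at h2
  refine h2.congr_fun fun n => ?_
  rw [smul_eq_mul]
  congr 1
  refine integral_congr_ae ?_
  filter_upwards [ae_minkowski_mem_Ioo] with t ht
  rw [fract_one_div_realBranch n (Ioo_subset_Ico_self ht)]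

/-! ### The variance identity and its strict positivity -/

lemma coboundary_ae : (fun x => centredLog x + coboundary x) =ᵐ[minkowskiMeasure]
    fun x => (centredLog x + realPotential x) - realPotential (Int.fract (1 / x)) := by
  filter_upwards [ae_minkowski_mem_Ioo] with x hx
  rw [(coboundary_eq (Ioo_subset_Icc_self hx)).2]
  ring

lemma integrable_centredLog_sq :
    Integrable (fun x => centredLog x * centredLog x) minkowskiMeasure :=
  integrable_mul_of_le measurable_centredLog measurable_centredLog
    (fun _ hx => abs_centredLog_le_sizeConst hx) (fun _ hx => abs_centredLog_le_sizeConst hx)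

lemma integrable_centredLog_mul_realPotential :
    Integrable (fun x => centredLog x * realPotential x) minkowskiMeasure :=
  integrable_mul_of_le measurable_centredLog continuous_realPotential.measurable
    (fun _ hx => abs_centredLog_le_sizeConst hx)
    (fun _ hx => abs_realPotential_le_sizeConst hx (Ioo_subset_Icc_self hx))

/-- Expanding the square of `(L + ψ) - ψ∘G`, the cross term gives `-2 ∫ ψ²` by duality and `∫ (ψ∘G)²
= ∫ ψ²` by invariance; together they cancel the `∫ ψ²` coming from `(L + ψ)²`. -/
lemma integrable_and_integral_coboundary_sq :
    Integrable (fun x => (centredLog x + coboundary x) ^ 2) minkowskiMeasure ∧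
    ∫ x, (centredLog x + coboundary x) ^ 2 ∂minkowskiMeasure =
      (∫ x, centredLog x * centredLog x ∂minkowskiMeasure) +
        2 * ∫ x, centredLog x * realPotential x ∂minkowskiMeasure := by
  have hV := continuous_realPotential.measurable
  have i1 := integrable_centredLog_sq
  have i2 := integrable_centredLog_mul_realPotential
  have i3 : Integrable (fun x => realPotential x * realPotential x) minkowskiMeasure :=
    integrable_mul_of_le hV hV
      (fun _ hx => abs_realPotential_le_sizeConst hx (Ioo_subset_Icc_self hx))
      (fun _ hx => abs_realPotential_le_sizeConst hx (Ioo_subset_Icc_self hx))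
  have i4 : Integrable (fun x => (centredLog x + realPotential x) *
      realPotential (Int.fract (1 / x))) minkowskiMeasure :=
    integrable_mul_of_le (measurable_centredLog.add hV) measurable_realPotential_fract
    (fun x hx => abs_centredLog_add_le hx)
    (fun x hx => abs_realPotential_le_sizeConst hx (fract_mem _))
  have i5 := integrable_mul_of_le measurable_realPotential_fract
    measurable_realPotential_fract
    (fun x hx => abs_realPotential_le_sizeConst hx (fract_mem _))
    (fun x hx => abs_realPotential_le_sizeConst hx (fract_mem _))
  have e : (fun x => (centredLog x + coboundary x) ^ 2) =ᵐ[minkowskiMeasure] fun x =>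
      (((centredLog x * centredLog x + 2 * (centredLog x * realPotential x)) +
        realPotential x * realPotential x) -
        2 * ((centredLog x + realPotential x) * realPotential (Int.fract (1 / x)))) +
        realPotential (Int.fract (1 / x)) * realPotential (Int.fract (1 / x)) := by
    filter_upwards [coboundary_ae] with x hx
    rw [hx]
    ring
  have j1 : Integrable (fun x => centredLog x * centredLog x +
      2 * (centredLog x * realPotential x)) minkowskiMeasure := i1.add (i2.const_mul 2)
  have j2 : Integrable (fun x => (centredLog x * centredLog x +
      2 * (centredLog x * realPotential x)) + realPotential x * realPotential x)
      minkowskiMeasure := j1.add i3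
  have j3 : Integrable (fun x => ((centredLog x * centredLog x +
      2 * (centredLog x * realPotential x)) + realPotential x * realPotential x) -
      2 * ((centredLog x + realPotential x) * realPotential (Int.fract (1 / x))))
      minkowskiMeasure := j2.sub (i4.const_mul 2)
  refine ⟨(j3.add i5).congr e.symm, ?_⟩
  rw [integral_congr_ae e, integral_add j3 i5, integral_sub j2 (i4.const_mul 2), integral_add j1 i3,
    integral_add i1 (i2.const_mul 2), integral_const_mul, integral_const_mul]
  rw [integral_centredLog_add_mul_realPotential_fract, integral_realPotential_fract_sq]
  ring

/-- If the integral vanished, one could fix a single `t` for which `L + ψ = ψ∘G` holds on every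
branch. As `|ψ| ≤ 1`, the quantity `(n + 1) α - log(n + 1 + t)` would be bounded by `2` for all `n`,
which logarithmic growth forbids. -/
lemma integral_coboundary_sq_pos :
    0 < ∫ x, (centredLog x + coboundary x) ^ 2 ∂minkowskiMeasure := by
  refine lt_of_le_of_ne (integral_nonneg fun x => sq_nonneg _) fun h0 => ?_
  have h1 := (integral_eq_zero_iff_of_nonneg (fun x => sq_nonneg (centredLog x + coboundary x))
    integrable_and_integral_coboundary_sq.1).1 h0.symm
  have h2 : ∀ᵐ x ∂minkowskiMeasure,
      (centredLog x + realPotential x) - realPotential (Int.fract (1 / x)) = 0 := by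
    filter_upwards [h1, coboundary_ae] with x hx hx2
    rw [← hx2]
    exact pow_eq_zero_iff two_ne_zero |>.1 hx
  have h3 : ∀ᵐ t ∂minkowskiMeasure, ∀ n : ℕ, (centredLog (realBranch n t) +
      realPotential (realBranch n t)) - realPotential (Int.fract (1 / realBranch n t)) = 0 :=
    ae_all_iff.2 fun n => ae_comp_realBranch h2 n
  obtain ⟨t, ht, ht2⟩ := (ae_minkowski_mem_Ioo.and h3).exists
  have hb (n : ℕ) : |(n + 1) * minkowskiAlpha - Real.log (n + 1 + t)| ≤ 2 := by
    have h4 := ht2 n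
    rw [fract_one_div_realBranch n (Ioo_subset_Ico_self ht), centredLog_realBranch n ht] at h4
    have h5 := abs_le.1 (abs_realPotential_le (realBranch_mem n (Ioo_subset_Icc_self ht)))
    have h6 := abs_le.1 (abs_realPotential_le (Ioo_subset_Icc_self ht))
    rw [abs_le]
    constructor <;> linarith [h5.1, h5.2, h6.1, h6.2]
  obtain ⟨n, hn⟩ := exists_nat_gt (Real.exp 7)
  have t0 := ht.1
  have hm : 0 < (n : ℝ) + 1 + t := by positivity
  have b1 := abs_le.1 (hb n)
  -- Passing from `n` to `2n + 1` doubles `n + 1`: subtracting twice the first estimate eliminates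
  -- `α` and gives `log(n + 1 + t) ≤ 6 + log 2 < 7`, against the choice of `n`.
  have b2 := abs_le.1 (hb (2 * n + 1))
  have l1 : Real.log ((2 * n + 1 : ℕ) + 1 + t) ≤ Real.log 2 + Real.log (n + 1 + t) := by
    rw [← Real.log_mul (by norm_num) hm.ne']
    refine Real.log_le_log (by positivity) ?_
    push_cast
    linarith
  have l2 : 7 < Real.log (n + 1 + t) := by
    rw [Real.lt_log_iff_exp_lt hm]
    linarith
  have l3 := Real.log_two_lt_d9
  push_cast at b2 l1
  linarith [b1.1, b1.2, b2.1, b2.2]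

lemma integrable_prod_centredLog :
    Integrable (fun p : ℝ × ℝ => centredLog p.1 * Real.log (1 + p.1 * p.2))
      (minkowskiMeasure.prod minkowskiMeasure) := by
  have h1 : Integrable centredLog minkowskiMeasure :=
    integrable_log.add (integrable_floor.const_mul _)
  have h2 : Integrable (fun p : ℝ × ℝ => centredLog p.1) (minkowskiMeasure.prod minkowskiMeasure) :=
    h1.comp_fst minkowskiMeasure
  have hm : Measurable fun p : ℝ × ℝ => centredLog p.1 * Real.log (1 + p.1 * p.2) :=
    (measurable_centredLog.comp measurable_fst).mul (by fun_prop)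
  refine h2.norm.mono' hm.aestronglyMeasurable ?_
  filter_upwards [Measure.quasiMeasurePreserving_fst.ae ae_minkowski_mem_Ioo,
    Measure.quasiMeasurePreserving_snd.ae ae_minkowski_mem_Ioo] with p hp1 hp2
  have := log_one_add_mul_mem (Ioo_subset_Icc_self hp1) (Ioo_subset_Icc_self hp2)
  rw [norm_mul, Real.norm_of_nonneg this.1]
  exact mul_le_of_le_one_right (norm_nonneg _) this.2

/-- Fubini: with `y` integrated first, the inner integral of `log(1 + xy)` is `-ψ(x)`. -/
lemma integral_integral_centredLog :
    ∫ y, ∫ x, centredLog x * Real.log (1 + x * y) ∂minkowskiMeasure ∂minkowskiMeasure =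
      -∫ x, centredLog x * realPotential x ∂minkowskiMeasure := by
  rw [← integral_integral_swap (f := fun x y => centredLog x * Real.log (1 + x * y))
    integrable_prod_centredLog, ← integral_neg]
  refine integral_congr_ae ?_
  filter_upwards [ae_minkowski_mem_Ioo] with x hx
  rw [integral_const_mul, realPotential_eq (Ioo_subset_Icc_self hx)]
  ring

lemma integral_digitLog_mul_potential :
    ∫ x, digitLog minkowskiAlpha x * potential.1 (realPt x) ∂minkowskiMeasure =
      ((∫ x, centredLog x * realPotential x ∂minkowskiMeasure : ℝ) : ℂ) := by
  rw [← integral_complex_ofReal]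
  refine integral_congr_ae ?_
  filter_upwards [ae_minkowski_mem_Ioo] with x hx
  rw [digitLog_minkowskiAlpha, ← ofReal_realPotential (Ioo_subset_Icc_self hx)]
  push_cast
  rfl

lemma integral_digitLog_sq :
    ∫ x, digitLog minkowskiAlpha x ^ 2 ∂minkowskiMeasure =
      ((∫ x, centredLog x * centredLog x ∂minkowskiMeasure : ℝ) : ℂ) := by
  rw [← integral_complex_ofReal]
  refine integral_congr_ae (ae_of_all _ fun x => ?_)
  simp only [digitLog_minkowskiAlpha]
  push_cast
  ring

/-- The derivatives at `0` of the logarithm of an analytic solution. -/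
lemma IsAnalyticSolution.derivs {M δ₀ δ η : ℝ} {ρ : ℂ → ℂ}
    (h : ∀ τ z : ℂ, ‖τ‖ ≤ δ₀ → ‖z - 1 / 2‖ ≤ δ₀ →
      GoodPerturbation minkowskiFunctional Hinf.one (restOpAt τ z) (7 / 6) M)
    (hδ₀ : δ₀ ≤ 1 / 10) (hδ : δ ≤ δ₀) (hρ : IsAnalyticSolution δ η ρ) :
    deriv (fun τ => Complex.log (ρ τ)) 0 = minkowskiAlpha ∧
    iteratedDeriv 2 (fun τ => Complex.log (ρ τ)) 0 =
      ((-(1 / 2) * (∫ x, centredLog x * centredLog x ∂minkowskiMeasure) -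
        ∫ x, centredLog x * realPotential x ∂minkowskiMeasure : ℝ) : ℂ) := by
  have h0 := hρ.apply_zero h hδ₀ hδ
  have hρa : AnalyticAt ℂ ρ 0 := hρ.analytic 0 (by simpa using hρ.pos.le)
  have hq : AnalyticAt ℂ (fun τ => Complex.log (ρ τ)) 0 :=
    hρa.clog (by rw [h0]; left; norm_num)
  have hne : ∀ᶠ τ in 𝓝 (0 : ℂ), ρ τ ≠ 0 :=
    hρa.continuousAt.eventually_ne (by rw [h0]; norm_num)
  have hball : ∀ᶠ τ in 𝓝 (0 : ℂ), ‖τ‖ ≤ η := by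
    filter_upwards [Metric.closedBall_mem_nhds (0 : ℂ) hρ.pos] with τ hτ
    simpa using hτ
  have hgood : ∀ τ : ℂ, ‖τ‖ ≤ η →
      GoodPerturbation minkowskiFunctional Hinf.one (restOpAt τ (ρ τ)) (7 / 6) M := fun τ hτ =>
    h τ (ρ τ) ((hτ.trans hρ.le).trans hδ) ((hρ.near_half τ hτ).trans hδ)
  obtain ⟨d1, d2⟩ := deriv_log_solution hq (s := 7 / 6) (M := M)
    (by simp only [h0]; rw [Complex.exp_log (by norm_num)])
    (by
      filter_upwards [hne, hball] with τ hτ hτ2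
      rw [Complex.exp_log hτ]
      exact hgood τ hτ2)
    (by
      filter_upwards [hne, hball] with τ hτ hτ2
      rw [Complex.exp_log hτ]
      exact (hgood τ hτ2).dominantEigenvalue_eq_one_iff.1 (hρ.eq_one τ hτ2))
  refine ⟨d1, ?_⟩
  rw [iteratedDeriv_succ, iteratedDeriv_one, d2, integral_digitLog_mul_potential,
    integral_digitLog_sq]
  push_cast
  rfl

end

theorem mainTheorem4 :
    -- the integrals are convergent
    IntegrableOn Real.log (Ioc (0 : ℝ) 1) minkowskiMeasure ∧
    IntegrableOn (fun x => centredLog x ^ 2) (Icc (0 : ℝ) 1) minkowskiMeasure ∧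
    Integrable (fun p : ℝ × ℝ => centredLog p.1 * Real.log (1 + p.1 * p.2))
      ((minkowskiMeasure.restrict (Icc (0 : ℝ) 1)).prod
        (minkowskiMeasure.restrict (Icc (0 : ℝ) 1))) ∧
    (∀ x ∈ Icc (0 : ℝ) 1,
      IntegrableOn (fun y => Real.log ((1 + y * Int.fract (1 / x)) / (1 + y * x)))
        (Icc (0 : ℝ) 1) minkowskiMeasure) ∧
    IntegrableOn (fun x => (centredLog x + coboundary x) ^ 2) (Icc (0 : ℝ) 1) minkowskiMeasure ∧
    ∃ δ₀ : ℝ, 0 < δ₀ ∧ ∀ δ : ℝ, 0 < δ → δ ≤ δ₀ →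
      -- the function `λ` is well defined near `(0, 1/2)`
      (∀ τ z : ℂ, ‖τ‖ ≤ δ → ‖z - 1 / 2‖ ≤ δ →
        IsSimpleDominantEigenvalue (transferOp τ z) (dominantEigenvalue τ z)) ∧
      -- there is an analytic solution `ρ` of `λ(τ, ρ(τ)) = 1`
      (∃ (η : ℝ) (ρ : ℂ → ℂ), IsAnalyticSolution δ η ρ) ∧
      -- and every one of them has the stated first and second order behaviour at `0`
      ∀ (η : ℝ) (ρ : ℂ → ℂ), IsAnalyticSolution δ η ρ →
        ρ 0 = 1 / 2 ∧
        Complex.log (2 * ρ 0) = 0 ∧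
        deriv (fun τ => Complex.log (ρ τ)) 0 = (minkowskiAlpha : ℂ) ∧
        (∃ v : ℝ, v < 0 ∧ iteratedDeriv 2 (fun τ => Complex.log (ρ τ)) 0 = (v : ℂ)) ∧
        iteratedDeriv 2 (fun τ => Complex.log (ρ τ)) 0 =
          ((-(1 / 2) * (∫ x in Icc (0 : ℝ) 1, centredLog x ^ 2 ∂minkowskiMeasure) +
            ∫ y in Icc (0 : ℝ) 1, ∫ x in Icc (0 : ℝ) 1,
              centredLog x * Real.log (1 + x * y) ∂minkowskiMeasure ∂minkowskiMeasure : ℝ) : ℂ) ∧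
        iteratedDeriv 2 (fun τ => Complex.log (ρ τ)) 0 =
          ((-(1 / 2) * ∫ x in Icc (0 : ℝ) 1,
              (centredLog x + coboundary x) ^ 2 ∂minkowskiMeasure : ℝ) : ℂ) := by
  simp only [IntegrableOn, minkowskiMeasure_restrict_Icc,
    minkowskiMeasure_restrict_Ioc]
  refine ⟨integrable_log, by simpa only [sq] using integrable_centredLog_sq,
    integrable_prod_centredLog, fun x hx => ?_, integrable_and_integral_coboundary_sq.1, ?_⟩
  · simpa only [IntegrableOn, minkowskiMeasure_restrict_Icc] using (coboundary_eq hx).1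
  obtain ⟨M, δ₀, hδ₀, hδ₁, h⟩ := exists_goodPerturbation
  refine ⟨δ₀, hδ₀, fun δ hδ hle => ⟨fun τ z hτ hz => ?_, ?_, fun η ρ hρ => ?_⟩⟩
  · exact (h τ z (hτ.trans hle) (hz.trans hle)).dominantEigenvalue_spec
  · exact exists_isAnalyticSolution h hδ hle
  have h0 : ρ 0 = 1 / 2 := IsAnalyticSolution.apply_zero h hδ₁ hle hρ
  obtain ⟨d1, d2⟩ := IsAnalyticSolution.derivs h hδ₁ hle hρ
  have e := integrable_and_integral_coboundary_sq.2
  have d3 : iteratedDeriv 2 (fun τ => Complex.log (ρ τ)) 0 =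
      ((-(1 / 2) * ∫ x, (centredLog x + coboundary x) ^ 2 ∂minkowskiMeasure : ℝ) : ℂ) := by
    rw [d2, e]
    congr 1
    ring
  refine ⟨h0, by rw [h0]; norm_num, d1, ⟨_, ?_, d3⟩, ?_, d3⟩
  · linarith [integral_coboundary_sq_pos]
  · rw [d2, integral_integral_centredLog]
    simp only [sq, sub_eq_add_neg]
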